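/- **Theorem (uniform hard capacities with outliers).** There is a polynomial-time $10$-approximation algorithm for the $(L,U,\emptyset,p)$-Center problem with hard uniform capacities and outliers. Here an instance consists of a finite vertex set $V$ with $|V|=n$, a symmetric distance function $d:V\times V\to\mathbb{R}_{\ge 0}$ satisfying the triangle inequality, and integers $L,U,p\ge 0$ with $L\le U$. A feasible solution is a triple $(C,F,\varphi)$ consisting of a set $C\subseteq V$ of served vertices with $|C|\ge p$, a set $F\subseteq V$ of open centers (of arbitrary size, with at most one center open at each vertex), and a map $\varphi:C\to F$ such that $L\le|\varphi^{-1}(u)|\le U$ for every $u\in F$. Its radius is $\max_{v\in C}d(v,\varphi(v))$ (and $0$ if $C=\emptyset$). Precisely: there are a single algorithm (a random access machine program that adds, subtracts and compares integers at unit cost, and accesses the real distances only by comparing them with each other) and a polynomial $P$ such that, on every instance, the algorithm halts after at most $P(n)$ steps, and, if the instance has a feasible solution, it outputs a feasible solution $(C,F,\varphi)$ whose radius is at most $10$ times the radius of every feasible solution of the instance. -/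

import Mathlib

open scoped NNReal

namespace CapCenter

/-! ### The capacitated center problem -/

/-- An instance of capacitated center with uniform capacity interval `[L, U]`, hard capacities,
outliers and no bound on the number of centers. The vertex set is `Fin n`; each vertex is both a
client and a potential center, and at least `p` vertices have to be served. The distance function
is symmetric and satisfies the triangle inequality. -/
structure Instance (n : ℕ) where
  L : ℕ
  U : ℕ
  p : ℕ
  L_le_U : L ≤ U
  dist : Fin n → Fin n → ℝ≥0
  dist_symm : ∀ u v, dist u v = dist v u
  dist_triangle : ∀ u v w, dist u w ≤ dist u v + dist v w

/-- A tuple `(C, F, φ)`: the served vertices, the open centers, and the assignment. Only the values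
of `φ` on `C` matter. As `F` is a set, at most one center is opened at a vertex. -/
structure Solution (n : ℕ) where
  C : Finset (Fin n)
  F : Finset (Fin n)
  φ : Fin n → Fin n

namespace Instance

variable {n : ℕ}

/-- `φ` maps `C` to `F`, at least `p` vertices are served, and every open center serves
at least `L` and at most `U` vertices. -/
structure Feasible (I : Instance n) (S : Solution n) : Prop where
  mapsTo : ∀ v ∈ S.C, S.φ v ∈ S.F
  card_served : I.p ≤ S.C.card
  lower : ∀ u ∈ S.F, I.L ≤ (S.C.filter fun v => S.φ v = u).card
  upper : ∀ u ∈ S.F, (S.C.filter fun v => S.φ v = u).card ≤ I.U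

/-- The maximum cluster radius `max_{v ∈ C} d(v, φ(v))` (it is `0` if `C` is empty). -/
noncomputable def radius (I : Instance n) (S : Solution n) : ℝ≥0 :=
  S.C.sup fun v => I.dist v (S.φ v)

/-- A feasible solution whose radius is at most `ρ` times that of every feasible solution. -/
def IsApprox (I : Instance n) (ρ : ℝ≥0) (S : Solution n) : Prop :=
  I.Feasible S ∧ ∀ T : Solution n, I.Feasible T → I.radius S ≤ ρ * I.radius T

end Instance

/-! ### A random access machine with a step count

Programs work on integer variables and on integer arrays with computed indices. The operations on
integers are addition, (truncated) subtraction and comparison. There is no multiplication, so that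
the bit length of a number grows by at most one per operation, and unit costs are polynomially
related to bit costs. The real distances are a read-only part of the input that
can only be compared with each other. -/

/-- `read a e` is the entry of array `a` at index `e`. -/
inductive Expr where
  | const (c : ℕ)
  | var (x : ℕ)
  | read (a : ℕ) (e : Expr)
  | add (e₁ e₂ : Expr)
  | sub (e₁ e₂ : Expr)

/-- `distLE e₁ e₂ e₃ e₄` tests whether `d(e₁, e₂) ≤ d(e₃, e₄)`. -/
inductive Test where
  | le (e₁ e₂ : Expr)
  | distLE (e₁ e₂ e₃ e₄ : Expr)
  | not (b : Test)
  | and (b₁ b₂ : Test)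

/-- `assign x e` sets variable `x` to `e`; `store a e₁ e₂` sets entry `e₁` of array `a` to `e₂`. -/
inductive Prog where
  | skip
  | assign (x : ℕ) (e : Expr)
  | store (a : ℕ) (e₁ e₂ : Expr)
  | seq (c₁ c₂ : Prog)
  | ite (b : Test) (c₁ c₂ : Prog)
  | while (b : Test) (c : Prog)

/-- The memory: the value of each variable, and of each entry of each array. -/
structure State where
  var : ℕ → ℕ
  arr : ℕ → ℕ → ℕ

namespace Expr

def eval (s : State) : Expr → ℕ
  | const c => c
  | var x => s.var x
  | read a e => s.arr a (e.eval s)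
  | add e₁ e₂ => e₁.eval s + e₂.eval s
  | sub e₁ e₂ => e₁.eval s - e₂.eval s

/-- The number of elementary operations. -/
def cost : Expr → ℕ
  | const _ => 1
  | var _ => 1
  | read _ e => e.cost + 1
  | add e₁ e₂ => e₁.cost + e₂.cost + 1
  | sub e₁ e₂ => e₁.cost + e₂.cost + 1

end Expr

namespace Test

/-- A comparison of distances fails if one of its indices is not a vertex. -/
def eval {n : ℕ} (I : Instance n) (s : State) : Test → Prop
  | le e₁ e₂ => e₁.eval s ≤ e₂.eval s
  | distLE e₁ e₂ e₃ e₄ => ∃ u₁ u₂ u₃ u₄ : Fin n,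
      (u₁ : ℕ) = e₁.eval s ∧ (u₂ : ℕ) = e₂.eval s ∧ (u₃ : ℕ) = e₃.eval s ∧ (u₄ : ℕ) = e₄.eval s ∧
        I.dist u₁ u₂ ≤ I.dist u₃ u₄
  | not b => ¬ b.eval I s
  | and b₁ b₂ => b₁.eval I s ∧ b₂.eval I s

/-- The number of elementary operations. -/
def cost : Test → ℕ
  | le e₁ e₂ => e₁.cost + e₂.cost + 1
  | distLE e₁ e₂ e₃ e₄ => e₁.cost + e₂.cost + e₃.cost + e₄.cost + 1
  | not b => b.cost + 1
  | and b₁ b₂ => b₁.cost + b₂.cost + 1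

end Test

namespace State

/-- Variable `x` is set to `k`. -/
def setVar (s : State) (x k : ℕ) : State :=
  { s with var := Function.update s.var x k }

/-- Entry `i` of array `a` is set to `k`. -/
def setArr (s : State) (a i k : ℕ) : State :=
  { s with arr := Function.update s.arr a (Function.update (s.arr a) i k) }

/-- The output that is found in the final memory: array `0` marks the served vertices, array `1`
marks the open centers, and array `2` holds the assignment of the served vertices. -/
structure Outputs {n : ℕ} (s : State) (S : Solution n) : Prop where
  served : ∀ v : Fin n, v ∈ S.C ↔ s.arr 0 v = 1
  opened : ∀ u : Fin n, u ∈ S.F ↔ s.arr 1 u = 1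
  assigned : ∀ v ∈ S.C, (S.φ v : ℕ) = s.arr 2 v

end State

/-- The initial memory: variables `0`, `1`, `2`, `3` hold `n`, `L`, `U`, `p`, and the rest is `0`. -/
def Instance.initState {n : ℕ} (I : Instance n) : State where
  var x := if x = 0 then n else if x = 1 then I.L else if x = 2 then I.U
    else if x = 3 then I.p else 0
  arr _ _ := 0

/-- `c.Exec I s s' t`: on the instance `I`, the program `c`, started in memory `s`,
halts after `t` steps in memory `s'`. -/
inductive Prog.Exec {n : ℕ} (I : Instance n) : Prog → State → State → ℕ → Prop where
  | skip (s : State) : Prog.Exec I .skip s s 1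
  | assign (x : ℕ) (e : Expr) (s : State) :
      Prog.Exec I (.assign x e) s (s.setVar x (e.eval s)) (e.cost + 1)
  | store (a : ℕ) (e₁ e₂ : Expr) (s : State) :
      Prog.Exec I (.store a e₁ e₂) s (s.setArr a (e₁.eval s) (e₂.eval s)) (e₁.cost + e₂.cost + 1)
  | seq {c₁ c₂ : Prog} {s s' s'' : State} {t₁ t₂ : ℕ} :
      Prog.Exec I c₁ s s' t₁ → Prog.Exec I c₂ s' s'' t₂ →
      Prog.Exec I (.seq c₁ c₂) s s'' (t₁ + t₂)
  | ite_true {b : Test} {c₁ c₂ : Prog} {s s' : State} {t : ℕ} :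
      b.eval I s → Prog.Exec I c₁ s s' t → Prog.Exec I (.ite b c₁ c₂) s s' (b.cost + t + 1)
  | ite_false {b : Test} {c₁ c₂ : Prog} {s s' : State} {t : ℕ} :
      ¬ b.eval I s → Prog.Exec I c₂ s s' t → Prog.Exec I (.ite b c₁ c₂) s s' (b.cost + t + 1)
  | while_true {b : Test} {c : Prog} {s s' s'' : State} {t₁ t₂ : ℕ} :
      b.eval I s → Prog.Exec I c s s' t₁ → Prog.Exec I (.while b c) s' s'' t₂ →
      Prog.Exec I (.while b c) s s'' (b.cost + t₁ + t₂ + 1)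
  | while_false {b : Test} {c : Prog} {s : State} :
      ¬ b.eval I s → Prog.Exec I (.while b c) s s (b.cost + 1)

/-- Programs are deterministic: the final memory and the number of steps are unique. -/
theorem Prog.Exec.unique {n : ℕ} {I : Instance n} {c : Prog} {s s₁ s₂ : State} {t₁ t₂ : ℕ}
    (h₁ : Prog.Exec I c s s₁ t₁) (h₂ : Prog.Exec I c s s₂ t₂) : s₁ = s₂ ∧ t₁ = t₂ := by
  induction h₁ generalizing s₂ t₂ with
  | skip => cases h₂; exact ⟨rfl, rfl⟩
  | assign => cases h₂; exact ⟨rfl, rfl⟩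
  | store => cases h₂; exact ⟨rfl, rfl⟩
  | seq _ _ ih₁ ih₂ =>
    cases h₂ with
    | seq k₁ k₂ =>
      obtain ⟨rfl, rfl⟩ := ih₁ k₁
      obtain ⟨rfl, rfl⟩ := ih₂ k₂
      exact ⟨rfl, rfl⟩
  | ite_true hb _ ih =>
    cases h₂ with
    | ite_true _ k => obtain ⟨rfl, rfl⟩ := ih k; exact ⟨rfl, rfl⟩
    | ite_false kb _ => exact absurd hb kb
  | ite_false hb _ ih =>
    cases h₂ with
    | ite_true kb _ => exact absurd kb hb
    | ite_false _ k => obtain ⟨rfl, rfl⟩ := ih k; exact ⟨rfl, rfl⟩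
  | while_true hb _ _ ih₁ ih₂ =>
    cases h₂ with
    | while_true _ k₁ k₂ =>
      obtain ⟨rfl, rfl⟩ := ih₁ k₁
      obtain ⟨rfl, rfl⟩ := ih₂ k₂
      exact ⟨rfl, rfl⟩
    | while_false kb => exact absurd hb kb
  | while_false hb =>
    cases h₂ with
    | while_true kb _ _ => exact absurd kb hb
    | while_false _ => exact ⟨rfl, rfl⟩

end CapCenter

/-! An optimal radius is some distance d(a, b), unless nothing has to be served. So it suffices to
build, for each pair with r = d(a, b), clusters of diameter at most 10 r that serve at least as many
vertices as every solution of radius at most r, and to keep the best pair that serves p vertices. L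
is replaced by max(L, 1), which every nonempty cluster satisfies anyway. The center of a nonempty
cluster of a solution of radius at most r is big: at least L vertices lie within distance r of it.

Two vertices touch if their r-balls meet. Cores are chosen greedily among the big vertices so that
no two touch, and a big vertex is covered by the first core that it touches. A new core is taken
next to the covered region whenever possible (`CoreChoice`). It then has a parent core at distance
at most 4r, and touching big vertices always end up in the same tree of cores (`CoreInv`). A vertex
within r of a big vertex is given to a core covering such a big vertex, at distance at most 3r, and
each core keeps its own ball of at least L vertices. Every cluster of a solution of radius at most r
lies among the vertices of a single tree. Hence such a solution serves at most min(M, ⌊M/L⌋ U) of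
the M vertices of a tree (`card_served_le`).

This bound is attained by moving vertices along tree edges (`Allotment`). From the leaves to the
root, core t makes k t groups of L from its own vertices and those received, and hands the remainder
c t < L to its parent. The remainder at the root is then given back, e t to core t, as far as the
spare capacity k t (U - L) permits; let E t be the total of e over the subtree of t. Only the
difference of c t and E t crosses the edge above t, in one direction. Either everything gets served,
or all clusters are full (`Allotment.served_ge`). The decisive inequality is `Allotment.out_lt`:
fewer than L vertices leave each core. They can therefore all be taken from its own ball, no vertex
moves twice, and a moved vertex is within r + 4r = 5r of its new core (`near_core`), so that each
class has diameter at most 10 r.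

Finally a class is divided by rank modulo k t. The parts have sizes between L and U, and the first k
t vertices of the class are their centers, so the centers are distinct vertices of the class itself
(`Clustering.feasible`).

For the running time, the algorithm is written in a language whose only loops run over 0, …, n - 1,
and compiled to the machine. The step bound is then a polynomial in n read off from the syntax,
whatever the size of L, U and p. Products and quotients are bounded sums; this is enough because one
factor, or the quotient, is at most n. -/

namespace CapCenter

/-! ### Bounded-loop programs and their simulation in polynomial time. -/

/-! ### A language of bounded loops

All loops run over `0, …, n - 1`, so that every program halts, in polynomial time. -/

/-- `sum x e` is the sum of `e` over all values `x < n`; `le` and `distLE` evaluate to `1` or `0`;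
`ite c a b` is `a` unless `c` is zero. -/
inductive LExpr where
  | const (c : ℕ)
  | var (x : ℕ)
  | read (a : ℕ) (e : LExpr)
  | add (e₁ e₂ : LExpr)
  | sub (e₁ e₂ : LExpr)
  | le (e₁ e₂ : LExpr)
  | distLE (e₁ e₂ e₃ e₄ : LExpr)
  | ite (c e₁ e₂ : LExpr)
  | sum (x : ℕ) (e : LExpr)

inductive LProg where
  | skip
  | assign (x : ℕ) (e : LExpr)
  | store (a : ℕ) (e₁ e₂ : LExpr)
  | seq (c₁ c₂ : LProg)
  | ite (b : LExpr) (c₁ c₂ : LProg)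
  | loop (x : ℕ) (c : LProg)

/-- The comparison of distances of the machine, with indices that need not be vertices. -/
def Instance.DistLE {n : ℕ} (I : Instance n) (x₁ x₂ x₃ x₄ : ℕ) : Prop :=
  ∃ u₁ u₂ u₃ u₄ : Fin n, (u₁ : ℕ) = x₁ ∧ (u₂ : ℕ) = x₂ ∧ (u₃ : ℕ) = x₃ ∧ (u₄ : ℕ) = x₄ ∧
    I.dist u₁ u₂ ≤ I.dist u₃ u₄

open Classical in
noncomputable def LExpr.eval {n : ℕ} (I : Instance n) : LExpr → State → ℕ
  | const c, _ => c
  | var x, s => s.var x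
  | read a e, s => s.arr a (e.eval I s)
  | add e₁ e₂, s => e₁.eval I s + e₂.eval I s
  | sub e₁ e₂, s => e₁.eval I s - e₂.eval I s
  | le e₁ e₂, s => if e₁.eval I s ≤ e₂.eval I s then 1 else 0
  | distLE e₁ e₂ e₃ e₄, s =>
      if I.DistLE (e₁.eval I s) (e₂.eval I s) (e₃.eval I s) (e₄.eval I s) then 1 else 0
  | ite c e₁ e₂, s => if c.eval I s ≠ 0 then e₁.eval I s else e₂.eval I s
  | sum x e, s => ∑ i ∈ Finset.range n, e.eval I (s.setVar x i)

/-- The state after `m` rounds of the loop over `x` with body `f`. -/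
def State.iter (x : ℕ) (f : State → State) (s : State) : ℕ → State
  | 0 => s
  | m + 1 => f ((State.iter x f s m).setVar x m)

noncomputable def LProg.run {n : ℕ} (I : Instance n) : LProg → State → State
  | skip, s => s
  | assign x e, s => s.setVar x (e.eval I s)
  | store a e₁ e₂, s => s.setArr a (e₁.eval I s) (e₂.eval I s)
  | seq c₁ c₂, s => c₂.run I (c₁.run I s)
  | ite b c₁ c₂, s => if b.eval I s ≠ 0 then c₁.run I s else c₂.run I s
  | loop x c, s => (State.iter x (c.run I) s n).setVar x n

/-- The variables that a program may change. -/
def LProg.setsVar : LProg → ℕ → Bool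
  | skip, _ => false
  | assign x _, y => x == y
  | store _ _ _, _ => false
  | seq c₁ c₂, y => c₁.setsVar y || c₂.setsVar y
  | ite _ c₁ c₂, y => c₁.setsVar y || c₂.setsVar y
  | loop x c, y => x == y || c.setsVar y

/-- The arrays that a program may change. -/
def LProg.setsArr : LProg → ℕ → Bool
  | skip, _ => false
  | assign _ _, _ => false
  | store a _ _, b => a == b
  | seq c₁ c₂, y => c₁.setsArr y || c₂.setsArr y
  | ite _ c₁ c₂, y => c₁.setsArr y || c₂.setsArr y
  | loop _ c, y => c.setsArr y

/-- All variables are below `D`, and the variable `0` is not bound. -/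
def LExpr.ok (D : ℕ) : LExpr → Bool
  | const _ => true
  | var x => x < D
  | read _ e => e.ok D
  | add e₁ e₂ => e₁.ok D && e₂.ok D
  | sub e₁ e₂ => e₁.ok D && e₂.ok D
  | le e₁ e₂ => e₁.ok D && e₂.ok D
  | distLE e₁ e₂ e₃ e₄ => e₁.ok D && e₂.ok D && e₃.ok D && e₄.ok D
  | ite c e₁ e₂ => c.ok D && e₁.ok D && e₂.ok D
  | sum x e => 0 < x && x < D && e.ok D

/-- All variables are below `D`, the variable `0` is not changed, and a loop variable is not
changed in the body of its loop. -/
def LProg.ok (D : ℕ) : LProg → Bool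
  | skip => true
  | assign x e => 0 < x && x < D && e.ok D
  | store _ e₁ e₂ => e₁.ok D && e₂.ok D
  | seq c₁ c₂ => c₁.ok D && c₂.ok D
  | ite b c₁ c₂ => b.ok D && c₁.ok D && c₂.ok D
  | loop x c => 0 < x && x < D && !c.setsVar x && c.ok D

/-! ### Basic facts about memories -/

namespace State

@[simp] theorem setVar_arr (s : State) (x k : ℕ) : (s.setVar x k).arr = s.arr := rfl

@[simp] theorem setArr_var (s : State) (a i k : ℕ) : (s.setArr a i k).var = s.var := rfl

theorem setVar_var (s : State) (x k y : ℕ) :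
    (s.setVar x k).var y = if y = x then k else s.var y := by
  simp [setVar, Function.update_apply]

@[simp] theorem setVar_var_self (s : State) (x k : ℕ) : (s.setVar x k).var x = k := by
  simp [setVar]

theorem setVar_var_ne (s : State) {x y : ℕ} (k : ℕ) (h : y ≠ x) :
    (s.setVar x k).var y = s.var y := by
  simp [setVar_var, h]

theorem setArr_arr (s : State) (a i k b : ℕ) :
    (s.setArr a i k).arr b = if b = a then Function.update (s.arr a) i k else s.arr b := by
  simp [setArr, Function.update_apply]

/-- Two memories with the same arrays, and the same variables below `D`. -/
structure Agree (D : ℕ) (s s' : State) : Prop where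
  arr : s.arr = s'.arr
  var : ∀ x < D, s.var x = s'.var x

namespace Agree

variable {D : ℕ} {s s' s'' : State}

theorem refl (D : ℕ) (s : State) : Agree D s s := ⟨rfl, fun _ _ => rfl⟩

theorem trans (h : Agree D s s') (h' : Agree D s' s'') : Agree D s s'' :=
  ⟨h.arr.trans h'.arr, fun x hx => (h.var x hx).trans (h'.var x hx)⟩

theorem mono {D' : ℕ} (h : Agree D s s') (hD : D' ≤ D) : Agree D' s s' :=
  ⟨h.arr, fun x hx => h.var x (hx.trans_le hD)⟩

theorem setVar (h : Agree D s s') (x k : ℕ) : Agree D (s.setVar x k) (s'.setVar x k) :=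
  ⟨h.arr, fun y hy => by simp only [setVar_var, h.var y hy]⟩

theorem setArr (h : Agree D s s') (a i k : ℕ) : Agree D (s.setArr a i k) (s'.setArr a i k) := by
  refine ⟨funext fun b => ?_, h.var⟩
  simp only [setArr_arr, h.arr]

theorem setVar_left (h : Agree D s s') {x : ℕ} (k : ℕ) (hx : D ≤ x) : Agree D (s.setVar x k) s' :=
  ⟨h.arr, fun y hy => by rw [setVar_var_ne _ _ (by omega), h.var y hy]⟩

end Agree

end State

/-! ### Compilation -/

/-- The loop over `x = 0, …, n - 1`. -/
def Prog.forLoop (x : ℕ) (c : Prog) : Prog :=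
  .seq (.assign x (.const 0))
    (.while (.not (.le (.var 0) (.var x))) (.seq c (.assign x (.add (.var x) (.const 1)))))

/-- The program halts within `T` steps in a memory with property `Q`. -/
def Prog.Reaches {n : ℕ} (I : Instance n) (c : Prog) (s : State) (T : ℕ) (Q : State → Prop) :
    Prop :=
  ∃ s' t, Prog.Exec I c s s' t ∧ t ≤ T ∧ Q s'

namespace Prog.Reaches

variable {n : ℕ} {I : Instance n} {c c₁ c₂ : Prog} {s : State} {T T₁ T₂ : ℕ} {Q R : State → Prop}

theorem mono (h : Reaches I c s T Q) (hT : T ≤ T₁) (hQ : ∀ s', Q s' → R s') :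
    Reaches I c s T₁ R := by
  obtain ⟨s', t, h, ht, hs⟩ := h
  exact ⟨s', t, h, ht.trans hT, hQ _ hs⟩

theorem seq (h₁ : Reaches I c₁ s T₁ Q) (h₂ : ∀ s', Q s' → Reaches I c₂ s' T₂ R) :
    Reaches I (.seq c₁ c₂) s (T₁ + T₂) R := by
  obtain ⟨s', t, h, ht, hs⟩ := h₁
  obtain ⟨s'', t', h', ht', hs'⟩ := h₂ _ hs
  exact ⟨s'', t + t', .seq h h', by omega, hs'⟩

theorem assign (x : ℕ) (e : Expr) (h : Q (s.setVar x (e.eval s))) :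
    Reaches I (.assign x e) s (e.cost + 1) Q :=
  ⟨_, _, .assign x e s, le_rfl, h⟩

theorem ite {b : Test} (h₁ : b.eval I s → Reaches I c₁ s T₁ Q)
    (h₂ : ¬ b.eval I s → Reaches I c₂ s T₂ Q) :
    Reaches I (.ite b c₁ c₂) s (b.cost + T₁ + T₂ + 1) Q := by
  by_cases hb : b.eval I s
  · obtain ⟨s', t, h, ht, hs⟩ := h₁ hb
    exact ⟨s', _, .ite_true hb h, by omega, hs⟩
  · obtain ⟨s', t, h, ht, hs⟩ := h₂ hb
    exact ⟨s', _, .ite_false hb h, by omega, hs⟩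

/-- The invariant refers to the memory in which the counter is already set. A round costs its body
plus 9 steps for test, increment and control; the initialisation and the final test cost 7. -/
theorem forLoop {x : ℕ} (Inv : ℕ → State → Prop) (h₀ : Inv 0 (s.setVar x 0))
    (hvar : ∀ i s, Inv i s → s.var 0 = n ∧ s.var x = i)
    (hstep : ∀ i < n, ∀ s, Inv i s →
      Reaches I c s T fun s' => s'.var x = i ∧ Inv (i + 1) (s'.setVar x (i + 1))) :
    Reaches I (.forLoop x c) s (n * (T + 9) + 7) (Inv n) := by
  have key : ∀ m i, i + m = n → ∀ s, Inv i s →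
      Reaches I (.while (.not (.le (.var 0) (.var x)))
        (.seq c (.assign x (.add (.var x) (.const 1))))) s (m * (T + 9) + 5) (Inv n) := by
    intro m
    induction m with
    | zero =>
      intro i hi s hs
      obtain ⟨h0, hx⟩ := hvar i s hs
      obtain rfl : i = n := by omega
      exact ⟨s, _, .while_false (by simp [Test.eval, Expr.eval, h0, hx]),
        by simp [Test.cost, Expr.cost], hs⟩
    | succ m ih =>
      intro i hi s hs
      obtain ⟨h0, hx⟩ := hvar i s hs
      obtain ⟨s', t, h, ht, hx', hI⟩ := hstep i (by omega) s hs
      obtain ⟨s'', t', h', ht', hI'⟩ := ih (i + 1) (by omega) _ hI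
      have hb : (Test.not (.le (.var 0) (.var x))).eval I s := by
        simp only [Test.eval, Expr.eval, h0, hx]; omega
      have ha := Exec.assign (I := I) x (.add (.var x) (.const 1)) s'
      simp only [Expr.eval, hx'] at ha
      refine ⟨s'', _, .while_true hb (.seq h ha) h', ?_, hI'⟩
      simp only [Test.cost, Expr.cost]
      rw [Nat.succ_mul]
      omega
  obtain ⟨s', t, h, ht, hs⟩ := key n 0 (by omega) _ h₀
  exact ⟨s', _, .seq (.assign x (.const 0) s) h, by simp only [Expr.cost]; omega, hs⟩

end Prog.Reaches

/-- The value of the expression is computed in variable `d`, using variables from `d` on. -/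
def LExpr.comp : LExpr → ℕ → Prog
  | const c, d => .assign d (.const c)
  | var x, d => .assign d (.var x)
  | read a e, d => .seq (e.comp d) (.assign d (.read a (.var d)))
  | add e₁ e₂, d =>
      .seq (e₁.comp d) (.seq (e₂.comp (d + 1)) (.assign d (.add (.var d) (.var (d + 1)))))
  | sub e₁ e₂, d =>
      .seq (e₁.comp d) (.seq (e₂.comp (d + 1)) (.assign d (.sub (.var d) (.var (d + 1)))))
  | le e₁ e₂, d =>
      .seq (e₁.comp d) (.seq (e₂.comp (d + 1))
        (.ite (.le (.var d) (.var (d + 1))) (.assign d (.const 1)) (.assign d (.const 0))))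
  | distLE e₁ e₂ e₃ e₄, d =>
      .seq (e₁.comp d) (.seq (e₂.comp (d + 1)) (.seq (e₃.comp (d + 2)) (.seq (e₄.comp (d + 3))
        (.ite (.distLE (.var d) (.var (d + 1)) (.var (d + 2)) (.var (d + 3)))
          (.assign d (.const 1)) (.assign d (.const 0))))))
  | ite c e₁ e₂, d =>
      .seq (c.comp d) (.ite (.le (.const 1) (.var d)) (e₁.comp d) (e₂.comp d))
  | sum x e, d =>
      .seq (.assign (d + 1) (.var x)) (.seq (.assign d (.const 0)) (.seq
        (.forLoop x (.seq (e.comp (d + 2)) (.assign d (.add (.var d) (.var (d + 2))))))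
        (.assign x (.var (d + 1)))))

/-- The bound depends on `n` alone: a sum has `n` rounds, and all other operations have a fixed
overhead. -/
noncomputable def LExpr.time : LExpr → Polynomial ℕ
  | const _ => 2
  | var _ => 2
  | read _ e => e.time + 3
  | add e₁ e₂ => e₁.time + e₂.time + 4
  | sub e₁ e₂ => e₁.time + e₂.time + 4
  | le e₁ e₂ => e₁.time + e₂.time + 8
  | distLE e₁ e₂ e₃ e₄ => e₁.time + e₂.time + e₃.time + e₄.time + 10
  | ite c e₁ e₂ => c.time + e₁.time + e₂.time + 4
  | sum _ e => .X * (e.time + 13) + 13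

/-- Lets a subexpression be evaluated after intermediate results have been written to variables from
`D` on. -/
theorem LExpr.eval_congr {n : ℕ} (I : Instance n) {D : ℕ} (e : LExpr) (he : e.ok D) {s s' : State}
    (h : s.Agree D s') : e.eval I s = e.eval I s' := by
  induction e generalizing s s' with
  | const c => rfl
  | var x => exact h.var x (by simpa [ok] using he)
  | read a e ih => simp only [eval, ih he h, h.arr]
  | add e₁ e₂ ih₁ ih₂ | sub e₁ e₂ ih₁ ih₂ | le e₁ e₂ ih₁ ih₂ =>
    simp only [ok, Bool.and_eq_true] at he
    simp only [eval, ih₁ he.1 h, ih₂ he.2 h]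
  | distLE e₁ e₂ e₃ e₄ ih₁ ih₂ ih₃ ih₄ =>
    simp only [ok, Bool.and_eq_true] at he
    rw [eval, eval, ih₁ he.1.1.1 h, ih₂ he.1.1.2 h, ih₃ he.1.2 h, ih₄ he.2 h]
  | ite c e₁ e₂ ih ih₁ ih₂ =>
    simp only [ok, Bool.and_eq_true] at he
    simp only [eval, ih he.1.1 h, ih₁ he.1.2 h, ih₂ he.2 h]
  | sum x e ih =>
    simp only [ok, Bool.and_eq_true] at he
    exact Finset.sum_congr rfl fun i _ => ih he.2 (h.setVar x i)

-- Temporaries form a stack: a subexpression compiled at level `d` changes nothing below `d`, so the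
-- results already computed survive and the expressions evaluated later, whose variables are below
-- `D ≤ d`, keep their values.
open Prog in
theorem LExpr.comp_reaches {n : ℕ} (I : Instance n) {D : ℕ} (hD : 0 < D) (e : LExpr)
    (he : e.ok D) (d : ℕ) (hd : D ≤ d) (s : State) (hs : s.var 0 = n) :
    Reaches I (e.comp d) s (e.time.eval n) fun s' => s'.Agree d s ∧ s'.var d = e.eval I s := by
  induction e generalizing s d with
  | const c =>
    refine (Reaches.assign _ _ ?_).mono (by simp [time, Expr.cost]) fun _ h => h
    exact ⟨(State.Agree.refl d s).setVar_left _ le_rfl, by simp [eval, Expr.eval]⟩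
  | var x =>
    refine (Reaches.assign _ _ ?_).mono (by simp [time, Expr.cost]) fun _ h => h
    exact ⟨(State.Agree.refl d s).setVar_left _ le_rfl, by simp [eval, Expr.eval]⟩
  | read a e ih =>
    refine ((ih he d hd s hs).seq fun s' h => Reaches.assign (Q := fun s' =>
      s'.Agree d s ∧ s'.var d = (read a e).eval I s) _ _ ?_).mono ?_ fun _ h => h
    · exact ⟨h.1.setVar_left _ le_rfl, by simp [eval, Expr.eval, h.2, h.1.arr]⟩
    · simp [time, Expr.cost]
  | add e₁ e₂ ih₁ ih₂ | sub e₁ e₂ ih₁ ih₂ =>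
    simp only [ok, Bool.and_eq_true] at he
    refine ((ih₁ he.1 d hd s hs).seq fun s₁ h₁ => ((ih₂ he.2 (d + 1) (by omega) s₁
      ((h₁.1.var 0 (by omega)).trans hs)).seq fun s₂ h₂ => Reaches.assign _ _ ?_)).mono ?_
        fun _ h => h
    · have hv := h₂.1.var d (by omega)
      have he := eval_congr I e₂ he.2 (h₁.1.mono hd)
      exact ⟨((h₂.1.mono (by omega)).trans h₁.1).setVar_left _ le_rfl,
        by simp [eval, Expr.eval, hv, h₁.2, h₂.2, he]⟩
    · simp [time, Expr.cost]; omega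
  | le e₁ e₂ ih₁ ih₂ =>
    simp only [ok, Bool.and_eq_true] at he
    refine ((ih₁ he.1 d hd s hs).seq fun s₁ h₁ => ((ih₂ he.2 (d + 1) (by omega) s₁
      ((h₁.1.var 0 (by omega)).trans hs)).seq fun s₂ h₂ => Reaches.ite
        (fun hb => Reaches.assign _ _ ?_) fun hb => Reaches.assign _ _ ?_)).mono ?_ fun _ h => h
    · have hv := h₂.1.var d (by omega)
      have he := eval_congr I e₂ he.2 (h₁.1.mono hd)
      simp only [Test.eval, Expr.eval, hv, h₁.2, h₂.2, he] at hb
      exact ⟨((h₂.1.mono (by omega)).trans h₁.1).setVar_left _ le_rfl,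
        by simp [eval, Expr.eval, hb]⟩
    · have hv := h₂.1.var d (by omega)
      have he := eval_congr I e₂ he.2 (h₁.1.mono hd)
      simp only [Test.eval, Expr.eval, hv, h₁.2, h₂.2, he] at hb
      refine ⟨((h₂.1.mono (by omega)).trans h₁.1).setVar_left _ le_rfl, ?_⟩
      simp only [eval, if_neg hb, State.setVar_var_self, Expr.eval]
    · simp [time, Expr.cost, Test.cost]; omega
  | distLE e₁ e₂ e₃ e₄ ih₁ ih₂ ih₃ ih₄ =>
    simp only [ok, Bool.and_eq_true] at he
    refine ((ih₁ he.1.1.1 d hd s hs).seq fun s₁ h₁ => ((ih₂ he.1.1.2 (d + 1) (by omega) s₁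
      ((h₁.1.var 0 (by omega)).trans hs)).seq fun s₂ h₂ => ((ih₃ he.1.2 (d + 2) (by omega) s₂
      ((h₂.1.var 0 (by omega)).trans ((h₁.1.var 0 (by omega)).trans hs))).seq fun s₃ h₃ =>
      ((ih₄ he.2 (d + 3) (by omega) s₃ ((h₃.1.var 0 (by omega)).trans
      ((h₂.1.var 0 (by omega)).trans ((h₁.1.var 0 (by omega)).trans hs)))).seq fun s₄ h₄ =>
      (?_ : Reaches I _ s₄ 10 _))))).mono ?_ fun _ h => h
    · have a₂ : s₂.Agree d s := (h₂.1.mono (by omega)).trans h₁.1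
      have a₃ : s₃.Agree d s := (h₃.1.mono (by omega)).trans a₂
      have a₄ : s₄.Agree d s := (h₄.1.mono (by omega)).trans a₃
      have v₁ : s₄.var d = e₁.eval I s := by
        rw [h₄.1.var d (by omega), h₃.1.var d (by omega), h₂.1.var d (by omega), h₁.2]
      have v₂ : s₄.var (d + 1) = e₂.eval I s := by
        rw [h₄.1.var (d + 1) (by omega), h₃.1.var (d + 1) (by omega), h₂.2,
          eval_congr I e₂ he.1.1.2 (h₁.1.mono hd)]
      have v₃ : s₄.var (d + 2) = e₃.eval I s := by
        rw [h₄.1.var (d + 2) (by omega), h₃.2, eval_congr I e₃ he.1.2 (a₂.mono hd)]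
      have v₄ : s₄.var (d + 3) = e₄.eval I s := by
        rw [h₄.2, eval_congr I e₄ he.2 (a₃.mono hd)]
      refine (Reaches.ite (fun hb => Reaches.assign _ _ ?_) fun hb => Reaches.assign _ _ ?_).mono
        (by simp [Expr.cost, Test.cost]) fun _ h => h
      · simp only [Test.eval, Expr.eval, v₁, v₂, v₃, v₄] at hb
        refine ⟨a₄.setVar_left _ le_rfl, ?_⟩
        change I.DistLE _ _ _ _ at hb
        rw [State.setVar_var_self, eval, if_pos hb, Expr.eval]
      · simp only [Test.eval, Expr.eval, v₁, v₂, v₃, v₄] at hb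
        refine ⟨a₄.setVar_left _ le_rfl, ?_⟩
        change ¬ I.DistLE _ _ _ _ at hb
        rw [State.setVar_var_self, eval, if_neg hb, Expr.eval]
    · simp [time]; omega
  | ite c e₁ e₂ ih ih₁ ih₂ =>
    simp only [ok, Bool.and_eq_true] at he
    refine ((ih he.1.1 d hd s hs).seq fun s' h =>
      have hs' := (h.1.var 0 (by omega)).trans hs
      Reaches.ite
        (Q := fun s' => s'.Agree d s ∧ s'.var d = (LExpr.ite c e₁ e₂).eval I s)
        (fun hb => (ih₁ he.1.2 d hd s' hs').mono le_rfl ?_)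
        fun hb => (ih₂ he.2 d hd s' hs').mono le_rfl ?_).mono ?_ fun _ h => h
    · intro s'' h''
      simp only [Test.eval, Expr.eval, h.2] at hb
      refine ⟨h''.1.trans h.1, ?_⟩
      rw [h''.2, eval_congr I e₁ he.1.2 (h.1.mono hd), eval, if_pos (by omega)]
    · intro s'' h''
      simp only [Test.eval, Expr.eval, h.2] at hb
      refine ⟨h''.1.trans h.1, ?_⟩
      rw [h''.2, eval_congr I e₂ he.2 (h.1.mono hd), eval, if_neg (by omega)]
    · simp [time, Expr.cost, Test.cost]; omega
  | sum x e ih =>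
    simp only [ok, Bool.and_eq_true, decide_eq_true_eq] at he
    obtain ⟨⟨hx0, hxD⟩, he⟩ := he
    -- The old value of the bound variable is saved in `d + 1` and restored at the end; the partial
    -- sum is kept in `d`, and the summand works from `d + 2` on.
    refine ((Reaches.assign (Q := fun s' => s' = s.setVar (d + 1) (s.var x)) _ _ rfl).seq
      fun s₁ h₁ => (Reaches.assign (Q := fun s' => s' = s₁.setVar d 0) _ _ rfl).seq
      fun s₂ h₂ => (Reaches.forLoop (T := e.time.eval n + 4) (fun i s' =>
        s'.Agree d (s.setVar x i) ∧ s'.var (d + 1) = s.var x ∧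
        s'.var d = ∑ j ∈ Finset.range i, e.eval I (s.setVar x j)) ?_ ?_ ?_).seq
      fun s₃ h₃ => Reaches.assign _ _ ?_).mono ?_ fun _ h => h
    · subst h₂ h₁
      refine ⟨(((State.Agree.refl d s).setVar_left _ (by omega)).setVar_left _ le_rfl).setVar _ _,
        ?_, ?_⟩
      · simp only [State.setVar_var]
        rw [if_neg (by omega), if_neg (by omega), if_pos trivial]
      · simp only [State.setVar_var]
        rw [if_neg (by omega), if_pos trivial, Finset.sum_range_zero]
    · intro i s' h
      rw [h.1.var 0 (by omega), h.1.var x (by omega), State.setVar_var_ne _ _ (by omega)]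
      simp [hs]
    · intro i hi s' h
      refine ((ih he (d + 2) (by omega) s' ?_).seq fun s'' h'' => Reaches.assign _ _ ?_).mono
        ?_ fun _ h => h
      · rw [h.1.var 0 (by omega), State.setVar_var_ne _ _ (by omega), hs]
      · have a : s''.Agree d (s.setVar x i) := (h''.1.mono (by omega)).trans h.1
        have hd' := h''.1.var d (by omega)
        have hd1 := h''.1.var (d + 1) (by omega)
        have hx := a.var x (by omega)
        rw [State.setVar_var_self] at hx
        refine ⟨?_, ⟨a.arr, fun y hy => ?_⟩, ?_, ?_⟩
        · rw [State.setVar_var_ne _ _ (by omega), hx]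
        · by_cases hyx : y = x
          · simp [hyx]
          · rw [State.setVar_var_ne _ _ hyx, State.setVar_var_ne _ _ (by omega), a.var y hy,
              State.setVar_var_ne _ _ hyx, State.setVar_var_ne _ _ hyx]
        · rw [State.setVar_var_ne _ _ (by omega), State.setVar_var_ne _ _ (by omega), hd1, h.2.1]
        · rw [State.setVar_var_ne _ _ (by omega), State.setVar_var_self, Finset.sum_range_succ]
          simp only [Expr.eval, hd', h''.2, h.2.2, eval_congr I e he (h.1.mono hd)]
      · simp [Expr.cost]
    · refine ⟨⟨h₃.1.arr, fun y hy => ?_⟩, ?_⟩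
      · by_cases hyx : y = x
        · subst hyx; simp [Expr.eval, h₃.2.1]
        · rw [State.setVar_var_ne _ _ hyx, h₃.1.var y hy, State.setVar_var_ne _ _ hyx]
      · rw [State.setVar_var_ne _ _ (by omega), h₃.2.2, eval]
    · simp [time, Expr.cost]; ring_nf; omega

/-- The compilation of a program, with intermediate results in variables from `D` on. -/
def LProg.comp (D : ℕ) : LProg → Prog
  | skip => .skip
  | assign x e => .seq (e.comp D) (.assign x (.var D))
  | store a e₁ e₂ =>
      .seq (e₁.comp D) (.seq (e₂.comp (D + 1)) (.store a (.var D) (.var (D + 1))))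
  | seq c₁ c₂ => .seq (c₁.comp D) (c₂.comp D)
  | ite b c₁ c₂ =>
      .seq (b.comp D) (.ite (.le (.const 1) (.var D)) (c₁.comp D) (c₂.comp D))
  | loop x c => .forLoop x (c.comp D)

noncomputable def LProg.time : LProg → Polynomial ℕ
  | skip => 1
  | assign _ e => e.time + 2
  | store _ e₁ e₂ => e₁.time + e₂.time + 3
  | seq c₁ c₂ => c₁.time + c₂.time
  | ite b c₁ c₂ => b.time + c₁.time + c₂.time + 4
  | loop _ c => .X * (c.time + 9) + 7

/-- Whatever `c` does not change is the same in `s` and `s'`. -/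
structure LProg.Frame (c : LProg) (s s' : State) : Prop where
  var : ∀ x, c.setsVar x = false → s'.var x = s.var x
  arr : ∀ a, c.setsArr a = false → s'.arr a = s.arr a

/-- The frame property of the body is a hypothesis, so that this can serve inside the induction that
proves it for all programs. -/
theorem LProg.iter_frame_of {n : ℕ} (I : Instance n) (x : ℕ) {c : LProg} (s : State)
    (h : ∀ s, c.Frame s (c.run I s)) (m : ℕ) :
    (loop x c).Frame s (State.iter x (c.run I) s m) := by
  induction m with
  | zero => exact ⟨fun _ _ => rfl, fun _ _ => rfl⟩
  | succ m ihm =>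
    refine ⟨fun y hy => ?_, fun a ha => ?_⟩
    · have hy' := hy
      simp only [setsVar, Bool.or_eq_false_iff, beq_eq_false_iff_ne] at hy
      rw [State.iter, (h _).var y hy.2, State.setVar_var_ne _ _ (Ne.symm hy.1),
        ihm.var y hy']
    · rw [State.iter, (h _).arr a ha, State.setVar_arr, ihm.arr a ha]

theorem LProg.frame_run {n : ℕ} (I : Instance n) (c : LProg) (s : State) :
    c.Frame s (c.run I s) := by
  induction c generalizing s with
  | skip => exact ⟨fun _ _ => rfl, fun _ _ => rfl⟩
  | assign x e =>
    refine ⟨fun y hy => ?_, fun _ _ => rfl⟩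
    simp only [setsVar, beq_eq_false_iff_ne] at hy
    exact State.setVar_var_ne _ _ (Ne.symm hy)
  | store a e₁ e₂ =>
    refine ⟨fun _ _ => rfl, fun b hb => ?_⟩
    simp only [setsArr, beq_eq_false_iff_ne] at hb
    simp [run, State.setArr_arr, Ne.symm hb]
  | seq c₁ c₂ ih₁ ih₂ =>
    refine ⟨fun x hx => ?_, fun a ha => ?_⟩
    · simp only [setsVar, Bool.or_eq_false_iff] at hx
      rw [run, (ih₂ _).var x hx.2, (ih₁ _).var x hx.1]
    · simp only [setsArr, Bool.or_eq_false_iff] at ha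
      rw [run, (ih₂ _).arr a ha.2, (ih₁ _).arr a ha.1]
  | ite b c₁ c₂ ih₁ ih₂ =>
    refine ⟨fun x hx => ?_, fun a ha => ?_⟩
    · simp only [setsVar, Bool.or_eq_false_iff] at hx
      rw [run]
      split_ifs
      exacts [(ih₁ s).var x hx.1, (ih₂ s).var x hx.2]
    · simp only [setsArr, Bool.or_eq_false_iff] at ha
      rw [run]
      split_ifs
      exacts [(ih₁ s).arr a ha.1, (ih₂ s).arr a ha.2]
  | loop x c ih =>
    refine ⟨fun y hy => ?_, fun a ha => (iter_frame_of I x s ih n).arr a ha⟩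
    have hy' := hy
    simp only [setsVar, Bool.or_eq_false_iff, beq_eq_false_iff_ne] at hy
    rw [run, State.setVar_var_ne _ _ (Ne.symm hy.1), (iter_frame_of I x s ih n).var y hy']

theorem LProg.iter_frame {n : ℕ} (I : Instance n) (x : ℕ) (c : LProg) (s : State) (m : ℕ) :
    (loop x c).Frame s (State.iter x (c.run I) s m) :=
  iter_frame_of I x s (c.frame_run I) m

/-- The invariant rule for loops. -/
theorem LProg.run_loop {n : ℕ} (I : Instance n) {x : ℕ} {c : LProg} {s : State}
    (Inv : ℕ → State → Prop) (h₀ : Inv 0 s)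
    (hstep : ∀ i < n, ∀ s', (loop x c).Frame s s' → Inv i s' →
      Inv (i + 1) (c.run I (s'.setVar x i))) :
    ∃ s', (loop x c).Frame s s' ∧ Inv n s' ∧ (loop x c).run I s = s'.setVar x n := by
  refine ⟨_, iter_frame I x c s n, ?_, rfl⟩
  have key : ∀ m ≤ n, Inv m (State.iter x (c.run I) s m) := by
    intro m
    induction m with
    | zero => exact fun _ => h₀
    | succ m ih => exact fun hm => hstep m (by omega) _ (iter_frame I x c s m) (ih (by omega))
  exact key n le_rfl

theorem LProg.ok_setsVar_zero {D : ℕ} (c : LProg) (hc : c.ok D) : c.setsVar 0 = false := by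
  induction c with
  | skip => rfl
  | assign x e =>
    simp only [ok, Bool.and_eq_true, decide_eq_true_eq] at hc
    simp only [setsVar, beq_eq_false_iff_ne]; omega
  | store a e₁ e₂ => rfl
  | seq c₁ c₂ ih₁ ih₂ =>
    simp only [ok, Bool.and_eq_true] at hc
    simp [setsVar, ih₁ hc.1, ih₂ hc.2]
  | ite b c₁ c₂ ih₁ ih₂ =>
    simp only [ok, Bool.and_eq_true] at hc
    simp [setsVar, ih₁ hc.1.2, ih₂ hc.2]
  | loop x c ih =>
    simp only [ok, Bool.and_eq_true, decide_eq_true_eq] at hc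
    simp only [setsVar, ih hc.2, Bool.or_false, beq_eq_false_iff_ne]; omega

open Prog in
/-- The compiled program simulates the program, in polynomial time. -/
theorem LProg.comp_reaches {n : ℕ} (I : Instance n) {D : ℕ} (hD : 0 < D) (c : LProg)
    (hc : c.ok D) (s s₀ : State) (hs : s.Agree D s₀) (hn : s₀.var 0 = n) :
    Reaches I (c.comp D) s (c.time.eval n) fun s' => s'.Agree D (c.run I s₀) := by
  induction c generalizing s s₀ with
  | skip => exact ⟨s, 1, .skip s, by simp [time], hs⟩
  | assign x e =>
    simp only [ok, Bool.and_eq_true] at hc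
    refine ((e.comp_reaches I hD hc.2 D le_rfl s ((hs.var 0 hD).trans hn)).seq
      fun s' h => Reaches.assign _ _ ?_).mono ?_ fun _ h => h
    · rw [run, ← e.eval_congr I hc.2 hs, ← h.2]
      exact (h.1.trans hs).setVar _ _
    · simp [time, Expr.cost]
  | store a e₁ e₂ =>
    simp only [ok, Bool.and_eq_true] at hc
    have hs0 := (hs.var 0 hD).trans hn
    refine ((e₁.comp_reaches I hD hc.1 D le_rfl s hs0).seq fun s₁ h₁ =>
      (e₂.comp_reaches I hD hc.2 (D + 1) (by omega) s₁ ((h₁.1.var 0 hD).trans hs0)).seq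
      fun s₂ h₂ => (?_ : Reaches I _ s₂ 3 _)).mono ?_ fun _ h => h
    · refine ⟨_, _, .store a _ _ s₂, by simp [Expr.cost], ?_⟩
      have a₂ : s₂.Agree D s := (h₂.1.mono (by omega)).trans h₁.1
      simp only [run, Expr.eval, h₂.1.var D (by omega), h₁.2, h₂.2,
        e₂.eval_congr I hc.2 h₁.1, e₁.eval_congr I hc.1 hs, e₂.eval_congr I hc.2 hs]
      exact (a₂.trans hs).setArr _ _ _
    · simp [time]; omega
  | seq c₁ c₂ ih₁ ih₂ =>
    simp only [ok, Bool.and_eq_true] at hc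
    refine ((ih₁ hc.1 s s₀ hs hn).seq fun s' h => ih₂ hc.2 s' _ h ?_).mono ?_ fun _ h => h
    · rw [(c₁.frame_run I s₀).var 0 (c₁.ok_setsVar_zero hc.1), hn]
    · simp [time]
  | ite b c₁ c₂ ih₁ ih₂ =>
    simp only [ok, Bool.and_eq_true] at hc
    refine ((b.comp_reaches I hD hc.1.1 D le_rfl s ((hs.var 0 hD).trans hn)).seq
      fun s' h => Reaches.ite (fun hb => (ih₁ hc.1.2 s' s₀ (h.1.trans hs) hn).mono le_rfl ?_)
        fun hb => (ih₂ hc.2 s' s₀ (h.1.trans hs) hn).mono le_rfl ?_).mono ?_ fun _ h => h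
    · intro s'' h''
      simp only [Test.eval, Expr.eval, h.2, b.eval_congr I hc.1.1 hs] at hb
      rwa [run, if_pos (by omega)]
    · intro s'' h''
      simp only [Test.eval, Expr.eval, h.2, b.eval_congr I hc.1.1 hs] at hb
      rwa [run, if_neg (by omega)]
    · simp [time, Expr.cost, Test.cost]; omega
  | loop x c ih =>
    have hc' := hc
    simp only [ok, Bool.and_eq_true, decide_eq_true_eq, Bool.not_eq_true'] at hc
    obtain ⟨⟨⟨hx0, hxD⟩, hcx⟩, hc⟩ := hc
    -- The compiled loop increments its counter, whereas `run` sets it from outside; they agree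
    -- because the body does not change the counter.
    refine (Reaches.forLoop (T := c.time.eval n) (fun i s' =>
      s'.Agree D ((State.iter x (c.run I) s₀ i).setVar x i)) ?_ ?_ ?_).mono ?_ ?_
    · exact hs.setVar _ _
    · intro i s' h
      refine ⟨?_, ?_⟩
      · rw [h.var 0 hD, State.setVar_var_ne _ _ (by omega),
          (iter_frame I x c s₀ i).var 0 ((loop x c).ok_setsVar_zero hc'), hn]
      · rw [h.var x hxD, State.setVar_var_self]
    · intro i hi s' h
      refine (ih hc s' _ h ?_).mono le_rfl fun s'' h'' => ⟨?_, ?_⟩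
      · rw [State.setVar_var_ne _ _ (by omega),
          (iter_frame I x c s₀ i).var 0 ((loop x c).ok_setsVar_zero hc'), hn]
      · rw [h''.var x hxD, (c.frame_run I _).var x hcx, State.setVar_var_self]
      · exact h''.setVar _ _
    · simp [time]
    · exact fun s' h => h

end CapCenter

/-! ### Greedy cores, their trees, and the arithmetic of the allotment. -/

namespace CapCenter

/-! ### Selection of the cores -/

/-- The cores `1, …, m` have been selected. Core `t` is at the vertex `core t - 1` (`core t = 0` if
the selection had ended before), its parent is `par t` (`0` for a root), its root is `root t`.
The vertex `w` is covered by the core `cov w` (`0` if it is not covered). -/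
structure CoreInv (n : ℕ) (big : ℕ → Prop) (touch : ℕ → ℕ → Prop) (m : ℕ)
    (core par root cov : ℕ → ℕ) : Prop where
  cov_le : ∀ w < n, cov w ≤ m
  cov_spec : ∀ w < n, cov w ≠ 0 → big w ∧ core (cov w) ≠ 0 ∧ touch w (core (cov w) - 1)
  par_lt : ∀ t, 1 ≤ t → t ≤ m → par t < t
  root_eq : ∀ t, 1 ≤ t → t ≤ m → root t = if par t = 0 then t else root (par t)
  core_spec : ∀ t, 1 ≤ t → t ≤ m → core t ≠ 0 → core t - 1 < n ∧ cov (core t - 1) = t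
  par_core : ∀ t, 1 ≤ t → t ≤ m → par t ≠ 0 → core t ≠ 0 ∧ core (par t) ≠ 0 ∧
    ∃ w < n, touch (core t - 1) w ∧ touch w (core (par t) - 1)
  closed : ∀ w < n, big w → ∀ t, 1 ≤ t → t ≤ m → core t ≠ 0 → touch w (core t - 1) → cov w ≠ 0
  disj : ∀ t, 1 ≤ t → t ≤ m → ∀ t', 1 ≤ t' → t' ≤ m → core t ≠ 0 → core t' ≠ 0 →
    touch (core t - 1) (core t' - 1) → t = t'
  same : ∀ w < n, ∀ w' < n, cov w ≠ 0 → cov w' ≠ 0 → touch w w' → root (cov w) = root (cov w')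
  front : ∃ ρ, ∀ w < n, ∀ w' < n, big w → cov w = 0 → cov w' ≠ 0 → touch w w' →
    root (cov w') = ρ
  count : (∀ w < n, big w → cov w ≠ 0) ∨ m ≤ ((Finset.range n).filter fun w => cov w ≠ 0).card

/-- The choice of the next core: an uncovered vertex `u - 1` that touches a vertex covered by the
core `pr`, if there is one; else any uncovered vertex; `u = 0` if all vertices are covered. -/
structure CoreChoice (n : ℕ) (big : ℕ → Prop) (touch : ℕ → ℕ → Prop) (cov : ℕ → ℕ)
    (u pr : ℕ) : Prop where
  done : u = 0 → pr = 0 ∧ ∀ w < n, big w → cov w ≠ 0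
  new : u ≠ 0 → u - 1 < n ∧ big (u - 1) ∧ cov (u - 1) = 0
  fresh : pr = 0 → ∀ w < n, ∀ w' < n, big w → cov w = 0 → cov w' ≠ 0 → ¬ touch w w'
  near : pr ≠ 0 → u ≠ 0 ∧ ∃ w < n, cov w = pr ∧ touch (u - 1) w

variable {n : ℕ} {big : ℕ → Prop} {touch : ℕ → ℕ → Prop} {m : ℕ} {core par root cov : ℕ → ℕ}

theorem CoreInv.init (hcov : ∀ w < n, cov w = 0) :
    CoreInv n big touch 0 core par root cov where
  cov_le w hw := (hcov w hw).le
  cov_spec w hw h := absurd (hcov w hw) h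
  par_lt t _ _ := by omega
  root_eq t _ _ := by omega
  core_spec t _ _ := by omega
  par_core t _ _ := by omega
  closed w _ _ t _ _ := by omega
  disj t _ _ := by omega
  same w hw _ _ h := absurd (hcov w hw) h
  front := ⟨0, fun w _ w' hw' _ _ h => absurd (hcov w' hw') h⟩
  count := .inr (Nat.zero_le _)

/-- Only the tree that is being grown may touch uncovered vertices (`front`). A new tree starts only
when no uncovered vertex touches a covered one, so vertices of different trees never touch (`same`).
The cores stay disjoint because every big vertex that touches a core is covered (`closed`). -/
theorem CoreInv.step (hsymm : ∀ u w, touch u w → touch w u) (hrefl : ∀ u, big u → touch u u)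
    (h : CoreInv n big touch m core par root cov) {u pr : ℕ}
    (hc : CoreChoice n big touch cov u pr) {core' par' root' cov' : ℕ → ℕ}
    (hcore : core' = Function.update core (m + 1) u)
    (hpar : par' = Function.update par (m + 1) pr)
    (hroot : root' = Function.update root (m + 1) (if pr = 0 then m + 1 else root pr))
    (hcov₁ : ∀ w < n, u ≠ 0 → big w → cov w = 0 → touch (u - 1) w → cov' w = m + 1)
    (hcov₂ : ∀ w < n, ¬ (u ≠ 0 ∧ big w ∧ cov w = 0 ∧ touch (u - 1) w) → cov' w = cov w) :
    CoreInv n big touch (m + 1) core' par' root' cov' := by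
  have core_old : ∀ t ≤ m, core' t = core t := fun t ht => by
    rw [hcore, Function.update_of_ne (by omega)]
  have par_old : ∀ t ≤ m, par' t = par t := fun t ht => by
    rw [hpar, Function.update_of_ne (by omega)]
  have root_old : ∀ t ≤ m, root' t = root t := fun t ht => by
    rw [hroot, Function.update_of_ne (by omega)]
  have core_new : core' (m + 1) = u := by rw [hcore, Function.update_self]
  have par_new : par' (m + 1) = pr := by rw [hpar, Function.update_self]
  have root_new : root' (m + 1) = if pr = 0 then m + 1 else root pr := by
    rw [hroot, Function.update_self]
  have cov_old : ∀ w < n, cov w ≠ 0 → cov' w = cov w := fun w hw h =>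
    hcov₂ w hw fun h' => h h'.2.2.1
  have cov_cases : ∀ w < n, cov' w ≠ 0 → (cov w ≠ 0 ∧ cov' w = cov w) ∨
      (u ≠ 0 ∧ big w ∧ cov w = 0 ∧ touch (u - 1) w ∧ cov' w = m + 1) := by
    intro w hw h
    by_cases hn : u ≠ 0 ∧ big w ∧ cov w = 0 ∧ touch (u - 1) w
    · exact .inr ⟨hn.1, hn.2.1, hn.2.2.1, hn.2.2.2, hcov₁ w hw hn.1 hn.2.1 hn.2.2.1 hn.2.2.2⟩
    · have := hcov₂ w hw hn
      exact .inl ⟨this ▸ h, this⟩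
  have pr_le : pr ≤ m := by
    rcases eq_or_ne pr 0 with h0 | h0
    · omega
    · obtain ⟨_, w, hw, rfl, _⟩ := hc.near h0
      exact h.cov_le w hw
  obtain ⟨ρ, hρ⟩ := h.front
  -- covered vertices touching an uncovered one belong to the tree of the new core
  have link : u ≠ 0 → ∀ w < n, ∀ w' < n, big w → cov w = 0 → cov w' ≠ 0 → touch w w' →
      root (cov w') = root' (m + 1) := by
    intro hu w hw w' hw' hb h0 h1 ht
    have hpr : pr ≠ 0 := fun hpr => hc.fresh hpr w hw w' hw' hb h0 h1 ht
    obtain ⟨_, w₀, hw₀, hcw₀, ht₀⟩ := hc.near hpr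
    obtain ⟨hun, hub, hu0⟩ := hc.new hu
    rw [root_new, if_neg hpr, hρ w hw w' hw' hb h0 h1 ht, ← hcw₀,
      -- The new core itself is on the frontier, which identifies the frontier root `ρ` with the
      -- root of its parent.
      hρ _ hun w₀ hw₀ hub hu0 (hcw₀ ▸ hpr) ht₀]
  refine ⟨?_, ?_, ?_, ?_, ?_, ?_, ?_, ?_, ?_, ?_, ?_⟩
  · intro w hw
    by_cases h0 : cov' w = 0
    · omega
    · rcases cov_cases w hw h0 with ⟨_, h1⟩ | ⟨_, _, _, _, h1⟩
      · have := h.cov_le w hw; omega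
      · omega
  · intro w hw h0
    rcases cov_cases w hw h0 with ⟨h1, h2⟩ | ⟨hu, hb, _, ht, h1⟩
    · rw [h2, core_old _ (h.cov_le w hw)]
      exact h.cov_spec w hw h1
    · rw [h1, core_new]
      exact ⟨hb, hu, hsymm _ _ ht⟩
  · intro t h1 h2
    rcases Nat.lt_or_ge m t with h3 | h3
    · obtain rfl : t = m + 1 := by omega
      omega
    · rw [par_old t h3]
      exact h.par_lt t h1 h3
  · intro t h1 h2
    rcases Nat.lt_or_ge m t with h3 | h3
    · obtain rfl : t = m + 1 := by omega
      rw [root_new, par_new, root_old pr pr_le]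
    · have := h.par_lt t h1 h3
      rw [par_old t h3, root_old t h3, root_old (par t) (by omega)]
      exact h.root_eq t h1 h3
  · intro t h1 h2 h0
    rcases Nat.lt_or_ge m t with h3 | h3
    · obtain rfl : t = m + 1 := by omega
      rw [core_new] at h0 ⊢
      obtain ⟨hun, hub, hu0⟩ := hc.new h0
      exact ⟨hun, hcov₁ _ hun h0 hub hu0 (hrefl _ hub)⟩
    · rw [core_old t h3] at h0 ⊢
      obtain ⟨h4, h5⟩ := h.core_spec t h1 h3 h0
      exact ⟨h4, by rw [cov_old _ h4 (by omega), h5]⟩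
  · intro t h1 h2 h0
    rcases Nat.lt_or_ge m t with h3 | h3
    · obtain rfl : t = m + 1 := by omega
      rw [par_new] at h0 ⊢
      obtain ⟨hu, w, hw, rfl, ht⟩ := hc.near h0
      obtain ⟨-, h4, h5⟩ := h.cov_spec w hw h0
      rw [core_new, core_old _ (h.cov_le w hw)]
      exact ⟨hu, h4, w, hw, ht, h5⟩
    · have := h.par_lt t h1 h3
      rw [par_old t h3] at h0 ⊢
      rw [core_old t h3, core_old (par t) (by omega)]
      exact h.par_core t h1 h3 h0
  · intro w hw hb t h1 h2 h0 ht
    rcases Nat.lt_or_ge m t with h3 | h3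
    · obtain rfl : t = m + 1 := by omega
      rw [core_new] at h0 ht
      by_cases h4 : cov w = 0
      · rw [hcov₁ w hw h0 hb h4 (hsymm _ _ ht)]; omega
      · rwa [cov_old w hw h4]
    · rw [core_old t h3] at h0 ht
      have := h.closed w hw hb t h1 h3 h0 ht
      rwa [cov_old w hw this]
  · have key : ∀ t, 1 ≤ t → t ≤ m → core t ≠ 0 → u ≠ 0 → ¬ touch (u - 1) (core t - 1) := by
      intro t h1 h3 h0 hu ht
      obtain ⟨hun, hub, hu0⟩ := hc.new hu
      exact h.closed _ hun hub t h1 h3 h0 ht hu0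
    intro t h1 h2 t' h1' h2' h0 h0' ht
    rcases Nat.lt_or_ge m t with h3 | h3 <;> rcases Nat.lt_or_ge m t' with h3' | h3'
    · omega
    · obtain rfl : t = m + 1 := by omega
      rw [core_old t' h3'] at h0' ht
      rw [core_new] at h0 ht
      exact absurd ht (key t' h1' h3' h0' h0)
    · obtain rfl : t' = m + 1 := by omega
      rw [core_old t h3] at h0 ht
      rw [core_new] at h0' ht
      exact absurd (hsymm _ _ ht) (key t h1 h3 h0 h0')
    · rw [core_old t h3] at h0 ht
      rw [core_old t' h3'] at h0' ht
      exact h.disj t h1 h3 t' h1' h3' h0 h0' ht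
  · intro w hw w' hw' h0 h0' ht
    rcases cov_cases w hw h0 with ⟨h1, h2⟩ | ⟨hu, hb, h1, hut, h2⟩ <;>
      rcases cov_cases w' hw' h0' with ⟨h1', h2'⟩ | ⟨hu', hb', h1', hut', h2'⟩
    · rw [h2, h2', root_old _ (h.cov_le w hw), root_old _ (h.cov_le w' hw')]
      exact h.same w hw w' hw' h1 h1' ht
    · rw [h2, h2', root_old _ (h.cov_le w hw)]
      exact link hu' w' hw' w hw hb' h1' h1 (hsymm _ _ ht)
    · rw [h2, h2', root_old _ (h.cov_le w' hw')]
      exact (link hu w hw w' hw' hb h1 h1' ht).symm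
    · rw [h2, h2']
  -- If no core is left to choose, nothing is uncovered and any root will do; otherwise the frontier
  -- belongs to the tree of the new core.
  · by_cases hu : u = 0
    · refine ⟨0, fun w hw w' hw' hb h0 => ?_⟩
      have := (hc.done hu).2 w hw hb
      rw [cov_old w hw this] at h0
      exact absurd h0 this
    · refine ⟨root' (m + 1), fun w hw w' hw' hb h0 h0' ht => ?_⟩
      have h0w : cov w = 0 := by
        by_contra h1
        exact h1 (cov_old w hw h1 ▸ h0)
      rcases cov_cases w' hw' h0' with ⟨h1', h2'⟩ | ⟨hu', hb', h1', hut', h2'⟩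
      · rw [h2', root_old _ (h.cov_le w' hw')]
        exact link hu w hw w' hw' hb h0w h1' ht
      · rw [h2']
  · rcases h.count with h1 | h1
    · exact .inl fun w hw hb => by rw [cov_old w hw (h1 w hw hb)]; exact h1 w hw hb
    · by_cases hu : u = 0
      · exact .inl fun w hw hb => by
          rw [cov_old w hw ((hc.done hu).2 w hw hb)]; exact (hc.done hu).2 w hw hb
      -- The new core was uncovered and now covers itself, so the number of covered vertices grows.
      · obtain ⟨hun, hub, hu0⟩ := hc.new hu
        refine .inr (Nat.succ_le_of_lt (h1.trans_lt (Finset.card_lt_card ?_)))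
        refine Finset.ssubset_iff_subset_ne.2 ⟨fun w hw => ?_, fun heq => ?_⟩
        · simp only [Finset.mem_filter, Finset.mem_range] at hw ⊢
          exact ⟨hw.1, by rw [cov_old w hw.1 hw.2]; exact hw.2⟩
        · have h2 : u - 1 ∈ (Finset.range n).filter fun w => cov' w ≠ 0 := by
            simp only [Finset.mem_filter, Finset.mem_range]
            exact ⟨hun, by rw [hcov₁ _ hun hu hub hu0 (hrefl _ hub)]; omega⟩
          rw [← heq] at h2
          simp only [Finset.mem_filter] at h2
          exact h2.2 hu0

/-- After `n` rounds, all vertices are covered. -/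
theorem CoreInv.all_covered (h : CoreInv n big touch n core par root cov) :
    ∀ w < n, big w → cov w ≠ 0 := by
  rcases h.count with h1 | h1
  · exact h1
  · intro w hw _
    have h2 : (Finset.range n).filter (fun w => cov w ≠ 0) = Finset.range n :=
      Finset.eq_of_subset_of_card_le (Finset.filter_subset _ _) (by simpa using h1)
    have : w ∈ (Finset.range n).filter fun w => cov w ≠ 0 := by rw [h2]; simpa using hw
    exact (Finset.mem_filter.1 this).2

/-! ### Forests -/

/-- The nodes are `1, …, n`; the parent of a root is `0`. -/
structure Forest (n : ℕ) (par root : ℕ → ℕ) : Prop where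
  par_lt : ∀ t, 1 ≤ t → t ≤ n → par t < t
  root_eq : ∀ t, 1 ≤ t → t ≤ n → root t = if par t = 0 then t else root (par t)

def kids (n : ℕ) (par : ℕ → ℕ) (t : ℕ) : Finset ℕ := (Finset.Icc 1 n).filter fun j => par j = t

def tree (n : ℕ) (root : ℕ → ℕ) (ρ : ℕ) : Finset ℕ := (Finset.Icc 1 n).filter fun t => root t = ρ

namespace Forest

theorem root_spec (F : Forest n par root) : ∀ t, 1 ≤ t → t ≤ n →
    1 ≤ root t ∧ root t ≤ t ∧ par (root t) = 0 := by
  intro t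
  induction t using Nat.strong_induction_on with
  | _ t ih =>
    intro h1 h2
    have hp := F.par_lt t h1 h2
    rw [F.root_eq t h1 h2]
    split_ifs with h0
    · exact ⟨h1, le_rfl, h0⟩
    · obtain ⟨h3, h4, h5⟩ := ih (par t) hp (by omega) (by omega)
      exact ⟨h3, by omega, h5⟩

/-- Conservation along a tree. -/
theorem sum_tree (F : Forest n par root) {a b f : ℕ → ℕ}
    (h : ∀ t, 1 ≤ t → t ≤ n → a t + ∑ j ∈ kids n par t, f j = b t + f t)
    {ρ : ℕ} (h1 : 1 ≤ ρ) (h2 : ρ ≤ n) (hρ : par ρ = 0) :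
    ∑ t ∈ tree n root ρ, a t = ∑ t ∈ tree n root ρ, b t + f ρ := by
  have hs : ∑ t ∈ tree n root ρ, (a t + ∑ j ∈ kids n par t, f j) =
      ∑ t ∈ tree n root ρ, (b t + f t) := by
    refine Finset.sum_congr rfl fun t ht => ?_
    simp only [tree, Finset.mem_filter, Finset.mem_Icc] at ht
    exact h t ht.1.1 ht.1.2
  rw [Finset.sum_add_distrib, Finset.sum_add_distrib] at hs
  have hρ' : ρ ∈ tree n root ρ := by
    simp only [tree, Finset.mem_filter, Finset.mem_Icc]
    exact ⟨⟨h1, h2⟩, by rw [F.root_eq ρ h1 h2, if_pos hρ]⟩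
  -- Each node of the tree except the root is a child of exactly one node of the tree, so the flows
  -- on the inner edges cancel and only that of the root remains.
  have hd : ∑ t ∈ tree n root ρ, ∑ j ∈ kids n par t, f j =
      ∑ j ∈ (tree n root ρ).erase ρ, f j := by
    have : (tree n root ρ).erase ρ =
        (tree n root ρ).biUnion fun t => kids n par t := by
      ext j
      simp only [tree, kids, Finset.mem_erase, Finset.mem_biUnion, Finset.mem_filter,
        Finset.mem_Icc]
      constructor
      · rintro ⟨hj, ⟨hj1, hj2⟩, hjr⟩
        have hp := F.par_lt j hj1 hj2
        rw [F.root_eq j hj1 hj2] at hjr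
        split_ifs at hjr with h0
        · exact absurd hjr hj
        · exact ⟨par j, ⟨⟨by omega, by omega⟩, hjr⟩, ⟨hj1, hj2⟩, rfl⟩
      · rintro ⟨t, ⟨⟨ht1, ht2⟩, htr⟩, ⟨hj1, hj2⟩, rfl⟩
        refine ⟨?_, ⟨hj1, hj2⟩, ?_⟩
        · rintro rfl; omega
        · rw [F.root_eq j hj1 hj2, if_neg (by omega), htr]
    rw [this, Finset.sum_biUnion]
    intro t _ t' _ htt'
    rw [Function.onFun, Finset.disjoint_left]
    intro j hj hj'
    simp only [kids, Finset.mem_filter] at hj hj'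
    exact htt' (hj.2.symm.trans hj'.2)
  have he := Finset.add_sum_erase _ f hρ'
  omega

end Forest

/-- The number `c t` of vertices that core `t` hands to its parent, the number `k t` of its
clusters, the number `e t` of additional vertices that these clusters receive, and the number
`E t` of additional vertices in the subtree of `t`. -/
structure Allotment (n L U : ℕ) (par root own k c e E : ℕ → ℕ) : Prop where
  balance : ∀ t, 1 ≤ t → t ≤ n → own t + ∑ j ∈ kids n par t, c j = k t * L + c t
  c_lt : ∀ t, 1 ≤ t → t ≤ n → c t < L
  e_eq : ∀ t, 1 ≤ t → t ≤ n →
    e t = min (c (root t) - ∑ s ∈ (tree n root (root t)).filter (· < t), e s) (k t * (U - L))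
  E_eq : ∀ t, 1 ≤ t → t ≤ n → E t = e t + ∑ j ∈ kids n par t, E j

namespace Allotment

variable {L U : ℕ} {own k c e E : ℕ → ℕ}

theorem E_root (F : Forest n par root) (A : Allotment n L U par root own k c e E) {ρ : ℕ}
    (h1 : 1 ≤ ρ) (h2 : ρ ≤ n) (hρ : par ρ = 0) : E ρ = ∑ t ∈ tree n root ρ, e t := by
  have := F.sum_tree (a := e) (b := fun _ => 0) (f := E)
    (fun t h1 h2 => by rw [A.E_eq t h1 h2, zero_add]) h1 h2 hρ
  simpa using this.symm

/-- Each `e t` is capped by what the earlier nodes of the tree have left of the surplus `c ρ`, so no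
partial sum exceeds it. -/
theorem sum_e_le (A : Allotment n L U par root own k c e E) (ρ : ℕ) :
    ∑ t ∈ tree n root ρ, e t ≤ c ρ := by
  have key : ∀ m, ∑ t ∈ (tree n root ρ).filter (· < m), e t ≤ c ρ := by
    intro m
    induction m with
    | zero => simp
    | succ m ih =>
      by_cases hm : m ∈ tree n root ρ
      · have : (tree n root ρ).filter (· < m + 1) =
            insert m ((tree n root ρ).filter (· < m)) := by
          ext t
          simp only [Finset.mem_filter, Finset.mem_insert]
          constructor
          · rintro ⟨h, h'⟩
            rcases Nat.lt_or_ge t m with h'' | h''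
            · exact .inr ⟨h, h''⟩
            · exact .inl (by omega)
          · rintro (rfl | ⟨h, h'⟩)
            exacts [⟨hm, by omega⟩, ⟨h, by omega⟩]
        rw [this, Finset.sum_insert (by simp)]
        simp only [tree, Finset.mem_filter, Finset.mem_Icc] at hm
        have he := A.e_eq m hm.1.1 hm.1.2
        rw [hm.2] at he
        omega
      · have : (tree n root ρ).filter (· < m + 1) = (tree n root ρ).filter (· < m) := by
          refine Finset.filter_congr fun t ht => ?_
          have : t ≠ m := fun h => hm (h ▸ ht)
          omega
        rwa [this]
  have := key (n + 1)
  rwa [Finset.filter_true_of_mem] at this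
  intro t ht
  simp only [tree, Finset.mem_filter, Finset.mem_Icc] at ht
  omega

/-- The subtree of a node is contained in that of its parent, so `E` can only grow on the way to the
root. -/
theorem E_le_root (F : Forest n par root) (A : Allotment n L U par root own k c e E) :
    ∀ t, 1 ≤ t → t ≤ n → E t ≤ E (root t) := by
  intro t
  induction t using Nat.strong_induction_on with
  | _ t ih =>
    intro h1 h2
    have hp := F.par_lt t h1 h2
    rw [F.root_eq t h1 h2]
    split_ifs with h0
    · exact le_rfl
    · refine le_trans ?_ (ih (par t) hp (by omega) (by omega))
      rw [A.E_eq (par t) (by omega) (by omega)]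
      refine le_trans (Finset.single_le_sum (f := E) (fun _ _ => Nat.zero_le _) ?_)
        (Nat.le_add_left _ _)
      simp only [kids, Finset.mem_filter, Finset.mem_Icc]
      exact ⟨⟨h1, h2⟩, trivial⟩

theorem E_le_c_root (F : Forest n par root) (A : Allotment n L U par root own k c e E)
    {t : ℕ} (h1 : 1 ≤ t) (h2 : t ≤ n) : E t ≤ c (root t) := by
  obtain ⟨h3, h4, h5⟩ := F.root_spec t h1 h2
  refine (A.E_le_root F t h1 h2).trans ?_
  rw [A.E_root F h3 (by omega) h5]
  exact A.sum_e_le _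

theorem E_lt (F : Forest n par root) (A : Allotment n L U par root own k c e E)
    {t : ℕ} (h1 : 1 ≤ t) (h2 : t ≤ n) : E t < L := by
  obtain ⟨h3, h4, h5⟩ := F.root_spec t h1 h2
  exact (A.E_le_c_root F h1 h2).trans_lt (A.c_lt _ h3 (by omega))

theorem E_le_c (F : Forest n par root) (A : Allotment n L U par root own k c e E)
    {t : ℕ} (h1 : 1 ≤ t) (h2 : t ≤ n) (h0 : par t = 0) : E t ≤ c t := by
  have := A.E_le_c_root F h1 h2
  rwa [F.root_eq t h1 h2, if_pos h0] at this

/-- At most `L` vertices leave a core. -/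
theorem out_lt (F : Forest n par root) (A : Allotment n L U par root own k c e E)
    {t : ℕ} (h1 : 1 ≤ t) (h2 : t ≤ n) :
    (c t - E t) + ∑ j ∈ kids n par t, (E j - c j) < L := by
  have h3 : ∑ j ∈ kids n par t, (E j - c j) ≤ ∑ j ∈ kids n par t, E j :=
    Finset.sum_le_sum fun j _ => Nat.sub_le _ _
  -- The children receive at most `E t - e t`. Adding `c t - E t` gives at most `c t` if `E t ≤ c
  -- t`; otherwise that term vanishes and the total is at most `E t`.
  have h4 := A.E_eq t h1 h2
  have h5 := A.c_lt t h1 h2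
  have h6 := A.E_lt F h1 h2
  omega

/-- The size of a core after all exchanges. -/
theorem size_eq (A : Allotment n L U par root own k c e E) {t : ℕ} (h1 : 1 ≤ t) (h2 : t ≤ n)
    {s : ℕ} (hs : s + ((c t - E t) + ∑ j ∈ kids n par t, (E j - c j)) =
      own t + ((E t - c t) + ∑ j ∈ kids n par t, (c j - E j))) :
    s = k t * L + e t := by
  -- With truncated subtraction, both sides have the summands max(c j, E j).
  have h3 : ∑ j ∈ kids n par t, (E j - c j) + ∑ j ∈ kids n par t, c j =
      ∑ j ∈ kids n par t, (c j - E j) + ∑ j ∈ kids n par t, E j := by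
    rw [← Finset.sum_add_distrib, ← Finset.sum_add_distrib]
    exact Finset.sum_congr rfl fun j _ => by omega
  have h4 := A.balance t h1 h2
  have h5 := A.E_eq t h1 h2
  omega

theorem e_le (A : Allotment n L U par root own k c e E) {t : ℕ} (h1 : 1 ≤ t) (h2 : t ≤ n) :
    e t ≤ k t * (U - L) := by
  rw [A.e_eq t h1 h2]
  exact min_le_right _ _

/-- In each tree, the number of served vertices is the largest possible. -/
theorem served_ge (F : Forest n par root) (A : Allotment n L U par root own k c e E)
    (hLU : L ≤ U) {ρ : ℕ} (h1 : 1 ≤ ρ) (h2 : ρ ≤ n) (hρ : par ρ = 0) :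
    min (∑ t ∈ tree n root ρ, own t) ((∑ t ∈ tree n root ρ, own t) / L * U) ≤
      ∑ t ∈ tree n root ρ, (k t * L + e t) := by
  have hM := F.sum_tree A.balance h1 h2 hρ
  have hc := A.c_lt ρ h1 h2
  have he := A.sum_e_le ρ
  rw [← Finset.sum_mul] at hM
  rw [Finset.sum_add_distrib, ← Finset.sum_mul]
  -- Either the whole surplus of the root is placed and all vertices of the tree are served, or some
  -- surplus is left over.
  rcases he.eq_or_lt with he | he
  · exact (min_le_left _ _).trans (by omega)
  · refine (min_le_right _ _).trans ?_
    -- Only the root surplus `c ρ < L` is missing from the groups of `L`, so the tree has as many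
    -- clusters as any solution can form.
    have hdiv : (∑ t ∈ tree n root ρ, own t) / L = ∑ t ∈ tree n root ρ, k t := by
      rw [hM, add_comm, Nat.add_mul_div_right _ _ (by omega), Nat.div_eq_of_lt hc, zero_add]
    -- As surplus is left over, it never was the smaller term in the minimum: every core is filled
    -- to its spare capacity.
    have hfull : ∑ t ∈ tree n root ρ, e t = ∑ t ∈ tree n root ρ, k t * (U - L) := by
      refine Finset.sum_congr rfl fun t ht => ?_
      have ht' := ht
      simp only [tree, Finset.mem_filter, Finset.mem_Icc] at ht
      have h3 := A.e_eq t ht.1.1 ht.1.2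
      rw [ht.2] at h3
      have h4 : e t + ∑ s ∈ (tree n root ρ).filter (· < t), e s ≤
          ∑ s ∈ tree n root ρ, e s := by
        rw [← Finset.sum_insert (by simp)]
        refine Finset.sum_le_sum_of_subset fun s hs => ?_
        rcases Finset.mem_insert.1 hs with rfl | hs
        exacts [ht', Finset.filter_subset _ _ hs]
      omega
    rw [hdiv, hfull, ← Finset.sum_mul, ← Nat.mul_add, Nat.add_sub_cancel' hLU]

end Allotment

end CapCenter

/-! ### Exchanges along tree edges, division into clusters, and the upper bound. -/

namespace CapCenter

/-! ### Exchange of vertices between the cores -/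

/-- `x` vertices of `nb i` that carry the label `i` change it to `j`. -/
def Move (n : ℕ) (nb : ℕ → ℕ → Prop) (i j x : ℕ) (lab lab' : ℕ → ℕ) : Prop :=
  ∃ M : Finset ℕ, (∀ v ∈ M, v < n ∧ nb i v ∧ lab v = i) ∧ M.card = x ∧
    (∀ v ∈ M, lab' v = j) ∧ ∀ v < n, v ∉ M → lab' v = lab v

open Classical in
/-- The vertices of `nb i` that carry the label `i`. -/
noncomputable def available (n : ℕ) (nb : ℕ → ℕ → Prop) (lab : ℕ → ℕ) (i : ℕ) : Finset ℕ :=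
  (Finset.range n).filter fun v => nb i v ∧ lab v = i

def labelled (n : ℕ) (lab : ℕ → ℕ) (i : ℕ) : Finset ℕ := (Finset.range n).filter fun v => lab v = i

/-- The effect of the first `m` moves from `src t` to `dst t` of `amt t` vertices each. -/
structure MovesInv (n : ℕ) (nb : ℕ → ℕ → Prop) (src dst amt home : ℕ → ℕ) (m : ℕ)
    (lab : ℕ → ℕ) : Prop where
  lab_or : ∀ v < n, lab v = home v ∨
    nb (home v) v ∧ ∃ t < m, src t = home v ∧ dst t = lab v ∧ amt t ≠ 0
  avail : ∀ i, 1 ≤ i → i ≤ n → (available n nb home i).card ≤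
    (available n nb lab i).card + ∑ t ∈ (Finset.range m).filter (fun t => src t = i), amt t
  size : ∀ i, 1 ≤ i → i ≤ n →
    (labelled n lab i).card + ∑ t ∈ (Finset.range m).filter (fun t => src t = i), amt t =
    (labelled n home i).card + ∑ t ∈ (Finset.range m).filter (fun t => dst t = i), amt t

theorem MovesInv.init {n : ℕ} {nb : ℕ → ℕ → Prop} {src dst amt home lab : ℕ → ℕ}
    (h : ∀ v < n, lab v = home v) : MovesInv n nb src dst amt home 0 lab := by
  classical
  refine ⟨fun v hv => .inl (h v hv), fun i _ _ => ?_, fun i _ _ => ?_⟩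
  · have : available n nb home i = available n nb lab i :=
      Finset.filter_congr fun v hv => by rw [h v (Finset.mem_range.1 hv)]
    simp [this]
  · have : labelled n home i = labelled n lab i :=
      Finset.filter_congr fun v hv => by rw [h v (Finset.mem_range.1 hv)]
    simp [this]

theorem sum_filter_range_succ (m i : ℕ) (f amt : ℕ → ℕ) :
    ∑ t ∈ (Finset.range (m + 1)).filter (fun t => f t = i), amt t =
      ∑ t ∈ (Finset.range m).filter (fun t => f t = i), amt t + if f m = i then amt m else 0 := by
  rw [Finset.sum_filter, Finset.sum_filter, Finset.sum_range_succ]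

/-- Membership in `nb i` forces the home `i`, and source and destination differ. So a vertex can
leave only its home, never moves again, and vertices received by a class are never available for its
own moves. -/
theorem MovesInv.step {n : ℕ} {nb : ℕ → ℕ → Prop} {src dst amt home lab lab' : ℕ → ℕ} {m : ℕ}
    (h : MovesInv n nb src dst amt home m lab)
    (hnb : ∀ i, 1 ≤ i → i ≤ n → ∀ v < n, nb i v → home v = i)
    (hsrc : amt m ≠ 0 → 1 ≤ src m ∧ src m ≤ n) (hne : src m ≠ dst m)
    (hmove : Move n nb (src m) (dst m) (amt m) lab lab') :
    MovesInv n nb src dst amt home (m + 1) lab' := by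
  classical
  obtain ⟨M, hM, hcard, hin, hout⟩ := hmove
  rcases eq_or_ne (amt m) 0 with h0 | h0
  · rw [h0, Finset.card_eq_zero] at hcard
    subst hcard
    have hl : ∀ v < n, lab' v = lab v := fun v hv => hout v hv (by simp)
    refine ⟨fun v hv => ?_, fun i h1 h2 => ?_, fun i h1 h2 => ?_⟩
    · rw [hl v hv]
      rcases h.lab_or v hv with h3 | ⟨h3, t, ht, h4⟩
      exacts [.inl h3, .inr ⟨h3, t, by omega, h4⟩]
    · have : available n nb lab' i = available n nb lab i :=
        Finset.filter_congr fun v hv => by rw [hl v (Finset.mem_range.1 hv)]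
      simpa [this, sum_filter_range_succ, h0] using h.avail i h1 h2
    · have : labelled n lab' i = labelled n lab i :=
        Finset.filter_congr fun v hv => by rw [hl v (Finset.mem_range.1 hv)]
      simpa [this, sum_filter_range_succ, h0] using h.size i h1 h2
  · obtain ⟨hs1, hs2⟩ := hsrc h0
    have hMl : ∀ v, v ∈ M → v ∈ available n nb lab (src m) := fun v hv => by
      simpa [available] using hM v hv
    have hMl' : M ⊆ labelled n lab (src m) := fun v hv => by
      have := hM v hv
      simp only [labelled, Finset.mem_filter, Finset.mem_range]
      exact ⟨this.1, this.2.2⟩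
    refine ⟨fun v hv => ?_, fun i h1 h2 => ?_, fun i h1 h2 => ?_⟩
    · by_cases hvM : v ∈ M
      · obtain ⟨_, h3, h4⟩ := hM v hvM
        have h5 := hnb _ hs1 hs2 v hv h3
        exact .inr ⟨by rwa [h5], m, by omega, h5.symm, (hin v hvM).symm, h0⟩
      · rw [hout v hv hvM]
        rcases h.lab_or v hv with h3 | ⟨h3, t, ht, h4⟩
        exacts [.inl h3, .inr ⟨h3, t, by omega, h4⟩]
    · have h3 := h.avail i h1 h2
      rw [sum_filter_range_succ]
      by_cases hi : src m = i
      · subst hi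
        have : available n nb lab' (src m) = available n nb lab (src m) \ M := by
          ext v
          simp only [available, Finset.mem_sdiff, Finset.mem_filter, Finset.mem_range]
          constructor
          · rintro ⟨hv, h4, h5⟩
            by_cases hvM : v ∈ M
            · exact absurd (h5.symm.trans (hin v hvM)) hne
            · exact ⟨⟨hv, h4, by rw [← hout v hv hvM, h5]⟩, hvM⟩
          · rintro ⟨⟨hv, h4, h5⟩, hvM⟩
            exact ⟨hv, h4, by rw [hout v hv hvM, h5]⟩
        rw [this, if_pos rfl, Finset.card_sdiff_of_subset hMl, hcard]
        have := Finset.card_le_card hMl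
        omega
      · have : available n nb lab' i = available n nb lab i := by
          refine Finset.filter_congr fun v hv => and_congr_right fun h4 => ?_
          have hv := Finset.mem_range.1 hv
          rw [hout v hv]
          intro hvM
          have h5 := hnb _ hs1 hs2 v hv (hM v hvM).2.1
          exact hi (h5.symm.trans (hnb i h1 h2 v hv h4))
        rw [this, if_neg hi]
        exact h3
    · have h3 := h.size i h1 h2
      rw [sum_filter_range_succ, sum_filter_range_succ]
      by_cases hi : src m = i
      · subst hi
        have : labelled n lab' (src m) = labelled n lab (src m) \ M := by
          ext v
          simp only [labelled, Finset.mem_sdiff, Finset.mem_filter, Finset.mem_range]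
          constructor
          · rintro ⟨hv, h5⟩
            by_cases hvM : v ∈ M
            · exact absurd (h5.symm.trans (hin v hvM)) hne
            · exact ⟨⟨hv, by rw [← hout v hv hvM, h5]⟩, hvM⟩
          · rintro ⟨⟨hv, h5⟩, hvM⟩
            exact ⟨hv, by rw [hout v hv hvM, h5]⟩
        rw [this, if_pos rfl, if_neg hne.symm, Finset.card_sdiff_of_subset hMl', hcard]
        have := Finset.card_le_card hMl'
        omega
      · by_cases hj : dst m = i
        · subst hj
          have : labelled n lab' (dst m) = labelled n lab (dst m) ∪ M := by
            ext v
            simp only [labelled, Finset.mem_union, Finset.mem_filter, Finset.mem_range]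
            constructor
            · rintro ⟨hv, h5⟩
              by_cases hvM : v ∈ M
              · exact .inr hvM
              · exact .inl ⟨hv, by rw [← hout v hv hvM, h5]⟩
            · rintro (⟨hv, h5⟩ | hvM)
              · refine ⟨hv, ?_⟩
                rw [hout v hv, h5]
                intro hvM
                exact hne ((hM v hvM).2.2.symm.trans h5)
              · exact ⟨(hM v hvM).1, hin v hvM⟩
          rw [this, if_neg hi, if_pos rfl, Finset.card_union_of_disjoint, hcard]
          · omega
          · rw [Finset.disjoint_left]
            intro v hv hvM
            simp only [labelled, Finset.mem_filter] at hv
            exact hne ((hM v hvM).2.2.symm.trans hv.2)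
        · have : labelled n lab' i = labelled n lab i := by
            refine Finset.filter_congr fun v hv => ?_
            have hv := Finset.mem_range.1 hv
            by_cases hvM : v ∈ M
            · rw [hin v hvM, (hM v hvM).2.2]
              simp [hi, hj]
            · rw [hout v hv hvM]
          rw [this, if_neg hi, if_neg hj]
          exact h3

/-- Enough vertices are available for the next move. -/
theorem MovesInv.amt_le {n : ℕ} {nb : ℕ → ℕ → Prop} {src dst amt home lab : ℕ → ℕ} {m N : ℕ}
    (h : MovesInv n nb src dst amt home m lab) (hm : m < N) (h1 : 1 ≤ src m) (h2 : src m ≤ n)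
    (htot : ∑ t ∈ (Finset.range N).filter (fun t => src t = src m), amt t ≤
      (available n nb home (src m)).card) :
    amt m ≤ (available n nb lab (src m)).card := by
  have h3 := h.avail _ h1 h2
  have h4 : ∑ t ∈ (Finset.range (m + 1)).filter (fun t => src t = src m), amt t ≤
      ∑ t ∈ (Finset.range N).filter (fun t => src t = src m), amt t := by
    refine Finset.sum_le_sum_of_subset fun t ht => ?_
    simp only [Finset.mem_filter, Finset.mem_range] at ht ⊢
    exact ⟨by omega, ht.2⟩
  rw [sum_filter_range_succ, if_pos rfl] at h4
  omega

/-- The exchange between core `t + 1` and its parent. -/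
def exSrc (par c E : ℕ → ℕ) (t : ℕ) : ℕ := if E (t + 1) ≤ c (t + 1) then t + 1 else par (t + 1)

/-- At a root with unplaced surplus the destination is the parent `0`: the label of the outliers. -/
def exDst (par c E : ℕ → ℕ) (t : ℕ) : ℕ := if E (t + 1) ≤ c (t + 1) then par (t + 1) else t + 1

def exAmt (c E : ℕ → ℕ) (t : ℕ) : ℕ :=
  if E (t + 1) ≤ c (t + 1) then c (t + 1) - E (t + 1) else E (t + 1) - c (t + 1)

theorem sum_range_succ_eq_Icc (n : ℕ) (f : ℕ → ℕ) :
    ∑ t ∈ Finset.range n, f (t + 1) = ∑ t ∈ Finset.Icc 1 n, f t := by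
  rw [Finset.range_eq_Ico, Finset.sum_Ico_add' f 0 n 1]
  rfl

/-- Core `i` gives on the edge above it when `c i` is larger, and on the edge to a child `j` when `E
j` is larger; truncated subtraction switches off the other directions. -/
theorem sum_exSrc (n : ℕ) (par c E : ℕ → ℕ) {i : ℕ} (h1 : 1 ≤ i) (h2 : i ≤ n) :
    ∑ t ∈ (Finset.range n).filter (fun t => exSrc par c E t = i), exAmt c E t =
      (c i - E i) + ∑ j ∈ kids n par i, (E j - c j) := by
  rw [kids, Finset.sum_filter, Finset.sum_filter]
  have : ∑ t ∈ Finset.range n, (if exSrc par c E t = i then exAmt c E t else 0) =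
      ∑ t ∈ Finset.Icc 1 n, ((if t = i then c i - E i else 0) +
        if par t = i then E t - c t else 0) := by
    rw [← sum_range_succ_eq_Icc]
    refine Finset.sum_congr rfl fun t _ => ?_
    simp only [exSrc, exAmt]
    by_cases hE : E (t + 1) ≤ c (t + 1)
    · simp only [if_pos hE, Nat.sub_eq_zero_of_le hE, ite_self, add_zero]
      split_ifs with h <;> simp [h]
    · simp only [if_neg hE]
      have : (if t + 1 = i then c i - E i else 0) = 0 := by
        split_ifs with h
        · subst h; omega
        · rfl
      rw [this, zero_add]
  rw [this, Finset.sum_add_distrib, Finset.sum_ite_eq' (Finset.Icc 1 n) i,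
    if_pos (Finset.mem_Icc.2 ⟨h1, h2⟩)]

theorem sum_exDst (n : ℕ) (par c E : ℕ → ℕ) {i : ℕ} (h1 : 1 ≤ i) (h2 : i ≤ n) :
    ∑ t ∈ (Finset.range n).filter (fun t => exDst par c E t = i), exAmt c E t =
      (E i - c i) + ∑ j ∈ kids n par i, (c j - E j) := by
  rw [kids, Finset.sum_filter, Finset.sum_filter]
  have : ∑ t ∈ Finset.range n, (if exDst par c E t = i then exAmt c E t else 0) =
      ∑ t ∈ Finset.Icc 1 n, ((if t = i then E i - c i else 0) +
        if par t = i then c t - E t else 0) := by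
    rw [← sum_range_succ_eq_Icc]
    refine Finset.sum_congr rfl fun t _ => ?_
    simp only [exDst, exAmt]
    by_cases hE : E (t + 1) ≤ c (t + 1)
    · simp only [if_pos hE]
      have : (if t + 1 = i then E i - c i else 0) = 0 := by
        split_ifs with h
        · subst h; omega
        · rfl
      rw [this, zero_add]
    · simp only [if_neg hE, Nat.sub_eq_zero_of_le (le_of_not_ge hE), ite_self, add_zero]
      split_ifs with h <;> simp [h]
  rw [this, Finset.sum_add_distrib, Finset.sum_ite_eq' (Finset.Icc 1 n) i,
    if_pos (Finset.mem_Icc.2 ⟨h1, h2⟩)]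

/-! ### Division of the classes into clusters -/

/-- The number of vertices before `v` with the same label. -/
def rank (lab : ℕ → ℕ) (v : ℕ) : ℕ := ((Finset.range v).filter fun w => lab w = lab v).card

theorem rank_lt_rank {lab : ℕ → ℕ} {v w : ℕ} (h : lab v = lab w) (hvw : v < w) :
    rank lab v < rank lab w := by
  refine Finset.card_lt_card (Finset.ssubset_iff_subset_ne.2 ⟨fun x hx => ?_, fun heq => ?_⟩)
  · simp only [Finset.mem_filter, Finset.mem_range] at hx ⊢
    exact ⟨by omega, hx.2.trans h⟩
  · have : v ∈ (Finset.range w).filter fun x => lab x = lab w := by simp [hvw, h]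
    rw [← heq] at this
    simp at this

theorem rank_injOn {lab : ℕ → ℕ} {v w : ℕ} (h : lab v = lab w) (hr : rank lab v = rank lab w) :
    v = w := by
  rcases lt_trichotomy v w with h1 | h1 | h1
  · have := rank_lt_rank h h1; omega
  · exact h1
  · have := rank_lt_rank h.symm h1; omega

theorem rank_lt_card {n : ℕ} {lab : ℕ → ℕ} {v : ℕ} (hv : v < n) :
    rank lab v < (labelled n lab (lab v)).card := by
  refine Finset.card_lt_card (Finset.ssubset_iff_subset_ne.2 ⟨fun x hx => ?_, fun heq => ?_⟩)
  · simp only [labelled, Finset.mem_filter, Finset.mem_range] at hx ⊢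
    exact ⟨by omega, hx.2⟩
  · have : v ∈ labelled n lab (lab v) := by simp [labelled, hv]
    rw [← heq] at this
    simp at this

/-- The rank numbers a class consecutively from `0`. This reduces the division of a class to
residues in an initial segment, and gives every residue a representative in the class. -/
theorem image_rank (n : ℕ) (lab : ℕ → ℕ) (t : ℕ) :
    (labelled n lab t).image (rank lab) = Finset.range (labelled n lab t).card := by
  refine Finset.eq_of_subset_of_card_le (fun x hx => ?_) ?_
  · simp only [Finset.mem_image, labelled, Finset.mem_filter, Finset.mem_range] at hx ⊢
    obtain ⟨v, ⟨hv, rfl⟩, rfl⟩ := hx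
    exact rank_lt_card hv
  · rw [Finset.card_range, Finset.card_image_of_injOn]
    intro v hv w hw h
    simp only [labelled, Finset.coe_filter, Set.mem_ofPred_eq] at hv hw
    exact rank_injOn (hv.2.trans hw.2.symm) h

theorem exists_rank {n : ℕ} {lab : ℕ → ℕ} {t i : ℕ} (hi : i < (labelled n lab t).card) :
    ∃ v < n, lab v = t ∧ rank lab v = i := by
  have : i ∈ (labelled n lab t).image (rank lab) := by rw [image_rank]; simpa using hi
  simp only [Finset.mem_image, labelled, Finset.mem_filter, Finset.mem_range] at this
  obtain ⟨v, ⟨h1, h2⟩, h3⟩ := this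
  exact ⟨v, h1, h2, h3⟩

/-- The classes of the residues modulo `k` have sizes between `L` and `U`. -/
theorem card_residue {L U k s i : ℕ} (hi : i < k) (hL : k * L ≤ s) (hU : s ≤ k * U) :
    L ≤ ((Finset.range s).filter fun j => j % k = i).card ∧
      ((Finset.range s).filter fun j => j % k = i).card ≤ U := by
  have hk : 0 < k := by omega
  have h := Nat.count_modEq_card s hk i
  have h' : ((Finset.range s).filter fun j => j % k = i).card =
      s / k + if i % k < s % k then 1 else 0 := by
    rw [← h, Nat.count_eq_card_filter_range]
    congr 1
    refine Finset.filter_congr fun j _ => ?_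
    rw [Nat.ModEq, Nat.mod_eq_of_lt hi]
  rw [h']
  have h1 : L ≤ s / k := (Nat.le_div_iff_mul_le hk).2 (by rwa [mul_comm])
  have h2 : s / k ≤ U := Nat.div_le_of_le_mul hU
  refine ⟨by omega, ?_⟩
  -- A class with one element more than the quotient occurs only for a nonzero remainder; then the
  -- quotient is below `U`, because `s ≤ k * U`.
  split_ifs with h3
  · have h4 : s / k ≠ U := by
      intro h5
      have := Nat.div_add_mod s k
      rw [h5] at this
      omega
    omega
  · omega

theorem card_cluster {n L U : ℕ} {lab k : ℕ → ℕ} {t i : ℕ} (hi : i < k t)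
    (hL : k t * L ≤ (labelled n lab t).card) (hU : (labelled n lab t).card ≤ k t * U) :
    L ≤ ((labelled n lab t).filter fun v => rank lab v % k t = i).card ∧
      ((labelled n lab t).filter fun v => rank lab v % k t = i).card ≤ U := by
  have := card_residue hi hL hU
  rw [← image_rank, Finset.filter_image, Finset.card_image_of_injOn] at this
  · exact this
  · intro v hv w hw h
    simp only [labelled, Finset.coe_filter, Set.mem_ofPred_eq, Finset.mem_filter] at hv hw
    exact rank_injOn (hv.1.2.trans hw.1.2.symm) h

/-! ### Comparison with a feasible solution -/

/-- `u` and `v` are vertices at distance at most `r`. -/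
def Instance.Near {n : ℕ} (I : Instance n) (r : ℝ≥0) (x y : ℕ) : Prop :=
  ∃ u v : Fin n, (u : ℕ) = x ∧ (v : ℕ) = y ∧ I.dist u v ≤ r

namespace Instance.Near

variable {n : ℕ} {I : Instance n} {r r' : ℝ≥0} {x y z : ℕ}

theorem symm (h : I.Near r x y) : I.Near r y x := by
  obtain ⟨u, v, hu, hv, h⟩ := h
  exact ⟨v, u, hv, hu, by rwa [I.dist_symm]⟩

theorem trans (h : I.Near r x y) (h' : I.Near r' y z) : I.Near (r + r') x z := by
  obtain ⟨u, v, rfl, rfl, h⟩ := h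
  obtain ⟨v', w, hv, rfl, h'⟩ := h'
  obtain rfl : v' = v := Fin.ext hv
  exact ⟨u, w, rfl, rfl, (I.dist_triangle _ _ _).trans (add_le_add h h')⟩

theorem mono (h : I.Near r x y) (hr : r ≤ r') : I.Near r' x y := by
  obtain ⟨u, v, hu, hv, h⟩ := h
  exact ⟨u, v, hu, hv, h.trans hr⟩

end Instance.Near

def Instance.Touch {n : ℕ} (I : Instance n) (r : ℝ≥0) (u w : ℕ) : Prop :=
  ∃ z < n, I.Near r u z ∧ I.Near r w z

open Classical in
/-- `u` has at least `L` vertices within distance `r`. -/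
def Instance.Big {n : ℕ} (I : Instance n) (r : ℝ≥0) (L u : ℕ) : Prop :=
  L ≤ ((Finset.range n).filter fun z => I.Near r u z).card

namespace Instance

variable {n : ℕ} {I : Instance n} {r : ℝ≥0} {L u w x : ℕ}

theorem Touch.symm (h : I.Touch r u w) : I.Touch r w u := by
  obtain ⟨z, hz, h1, h2⟩ := h
  exact ⟨z, hz, h2, h1⟩

theorem Touch.near (h : I.Touch r u w) : I.Near (r + r) u w := by
  obtain ⟨z, hz, h1, h2⟩ := h
  exact h1.trans h2.symm

/-- The distance of a vertex to itself need not be zero, so touching is not reflexive in general; a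
big vertex has a vertex in its ball because `L` is positive. -/
theorem Big.touch_self (hL : 1 ≤ L) (h : I.Big r L u) : I.Touch r u u := by
  classical
  have : 0 < ((Finset.range n).filter fun z => I.Near r u z).card := lt_of_lt_of_le hL h
  obtain ⟨z, hz⟩ := Finset.card_pos.1 this
  simp only [Finset.mem_filter, Finset.mem_range] at hz
  exact ⟨z, hz.1, hz.2, hz.2⟩

end Instance

open Classical in
/-- The bound on the number of vertices that a solution serves in each tree. -/
theorem card_served_le {n : ℕ} (I : Instance n) {r : ℝ≥0} {T : Solution n} (hT : I.Feasible T)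
    (hr : I.radius T ≤ r) {L : ℕ} (hL : L = I.L + (1 - I.L)) (g : Fin n → ℕ) (R : Finset ℕ)
    (M : ℕ → ℕ)
    (hg : ∀ u : Fin n, I.Big r L u → g u ∈ R)
    (hM : ∀ ρ ∈ R, (Finset.univ.filter fun v : Fin n =>
      ∃ u : Fin n, I.Big r L u ∧ I.Near r u v ∧ g u = ρ).card ≤ M ρ) :
    T.C.card ≤ ∑ ρ ∈ R, min (M ρ) (M ρ / L * I.U) := by
  have hnear : ∀ v ∈ T.C, I.Near r (T.φ v) v := fun v hv => by
    refine Instance.Near.symm ⟨v, T.φ v, rfl, rfl, le_trans ?_ hr⟩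
    exact Finset.le_sup (f := fun v => I.dist v (T.φ v)) hv
  -- A cluster that serves some vertex is nonempty, so it satisfies even the lower bound max(I.L,
  -- 1), which is `L`.
  have hcl : ∀ v ∈ T.C, L ≤ (T.C.filter fun w => T.φ w = T.φ v).card := fun v hv => by
    have h1 := hT.lower _ (hT.mapsTo v hv)
    have h2 : 0 < (T.C.filter fun w => T.φ w = T.φ v).card :=
      Finset.card_pos.2 ⟨v, by simp [hv]⟩
    omega
  have hbig : ∀ v ∈ T.C, I.Big r L (T.φ v) := fun v hv => by
    refine (hcl v hv).trans ?_
    rw [← Finset.card_map Fin.valEmbedding]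
    refine Finset.card_le_card fun x hx => ?_
    simp only [Finset.mem_map, Finset.mem_filter, Fin.valEmbedding_apply, Finset.mem_range] at hx ⊢
    obtain ⟨w, ⟨hw, hw'⟩, rfl⟩ := hx
    exact ⟨w.2, hw' ▸ hnear w hw⟩
  rw [Finset.card_eq_sum_card_fiberwise (f := fun v => g (T.φ v)) (t := R)
    fun v hv => hg _ (hbig v hv)]
  refine Finset.sum_le_sum fun ρ hρ => ?_
  set Cρ := T.C.filter fun v => g (T.φ v) = ρ with hC
  have hCM : Cρ.card ≤ M ρ := by
    refine le_trans (Finset.card_le_card fun v hv => ?_) (hM ρ hρ)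
    rw [hC, Finset.mem_filter] at hv
    simp only [Finset.mem_filter, Finset.mem_univ, true_and]
    exact ⟨T.φ v, hbig v hv.1, hnear v hv.1, hv.2⟩
  refine le_min hCM ?_
  -- The value of `g` depends only on the center, so `Cρ` is a union of whole clusters, each with at
  -- least `L` and at most `I.U` vertices.
  have hsum : Cρ.card = ∑ u ∈ Cρ.image T.φ, (T.C.filter fun v => T.φ v = u).card := by
    rw [Finset.card_eq_sum_card_image T.φ Cρ]
    refine Finset.sum_congr rfl fun u hu => ?_
    congr 1
    obtain ⟨v, hv, rfl⟩ := Finset.mem_image.1 hu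
    rw [hC, Finset.mem_filter] at hv
    ext w
    simp only [hC, Finset.mem_filter]
    constructor
    · rintro ⟨⟨h1, h2⟩, h3⟩
      exact ⟨h1, h3⟩
    · rintro ⟨h1, h3⟩
      exact ⟨⟨h1, by rw [h3]; exact hv.2⟩, h3⟩
  have hmem : ∀ u ∈ Cρ.image T.φ, ∃ v ∈ T.C, T.φ v = u := fun u hu => by
    obtain ⟨v, hv, rfl⟩ := Finset.mem_image.1 hu
    exact ⟨v, (Finset.mem_filter.1 hv).1, rfl⟩
  have h1 : (Cρ.image T.φ).card * L ≤ Cρ.card := by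
    rw [hsum, ← smul_eq_mul]
    refine Finset.card_nsmul_le_sum _ _ _ fun u hu => ?_
    obtain ⟨v, hv, rfl⟩ := hmem u hu
    exact hcl v hv
  have h2 : Cρ.card ≤ (Cρ.image T.φ).card * I.U := by
    rw [hsum, ← smul_eq_mul]
    refine Finset.sum_le_card_nsmul _ _ _ fun u hu => ?_
    obtain ⟨v, hv, rfl⟩ := hmem u hu
    exact hT.upper _ (hT.mapsTo v hv)
  refine h2.trans (Nat.mul_le_mul_right _ ?_)
  rw [Nat.le_div_iff_mul_le (by omega)]
  exact h1.trans hCM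

end CapCenter

/-! ### Building blocks of programs: bounded arithmetic, searches, and tables. -/

namespace CapCenter

/-! ### Derived expressions and loops -/

namespace LExpr

def conj (a b : LExpr) : LExpr := .ite a b (.const 0)

def neg (a : LExpr) : LExpr := .ite a (.const 0) (.const 1)

def eq (a b : LExpr) : LExpr := conj (.le a b) (.le b a)

def lt (a b : LExpr) : LExpr := .le (.add a (.const 1)) b

/-- Some `x < n` satisfies `a`. -/
def ex (x : ℕ) (a : LExpr) : LExpr := .le (.const 1) (.sum x a)

/-- The number of `x < n` that satisfy `a`. -/
def cnt (x : ℕ) (a : LExpr) : LExpr := .sum x (.ite a (.const 1) (.const 0))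

def Holds {n : ℕ} (I : Instance n) (a : LExpr) (s : State) : Prop := a.eval I s ≠ 0

def min (a b : LExpr) : LExpr := .sub a (.sub a b)

def succ (a : LExpr) : LExpr := .add a (.const 1)

def pred (a : LExpr) : LExpr := .sub a (.const 1)

/-- The product, if `a ≤ n`. -/
def mul (z : ℕ) (a b : LExpr) : LExpr := .sum z (.ite (lt (.var z) a) b (.const 0))

/-- The quotient, if it is at most `n`. -/
def div (z y : ℕ) (a b : LExpr) : LExpr := cnt z (.le (mul y (.succ (.var z)) b) a)

def mod (z y : ℕ) (a b : LExpr) : LExpr := .sub a (mul z (div z y a b) b)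

variable {n : ℕ} (I : Instance n) (a b : LExpr) (s : State)

@[simp] theorem eval_const (c : ℕ) : (const c).eval I s = c := rfl

@[simp] theorem eval_var (x : ℕ) : (var x).eval I s = s.var x := rfl

@[simp] theorem eval_read (x : ℕ) : (read x a).eval I s = s.arr x (a.eval I s) := rfl

@[simp] theorem eval_add : (add a b).eval I s = a.eval I s + b.eval I s := rfl

@[simp] theorem eval_sub : (sub a b).eval I s = a.eval I s - b.eval I s := rfl

@[simp] theorem eval_sum (x : ℕ) :
    (sum x a).eval I s = ∑ i ∈ Finset.range n, a.eval I (s.setVar x i) := rfl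

variable {a b s}

theorem eval_ite_pos {c : LExpr} (h : c.Holds I s) : (ite c a b).eval I s = a.eval I s := by
  simp only [eval]; exact if_pos h

theorem eval_ite_neg {c : LExpr} (h : ¬ c.Holds I s) : (ite c a b).eval I s = b.eval I s := by
  simp only [eval]; exact if_neg h

variable (a b s)

@[simp] theorem holds_var (x : ℕ) : (var x).Holds I s ↔ s.var x ≠ 0 := Iff.rfl

@[simp] theorem holds_read (x : ℕ) : (read x a).Holds I s ↔ s.arr x (a.eval I s) ≠ 0 := Iff.rfl

@[simp] theorem holds_le : (le a b).Holds I s ↔ a.eval I s ≤ b.eval I s := by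
  simp [Holds, eval]

theorem holds_distLE (c d : LExpr) : (distLE a b c d).Holds I s ↔
    I.DistLE (a.eval I s) (b.eval I s) (c.eval I s) (d.eval I s) := by
  simp only [Holds, eval]
  by_cases h : I.DistLE (a.eval I s) (b.eval I s) (c.eval I s) (d.eval I s)
  · rw [if_pos h]; simp [h]
  · rw [if_neg h]; simp [h]

@[simp] theorem holds_conj : (conj a b).Holds I s ↔ a.Holds I s ∧ b.Holds I s := by
  simp [Holds, conj, eval]

@[simp] theorem holds_neg : (neg a).Holds I s ↔ ¬ a.Holds I s := by
  simp [Holds, neg, eval]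

@[simp] theorem holds_eq : (eq a b).Holds I s ↔ a.eval I s = b.eval I s := by
  simp only [eq, holds_conj, holds_le]; omega

@[simp] theorem holds_lt : (lt a b).Holds I s ↔ a.eval I s < b.eval I s := by
  simp only [lt, holds_le]; rfl

@[simp] theorem holds_ex (x : ℕ) :
    (ex x a).Holds I s ↔ ∃ i < n, a.Holds I (s.setVar x i) := by
  rw [ex, holds_le, eval_const, Nat.succ_le_iff, Nat.pos_iff_ne_zero, eval_sum, ne_eq,
    Finset.sum_eq_zero_iff, not_forall]
  simp only [Classical.not_imp, Finset.mem_range]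
  rfl

variable {a b s}

theorem eval_cnt (x : ℕ) {P : ℕ → Prop} [DecidablePred P]
    (h : ∀ i < n, a.Holds I (s.setVar x i) ↔ P i) :
    (cnt x a).eval I s = ((Finset.range n).filter P).card := by
  rw [cnt, eval_sum, Finset.card_filter]
  refine Finset.sum_congr rfl fun i hi => ?_
  have h := h i (Finset.mem_range.1 hi)
  split_ifs with hP
  exacts [eval_ite_pos I (h.2 hP), eval_ite_neg I fun h' => hP (h.1 h')]

theorem eval_sumIf (x : ℕ) {P : ℕ → Prop} [DecidablePred P] {f : ℕ → ℕ}
    (h : ∀ i < n, a.Holds I (s.setVar x i) ↔ P i)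
    (hf : ∀ i < n, P i → b.eval I (s.setVar x i) = f i) :
    (sum x (ite a b (const 0))).eval I s = ∑ i ∈ Finset.range n, if P i then f i else 0 := by
  rw [eval_sum]
  refine Finset.sum_congr rfl fun i hi => ?_
  have h := h i (Finset.mem_range.1 hi)
  split_ifs with hP
  · rw [eval_ite_pos I (h.2 hP), hf i (Finset.mem_range.1 hi) hP]
  · exact eval_ite_neg I fun h' => hP (h.1 h')

variable (a b s)

@[simp] theorem eval_min : (min a b).eval I s = Min.min (a.eval I s) (b.eval I s) := by
  simp only [min, eval_sub]; omega

@[simp] theorem eval_succ : (succ a).eval I s = a.eval I s + 1 := rfl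

@[simp] theorem eval_pred : (pred a).eval I s = a.eval I s - 1 := rfl

variable {a b s}

/-- The variables that an expression depends on. -/
def usesVar : LExpr → ℕ → Bool
  | const _, _ => false
  | var x, y => x == y
  | read _ e, y => e.usesVar y
  | add e₁ e₂, y => e₁.usesVar y || e₂.usesVar y
  | sub e₁ e₂, y => e₁.usesVar y || e₂.usesVar y
  | le e₁ e₂, y => e₁.usesVar y || e₂.usesVar y
  | distLE e₁ e₂ e₃ e₄, y => e₁.usesVar y || e₂.usesVar y || e₃.usesVar y || e₄.usesVar y
  | ite c e₁ e₂, y => c.usesVar y || e₁.usesVar y || e₂.usesVar y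
  | sum x e, y => !(x == y) && e.usesVar y

theorem eval_setVar (e : LExpr) (s : State) {x : ℕ} (k : ℕ) (h : e.usesVar x = false) :
    e.eval I (s.setVar x k) = e.eval I s := by
  induction e generalizing s with
  | const c => rfl
  | var y =>
    simp only [usesVar, beq_eq_false_iff_ne] at h
    exact State.setVar_var_ne _ _ h
  | read a e ih => simp only [eval, ih s h, State.setVar_arr]
  | add e₁ e₂ ih₁ ih₂ | sub e₁ e₂ ih₁ ih₂ | le e₁ e₂ ih₁ ih₂ =>
    simp only [usesVar, Bool.or_eq_false_iff] at h
    simp only [eval, ih₁ s h.1, ih₂ s h.2]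
  | distLE e₁ e₂ e₃ e₄ ih₁ ih₂ ih₃ ih₄ =>
    simp only [usesVar, Bool.or_eq_false_iff] at h
    rw [eval, eval, ih₁ s h.1.1.1, ih₂ s h.1.1.2, ih₃ s h.1.2, ih₄ s h.2]
  | ite c e₁ e₂ ih ih₁ ih₂ =>
    simp only [usesVar, Bool.or_eq_false_iff] at h
    simp only [eval, ih s h.1.1, ih₁ s h.1.2, ih₂ s h.2]
  | sum y e ih =>
    simp only [eval]
    refine Finset.sum_congr rfl fun i _ => ?_
    by_cases hxy : x = y
    · subst hxy
      have : (s.setVar x k).setVar x i = s.setVar x i := by simp [State.setVar]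
      rw [this]
    · have h' : e.usesVar x = false := by simpa [usesVar, Ne.symm hxy] using h
      have : (s.setVar x k).setVar y i = (s.setVar y i).setVar x k := by
        simp only [State.setVar, State.mk.injEq, and_true]
        exact Function.update_comm hxy _ _ _
      rw [this, ih _ h']

/-- The number of positive multiples of `b`, up to `n * b`, that are at most `a`. -/
def divUpTo (n a b : ℕ) : ℕ := ((Finset.range n).filter fun z => (z + 1) * b ≤ a).card

theorem divUpTo_le (n a b : ℕ) : divUpTo n a b ≤ n :=
  (Finset.card_filter_le _ _).trans (Finset.card_range n).le

/-- The bound on `a` makes the quotient at most `n`, so no multiple is missed by counting only up to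
`n`. -/
theorem divUpTo_eq {n a b : ℕ} (hb : 0 < b) (h : a ≤ n * b) : divUpTo n a b = a / b := by
  have hle : a / b ≤ n := Nat.div_le_of_le_mul (by rwa [mul_comm])
  have : (Finset.range n).filter (fun z => (z + 1) * b ≤ a) = Finset.range (a / b) := by
    ext z
    rw [Finset.mem_filter, Finset.mem_range, Finset.mem_range, ← Nat.succ_le_iff (m := z),
      ← Nat.succ_le_iff (m := z), Nat.le_div_iff_mul_le hb]
    refine ⟨fun h => h.2, fun h => ⟨?_, h⟩⟩
    exact ((Nat.le_div_iff_mul_le hb).2 h).trans hle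
  rw [divUpTo, this, Finset.card_range]

theorem eval_mul {z : ℕ} (ha : a.usesVar z = false) (hb : b.usesVar z = false)
    (h : a.eval I s ≤ n) : (mul z a b).eval I s = a.eval I s * b.eval I s := by
  have h1 := eval_sumIf I (s := s) (a := lt (var z) a) (b := b) z
    (P := fun i => i < a.eval I s) (f := fun _ => b.eval I s)
    (fun i _ => by rw [holds_lt, eval_var, State.setVar_var_self, eval_setVar I a s i ha])
    (fun i _ _ => eval_setVar I b s i hb)
  have : (Finset.range n).filter (fun i => i < a.eval I s) = Finset.range (a.eval I s) := by
    ext i; simp only [Finset.mem_filter, Finset.mem_range]; omega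
  rw [mul, h1, ← Finset.sum_filter, this, Finset.sum_const, Finset.card_range, smul_eq_mul]

theorem eval_div {z y : ℕ} (hzy : z ≠ y) (ha : a.usesVar z = false) (hb : b.usesVar z = false)
    (hb' : b.usesVar y = false) :
    (div z y a b).eval I s = divUpTo n (a.eval I s) (b.eval I s) := by
  refine eval_cnt I z fun i hi => ?_
  rw [holds_le, eval_mul I (by simpa [succ, usesVar] using hzy) hb' (by simpa using hi),
    eval_setVar I a s i ha, eval_setVar I b s i hb]
  simp

theorem eval_mod {z y : ℕ} (hzy : z ≠ y) (ha : a.usesVar z = false) (hb : b.usesVar z = false)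
    (hb' : b.usesVar y = false) :
    (mod z y a b).eval I s =
      a.eval I s - divUpTo n (a.eval I s) (b.eval I s) * b.eval I s := by
  have h := eval_div I (s := s) hzy ha hb hb'
  rw [mod, eval_sub, eval_mul I _ hb (h ▸ divUpTo_le _ _ _), h]
  simp [div, cnt, usesVar]

end LExpr

namespace LProg

variable {n : ℕ} (I : Instance n)

theorem frame_trans {c : LProg} {s s' s'' : State} (h : c.Frame s s') (h' : c.Frame s' s'') :
    c.Frame s s'' :=
  ⟨fun x hx => (h'.var x hx).trans (h.var x hx), fun a ha => (h'.arr a ha).trans (h.arr a ha)⟩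

theorem run_ite_pos {b : LExpr} {c₁ c₂ : LProg} {s : State} (h : b.Holds I s) :
    (ite b c₁ c₂).run I s = c₁.run I s := by
  simp only [run]; exact if_pos h

theorem run_ite_neg {b : LExpr} {c₁ c₂ : LProg} {s : State} (h : ¬ b.Holds I s) :
    (ite b c₁ c₂).run I s = c₂.run I s := by
  simp only [run]; exact if_neg h

theorem frame_setVar {x : ℕ} {c : LProg} (s : State) (k : ℕ) :
    (loop x c).Frame s (s.setVar x k) := by
  refine ⟨fun y hy => ?_, fun _ _ => rfl⟩
  simp only [setsVar, Bool.or_eq_false_iff, beq_eq_false_iff_ne] at hy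
  exact State.setVar_var_ne _ _ (Ne.symm hy.1)

/-- Assign `e` to `y` for the last `x` that satisfies `b`. -/
def find (x y : ℕ) (b e : LExpr) : LProg := .loop x (.ite b (.assign y e) .skip)

/-- If the search fails, the old value of `y` survives. Hence a second search for preferred
candidates can follow a first one, whose result serves as fallback. -/
theorem run_find {x y : ℕ} (hxy : x ≠ y) {b e : LExpr} {s : State} (P : ℕ → Prop) (f : ℕ → ℕ)
    (hb : ∀ i < n, ∀ s', (find x y b e).Frame s s' → s'.var x = i → (b.Holds I s' ↔ P i))
    (he : ∀ i < n, ∀ s', (find x y b e).Frame s s' → s'.var x = i → P i → e.eval I s' = f i) :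
    (∃ i < n, P i ∧ ((find x y b e).run I s).var y = f i) ∨
      ((∀ i < n, ¬ P i) ∧ ((find x y b e).run I s).var y = s.var y) := by
  obtain ⟨s', hF, hI, hrun⟩ := run_loop I (x := x) (c := .ite b (.assign y e) .skip) (s := s)
    (fun i s' => (∃ j < i, P j ∧ s'.var y = f j) ∨ ((∀ j < i, ¬ P j) ∧ s'.var y = s.var y))
    (.inr ⟨fun _ h => absurd h (Nat.not_lt_zero _), rfl⟩) (by
      intro i hi s' hF hI
      have hF' := frame_trans hF (frame_setVar (c := .ite b (.assign y e) .skip) s' i)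
      have hb' := hb i hi _ hF' (by simp)
      have he' := he i hi _ hF' (by simp)
      rw [run]
      split_ifs with h
      · refine .inl ⟨i, by omega, hb'.1 h, ?_⟩
        rw [run, State.setVar_var_self]
        exact he' (hb'.1 h)
      · rw [run, State.setVar_var_ne _ _ hxy.symm]
        have hP : ¬ P i := fun hP => h (hb'.2 hP)
        rcases hI with ⟨j, hj, h'⟩ | ⟨h1, h2⟩
        · exact .inl ⟨j, by omega, h'⟩
        · refine .inr ⟨fun j hj => ?_, h2⟩
          rcases Nat.lt_succ_iff_lt_or_eq.1 hj with h3 | rfl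
          exacts [h1 j h3, hP])
  rw [find, hrun, State.setVar_var_ne _ _ hxy.symm]
  exact hI

/-- Store `e` in entry `i` of the array `a`, for all values of `x`. -/
def fill (x a : ℕ) (i e : LExpr) : LProg := .loop x (.store a i e)

/-- If `e` reads only the entries of `a` that have been stored before, then the final array is a
solution of the recursion. -/
theorem run_fill {x a : ℕ} {d e : LExpr} {s : State} (g : ℕ → ℕ)
    (hg : ∀ i < n, ∀ j < n, g i = g j → i = j)
    (hd : ∀ i < n, ∀ s', (fill x a d e).Frame s s' → s'.var x = i → d.eval I s' = g i)
    (he : ∀ i < n, ∀ s₁ s₂, (fill x a d e).Frame s s₁ → (fill x a d e).Frame s s₂ →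
      s₁.var x = i → s₂.var x = i → (∀ j < i, s₁.arr a (g j) = s₂.arr a (g j)) →
      e.eval I s₁ = e.eval I s₂) :
    ∀ i < n, ((fill x a d e).run I s).arr a (g i) =
      e.eval I (((fill x a d e).run I s).setVar x i) := by
  -- The recursion is stated with the current array rather than the array at the time of storing. By
  -- `he`, later stores do not matter for it.
  obtain ⟨s', hF, hI, hrun⟩ := run_loop I (x := x) (c := .store a d e) (s := s)
    (fun i s' => ∀ j < i, s'.arr a (g j) = e.eval I (s'.setVar x j))
    (fun _ h => absurd h (Nat.not_lt_zero _)) (by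
      intro i hi s' hF hI j hj
      have hF' := frame_trans hF (frame_setVar (c := .store a d e) s' i)
      have hrun : (store a d e).run I (s'.setVar x i) =
          (s'.setVar x i).setArr a (g i) (e.eval I (s'.setVar x i)) := by
        rw [run, hd i hi _ hF' (by simp)]
      have hF'' : (loop x (.store a d e)).Frame s ((store a d e).run I (s'.setVar x i)) :=
        frame_trans hF' (frame_run I (store a d e) (s'.setVar x i) |> fun h =>
          ⟨fun y hy => h.var y (by simp [setsVar]), fun b hb => h.arr b hb⟩)
      have hold : ∀ l < i, ((store a d e).run I (s'.setVar x i)).arr a (g l) =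
          s'.arr a (g l) := by
        intro l hl
        rw [hrun, State.setArr_arr, if_pos rfl, Function.update_of_ne]
        · rfl
        · intro h
          have := hg l (by omega) i hi h
          omega
      rcases Nat.lt_succ_iff_lt_or_eq.1 hj with h3 | rfl
      · rw [hold j h3, hI j h3]
        refine he j (by omega) _ _ (frame_trans hF (frame_setVar _ _))
          (frame_trans hF'' (frame_setVar _ _)) (by simp) (by simp) fun l hl => ?_
        rw [State.setVar_arr, State.setVar_arr, hold l (by omega)]
      · have : ((store a d e).run I (s'.setVar x j)).arr a (g j) = e.eval I (s'.setVar x j) := by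
          rw [hrun, State.setArr_arr, if_pos rfl, Function.update_self]
        rw [this]
        refine he j hi _ _ hF' (frame_trans hF'' (frame_setVar _ _)) (by simp) (by simp)
          fun l hl => ?_
        rw [State.setVar_arr, State.setVar_arr, hold l (by omega)])
  intro i hi
  rw [fill, hrun]
  have h2 : (s'.setVar x n).setVar x i = s'.setVar x i := by simp [State.setVar]
  rw [h2]
  exact hI i hi

/-- If the body of the loop changes the array `a` only in entry `x`, to a value with property `Q x`,
then all entries get this property. -/
theorem run_table {x a : ℕ} {c : LProg} {s : State} (Q : ℕ → ℕ → Prop)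
    (hc : ∀ i < n, ∀ s', (loop x c).Frame s s' → s'.var x = i →
      ∃ k, (c.run I s').arr a = Function.update (s'.arr a) i k ∧ Q i k) :
    ∀ i < n, Q i (((loop x c).run I s).arr a i) := by
  obtain ⟨s', hF, hI, hrun⟩ := run_loop I (x := x) (c := c) (s := s)
    (fun i s' => ∀ j < i, Q j (s'.arr a j))
    (fun _ h => absurd h (Nat.not_lt_zero _)) (by
      intro i hi s' hF hI j hj
      obtain ⟨k, h1, h2⟩ := hc i hi _ (frame_trans hF (frame_setVar (c := c) s' i)) (by simp)
      rw [h1]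
      rcases Nat.lt_succ_iff_lt_or_eq.1 hj with h3 | rfl
      · rw [Function.update_of_ne (by omega)]
        exact hI j h3
      · rwa [Function.update_self])
  rw [hrun]
  exact hI

/-- Replace each entry of the array `a` by a function of the entry. -/
theorem run_update {x a : ℕ} {e : LExpr} {s : State} (f : ℕ → ℕ)
    (he : ∀ i < n, ∀ s', (fill x a (.var x) e).Frame s s' → s'.var x = i →
      s'.arr a i = s.arr a i → e.eval I s' = f i) :
    ∀ i < n, ((fill x a (.var x) e).run I s).arr a i = f i := by
  obtain ⟨s', hF, hI, hrun⟩ := run_loop I (x := x) (c := .store a (.var x) e) (s := s)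
    (fun i s' => (∀ j < i, s'.arr a j = f j) ∧ ∀ j, i ≤ j → s'.arr a j = s.arr a j)
    ⟨fun _ h => absurd h (Nat.not_lt_zero _), fun _ _ => rfl⟩ (by
      intro i hi s' hF hI
      have hF' := frame_trans hF (frame_setVar (c := .store a (.var x) e) s' i)
      have hrun : (store a (.var x) e).run I (s'.setVar x i) =
          (s'.setVar x i).setArr a i (f i) := by
        rw [run, he i hi _ hF' (by simp) (hI.2 i le_rfl)]
        simp
      refine ⟨fun j hj => ?_, fun j hj => ?_⟩
      · rw [hrun, State.setArr_arr, if_pos rfl]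
        rcases Nat.lt_succ_iff_lt_or_eq.1 hj with h3 | rfl
        · rw [Function.update_of_ne (by omega)]
          exact hI.1 j h3
        · rw [Function.update_self]
      · rw [hrun, State.setArr_arr, if_pos rfl, Function.update_of_ne (by omega)]
        exact hI.2 j (by omega))
  rw [fill, hrun]
  exact hI.1

end LProg

end CapCenter

/-! ### The program that selects the cores. -/

namespace CapCenter

/-! ### The algorithm for a given radius -/

/-- Variables `1` and `2` hold the capacities `L` and `U`; variables `4` and `5` hold two
vertices, whose distance is the radius. -/
structure Setup {n : ℕ} (I : Instance n) (L : ℕ) (a b : Fin n) (s : State) : Prop where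
  v0 : s.var 0 = n
  v1 : s.var 1 = L
  v2 : s.var 2 = I.U
  v4 : s.var 4 = a
  v5 : s.var 5 = b

variable {n : ℕ} {I : Instance n} {L : ℕ} {a b : Fin n} {s s' : State}

theorem Setup.of_frame (h : Setup I L a b s) {c : LProg} (hF : c.Frame s s')
    (h0 : c.setsVar 0 = false := by rfl) (h1 : c.setsVar 1 = false := by rfl)
    (h2 : c.setsVar 2 = false := by rfl) (h4 : c.setsVar 4 = false := by rfl)
    (h5 : c.setsVar 5 = false := by rfl) : Setup I L a b s' :=
  ⟨(hF.var 0 h0).trans h.v0, (hF.var 1 h1).trans h.v1, (hF.var 2 h2).trans h.v2,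
    (hF.var 4 h4).trans h.v4, (hF.var 5 h5).trans h.v5⟩

theorem Setup.setVar (h : Setup I L a b s) (x k : ℕ) (hx : 5 < x := by omega) :
    Setup I L a b (s.setVar x k) := by
  refine ⟨?_, ?_, ?_, ?_, ?_⟩ <;> rw [State.setVar_var_ne _ _ (by omega)]
  exacts [h.v0, h.v1, h.v2, h.v4, h.v5]

namespace LExpr

/-- Arrays `3`, `4`, `5`, `6` hold the coverings, the cores, their parents and roots; array `7`
holds the labels, and `8`, `9`, `10`, `11` hold `k`, `c`, `e`, `E`. Variables from `20` on are
counters inside expressions. -/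
def near (x y : LExpr) : LExpr := .distLE x y (.var 4) (.var 5)

def big (x : LExpr) : LExpr := .le (.var 1) (cnt 20 (near x (.var 20)))

def touch (x y : LExpr) : LExpr :=
  ex 21 (conj (near x (.var 21)) (near y (.var 21)))

theorem holds_near (h : Setup I L a b s) (x y : LExpr) :
    (near x y).Holds I s ↔ I.Near (I.dist a b) (x.eval I s) (y.eval I s) := by
  rw [near, holds_distLE, eval_var, eval_var, h.v4, h.v5]
  constructor
  · rintro ⟨u₁, u₂, u₃, u₄, h1, h2, h3, h4, h5⟩
    obtain rfl := Fin.ext h3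
    obtain rfl := Fin.ext h4
    exact ⟨u₁, u₂, h1, h2, h5⟩
  · rintro ⟨u₁, u₂, h1, h2, h3⟩
    exact ⟨u₁, u₂, a, b, h1, h2, rfl, rfl, h3⟩

theorem holds_big (h : Setup I L a b s) {x : LExpr}
    (hx : ∀ i, x.eval I (s.setVar 20 i) = x.eval I s) :
    (big x).Holds I s ↔ I.Big (I.dist a b) L (x.eval I s) := by
  classical
  rw [big, holds_le, eval_cnt I 20 (P := I.Near (I.dist a b) (x.eval I s)) fun i _ => by
    rw [holds_near (h.setVar 20 i), hx, eval_var, State.setVar_var_self], eval_var, h.v1,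
    Instance.Big]

theorem holds_touch (h : Setup I L a b s) {x y : LExpr}
    (hx : ∀ i, x.eval I (s.setVar 21 i) = x.eval I s)
    (hy : ∀ i, y.eval I (s.setVar 21 i) = y.eval I s) :
    (touch x y).Holds I s ↔ I.Touch (I.dist a b) (x.eval I s) (y.eval I s) := by
  simp only [touch, holds_ex, holds_conj, holds_near (h.setVar 21 _), hx, hy, eval_var,
    State.setVar_var_self, Instance.Touch]

end LExpr

open LExpr LProg

/-- The vertex `x` is large and not covered. -/
def LExpr.uncovered (x : LExpr) : LExpr := conj (big x) (neg (.read 3 x))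

/-- The choice of the next core, in the variables `11` and `12`. -/
def selectCore : LProg :=
  .seq (.assign 11 (.const 0)) (.seq (.assign 12 (.const 0)) (.seq
    (find 13 11 (uncovered (.var 13)) (succ (.var 13))) (.seq
    (find 13 11 (conj (uncovered (.var 13))
      (ex 22 (conj (.read 3 (.var 22)) (touch (.var 13) (.var 22)))))
      (succ (.var 13)))
    (find 14 12 (conj (.var 11) (conj (.read 3 (.var 14)) (touch (pred (.var 11)) (.var 14))))
      (.read 3 (.var 14))))))

theorem holds_uncovered (h : Setup I L a b s) (x : ℕ) (hx : x ≠ 20) :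
    (uncovered (.var x)).Holds I s ↔
      I.Big (I.dist a b) L (s.var x) ∧ s.arr 3 (s.var x) = 0 := by
  simp [uncovered, holds_big h (x := .var x) (fun i => by simp [State.setVar_var, hx])]

/-- The first search finds any uncovered big vertex. The second replaces it by one that touches a
covered vertex, if possible. The third takes as parent a core covering such a touched vertex.
Vertices are stored with offset one, so that `0` means none. -/
theorem selectCore_spec (h : Setup I L a b s) :
    CoreChoice n (I.Big (I.dist a b) L) (I.Touch (I.dist a b)) (s.arr 3)
      ((selectCore.run I s).var 11) ((selectCore.run I s).var 12) := by
  obtain ⟨s₀, hs₀⟩ : ∃ s₀, s₀ = (s.setVar 11 0).setVar 12 0 := ⟨_, rfl⟩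
  have h₀ : Setup I L a b s₀ := by rw [hs₀]; exact (h.setVar 11 0).setVar 12 0
  have a₀ : s₀.arr 3 = s.arr 3 := by rw [hs₀]; rfl
  have u₀ : s₀.var 11 = 0 := by rw [hs₀]; simp [State.setVar_var]
  have p₀ : s₀.var 12 = 0 := by rw [hs₀]; simp
  set c₁ := find 13 11 (uncovered (.var 13)) (succ (.var 13)) with hc₁
  set c₂ := find 13 11 (conj (uncovered (.var 13))
      (ex 22 (conj (.read 3 (.var 22)) (touch (.var 13) (.var 22)))))
      (succ (.var 13)) with hc₂
  set c₃ := find 14 12 (conj (.var 11) (conj (.read 3 (.var 14))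
      (touch (pred (.var 11)) (.var 14)))) (.read 3 (.var 14)) with hc₃
  have hrun : selectCore.run I s = c₃.run I (c₂.run I (c₁.run I s₀)) := by rw [hs₀]; rfl
  have F₁ := frame_run I c₁ s₀
  have h₁ := h₀.of_frame F₁
  have S₁ := run_find I (x := 13) (y := 11) (by decide) (b := uncovered (.var 13))
    (e := succ (.var 13)) (s := s₀)
    (fun i => I.Big (I.dist a b) L i ∧ s.arr 3 i = 0) (fun i => i + 1)
    (fun i _ s' hF hi => by
      rw [holds_uncovered (h₀.of_frame hF) 13 (by decide), hi, hF.arr 3 rfl, a₀])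
    (fun i _ s' hF hi _ => by rw [eval_succ, eval_var, hi])
  rw [← hc₁, u₀] at S₁
  obtain ⟨s₁, hs₁⟩ : ∃ s₁, s₁ = c₁.run I s₀ := ⟨_, rfl⟩
  rw [← hs₁] at F₁ h₁ S₁ hrun
  have a₁ : s₁.arr 3 = s.arr 3 := (F₁.arr 3 rfl).trans a₀
  have p₁ : s₁.var 12 = 0 := (F₁.var 12 rfl).trans p₀
  have F₂ := frame_run I c₂ s₁
  have h₂ := h₁.of_frame F₂
  have S₂ := run_find I (x := 13) (y := 11) (by decide) (b := conj (uncovered (.var 13))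
      (ex 22 (conj (.read 3 (.var 22)) (touch (.var 13) (.var 22)))))
    (e := succ (.var 13)) (s := s₁)
    (fun i => (I.Big (I.dist a b) L i ∧ s.arr 3 i = 0) ∧
      ∃ w < n, s.arr 3 w ≠ 0 ∧ I.Touch (I.dist a b) i w) (fun i => i + 1)
    (fun i _ s' hF hi => by
      have h' := h₁.of_frame hF
      have e1 := holds_uncovered h' 13 (by decide)
      have e2 : ∀ j, (touch (.var 13) (.var 22)).Holds I (s'.setVar 22 j) ↔
          I.Touch (I.dist a b) i j := fun j => by
        rw [holds_touch (h'.setVar 22 j) (fun j => by simp [State.setVar_var])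
          (fun j => by simp [State.setVar_var])]
        simp [State.setVar_var, hi]
      rw [hi, hF.arr 3 rfl, a₁] at e1
      simp only [holds_conj, e1, holds_ex, e2, holds_read, eval_var, State.setVar_var_self,
        State.setVar_arr, hF.arr 3 rfl, a₁])
    (fun i _ s' hF hi _ => by rw [eval_succ, eval_var, hi])
  rw [← hc₂] at S₂
  obtain ⟨s₂, hs₂⟩ : ∃ s₂, s₂ = c₂.run I s₁ := ⟨_, rfl⟩
  rw [← hs₂] at F₂ h₂ S₂ hrun
  have a₂ : s₂.arr 3 = s.arr 3 := (F₂.arr 3 rfl).trans a₁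
  have p₂ : s₂.var 12 = 0 := (F₂.var 12 rfl).trans p₁
  have F₃ := frame_run I c₃ s₂
  have S₃ := run_find I (x := 14) (y := 12) (by decide) (b := conj (.var 11)
      (conj (.read 3 (.var 14)) (touch (pred (.var 11)) (.var 14))))
    (e := .read 3 (.var 14)) (s := s₂)
    (fun i => s₂.var 11 ≠ 0 ∧ s.arr 3 i ≠ 0 ∧ I.Touch (I.dist a b) (s₂.var 11 - 1) i) (s.arr 3)
    (fun i _ s' hF hi => by
      have h' := h₂.of_frame hF
      rw [holds_conj, holds_conj, holds_touch h' (fun j => by simp [State.setVar_var])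
        (fun j => by simp [State.setVar_var])]
      simp only [holds_read, holds_var, eval_var, eval_pred, hi, hF.arr 3 rfl, a₂,
        hF.var 11 rfl])
    (fun i _ s' hF hi _ => by rw [eval_read, eval_var, hi, hF.arr 3 rfl, a₂])
  rw [← hc₃, ← hrun, p₂] at S₃
  rw [hrun, F₃.var 11 rfl, ← hrun]
  constructor
  · intro hu
    refine ⟨?_, ?_⟩
    · rcases S₃ with ⟨i, _, h1, _⟩ | ⟨_, h1⟩
      exacts [absurd hu h1.1, h1]
    · rcases S₂ with ⟨i, _, _, h1⟩ | ⟨_, h1⟩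
      · omega
      · rcases S₁ with ⟨i, _, _, h2⟩ | ⟨h2, _⟩
        · omega
        · exact fun w hw hb h0 => h2 w hw ⟨hb, h0⟩
  · intro hu
    rcases S₂ with ⟨i, hi, h0, h1⟩ | ⟨_, h1⟩
    · rw [h1]; exact ⟨hi, h0.1⟩
    · rcases S₁ with ⟨i, hi, h0, h2⟩ | ⟨_, h2⟩
      · rw [h1, h2]; exact ⟨hi, h0⟩
      · omega
  -- Had the second search succeeded, the third would have found a nonzero parent; so it failed, and
  -- no uncovered big vertex touches a covered one.
  · intro hpr w hw w' hw' hb h0 h0' ht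
    rcases S₂ with ⟨i, hi, ⟨_, w'', hw'', h2, h3⟩, h1⟩ | ⟨h1, _⟩
    · rcases S₃ with ⟨j, _, h4, h5⟩ | ⟨h4, _⟩
      · exact h4.2.1 (h5 ▸ hpr)
      · exact h4 w'' hw'' ⟨by omega, h2, by rw [h1]; exact h3⟩
    · exact h1 w hw ⟨⟨hb, h0⟩, w', hw', h0', ht⟩
  · intro hpr
    rcases S₃ with ⟨j, hj, h4, h5⟩ | ⟨_, h4⟩
    · exact ⟨h4.1, j, hj, h5.symm, h4.2.2⟩
    · exact absurd h4 hpr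

/-- One round: the core `t` of variable `10` is selected. -/
def coreRound : LProg :=
  .seq (.assign 10 (succ (.var 9))) (.seq selectCore (.seq
    (.store 4 (.var 10) (.var 11)) (.seq
    (.store 5 (.var 10) (.var 12)) (.seq
    (.store 6 (.var 10) (.ite (.var 12) (.read 6 (.var 12)) (.var 10)))
    (fill 14 3 (.var 14) (.ite (conj (.var 11) (conj (uncovered (.var 14))
      (touch (pred (.var 11)) (.var 14)))) (.var 10) (.read 3 (.var 14))))))))

/-- The coverings found for the previous pair are erased first. Arrays `4`, `5`, `6` need no reset,
since the invariant after `m` rounds involves only the nodes `1, …, m`. -/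
def cores : LProg := .seq (fill 13 3 (.var 13) (.const 0)) (.loop 9 coreRound)

theorem coreRound_spec (hL : 1 ≤ L) (h : Setup I L a b s)
    (hI : CoreInv n (I.Big (I.dist a b) L) (I.Touch (I.dist a b)) (s.var 9)
      (s.arr 4) (s.arr 5) (s.arr 6) (s.arr 3)) :
    CoreInv n (I.Big (I.dist a b) L) (I.Touch (I.dist a b)) (s.var 9 + 1)
      ((coreRound.run I s).arr 4) ((coreRound.run I s).arr 5) ((coreRound.run I s).arr 6)
      ((coreRound.run I s).arr 3) := by
  obtain ⟨s₀, hs₀⟩ : ∃ s₀, s₀ = s.setVar 10 (s.var 9 + 1) := ⟨_, rfl⟩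
  have h₀ : Setup I L a b s₀ := by rw [hs₀]; exact h.setVar 10 _
  have a₀ : s₀.arr = s.arr := by rw [hs₀]; rfl
  have v₀ : s₀.var 10 = s.var 9 + 1 := by rw [hs₀]; simp
  have hc := selectCore_spec h₀
  have F₁ := frame_run I selectCore s₀
  obtain ⟨s₁, hs₁⟩ : ∃ s₁, s₁ = selectCore.run I s₀ := ⟨_, rfl⟩
  rw [← hs₁, a₀] at hc
  rw [← hs₁] at F₁
  have h₁ := h₀.of_frame F₁
  have a₁ : ∀ x, s₁.arr x = s.arr x := fun x => by rw [F₁.arr x rfl, a₀]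
  have v₁ : s₁.var 10 = s.var 9 + 1 := by rw [F₁.var 10 rfl, v₀]
  set u := s₁.var 11 with hu
  set pr := s₁.var 12 with hpr
  set t := s.var 9 + 1 with ht
  obtain ⟨s₂, hs₂⟩ : ∃ s₂, s₂ = ((s₁.setArr 4 t u).setArr 5 t pr).setArr 6 t
    (if pr = 0 then t else s.arr 6 pr) := ⟨_, rfl⟩
  have var₂ : s₂.var = s₁.var := by rw [hs₂]; rfl
  have h₂ : Setup I L a b s₂ := by
    constructor <;> rw [var₂]
    exacts [h₁.v0, h₁.v1, h₁.v2, h₁.v4, h₁.v5]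
  set c := fill 14 3 (.var 14) (.ite (conj (.var 11) (conj (uncovered (.var 14))
      (touch (pred (.var 11)) (.var 14)))) (.var 10) (.read 3 (.var 14))) with hcdef
  have hrun : coreRound.run I s = c.run I s₂ := by
    have : coreRound.run I s = c.run I (((s₁.setArr 4 (s₁.var 10) u).setArr 5 (s₁.var 10)
        pr).setArr 6 (s₁.var 10) ((LExpr.ite (.var 12) (.read 6 (.var 12)) (.var 10)).eval I
        ((s₁.setArr 4 (s₁.var 10) u).setArr 5 (s₁.var 10) pr))) := by
      rw [hu, hpr, hs₁, hs₀]; rfl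
    rw [this, hs₂, v₁]
    congr 2
    split_ifs with h0
    · rw [eval_ite_neg, eval_var, State.setArr_var, State.setArr_var, v₁]
      simpa [← hpr] using h0
    · rw [eval_ite_pos, eval_read, eval_var]
      · simp [State.setArr_arr, a₁, ← hpr]
      · simpa [← hpr] using h0
  have F := frame_run I c s₂
  have a₂ : s₂.arr 3 = s.arr 3 := by rw [hs₂]; simp [State.setArr_arr, a₁]
  -- The new covering as a function of the old one: the update of an entry depends only on that
  -- entry, so the array can be overwritten in place.
  obtain ⟨f, hf₁, hf₂⟩ : ∃ f : ℕ → ℕ,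
      (∀ i, (u ≠ 0 ∧ I.Big (I.dist a b) L i ∧ s.arr 3 i = 0 ∧
        I.Touch (I.dist a b) (u - 1) i) → f i = t) ∧
      ∀ i, ¬ (u ≠ 0 ∧ I.Big (I.dist a b) L i ∧ s.arr 3 i = 0 ∧
        I.Touch (I.dist a b) (u - 1) i) → f i = s.arr 3 i := by
    classical
    exact ⟨fun i => if u ≠ 0 ∧ I.Big (I.dist a b) L i ∧ s.arr 3 i = 0 ∧
        I.Touch (I.dist a b) (u - 1) i then t else s.arr 3 i, fun i h => if_pos h,
        fun i h => if_neg h⟩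
  have hcov : ∀ i < n, (c.run I s₂).arr 3 i = f i :=
    run_update I (s := s₂) (x := 14) (a := 3) (e := (.ite (conj (.var 11)
      (conj (uncovered (.var 14)) (touch (pred (.var 11)) (.var 14)))) (.var 10)
      (.read 3 (.var 14)))) f
      (fun i _ s' hF hi ha => by
        have h' := h₂.of_frame hF
        have e1 : (conj (.var 11) (conj (uncovered (.var 14))
            (touch (pred (.var 11)) (.var 14)))).Holds I s' ↔
            (u ≠ 0 ∧ I.Big (I.dist a b) L i ∧ s.arr 3 i = 0 ∧
              I.Touch (I.dist a b) (u - 1) i) := by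
          rw [holds_conj, holds_conj, holds_uncovered h' 14 (by decide),
            holds_touch h' (fun j => by simp [State.setVar_var])
            (fun j => by simp [State.setVar_var])]
          simp only [holds_var, eval_var, eval_pred, hi, ha, a₂, hF.var 11 rfl, var₂, ← hu,
            and_assoc]
        by_cases hP : (u ≠ 0 ∧ I.Big (I.dist a b) L i ∧ s.arr 3 i = 0 ∧
            I.Touch (I.dist a b) (u - 1) i)
        · rw [eval_ite_pos I (e1.2 hP), eval_var, hF.var 10 rfl, var₂, v₁, hf₁ i hP]
        · rw [eval_ite_neg I (fun h => hP (e1.1 h)), eval_read, eval_var, hi, ha, a₂, hf₂ i hP])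
  refine hI.step (fun _ _ h => h.symm) (fun _ h => h.touch_self hL) hc ?_ ?_ ?_ ?_ ?_
  · rw [hrun, F.arr 4 rfl, hs₂]
    simp [State.setArr_arr, a₁]
    rfl
  · rw [hrun, F.arr 5 rfl, hs₂]
    simp [State.setArr_arr, a₁]
    rfl
  · rw [hrun, F.arr 6 rfl, hs₂]
    simp [State.setArr_arr, a₁]
    rfl
  · intro w hw h1 h2 h3 h4
    rw [hrun, hcov w hw, hf₁ w ⟨h1, h2, h3, h4⟩]
  · intro w hw h1
    rw [hrun, hcov w hw, hf₂ w h1]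

theorem cores_spec (hL : 1 ≤ L) (h : Setup I L a b s) :
    CoreInv n (I.Big (I.dist a b) L) (I.Touch (I.dist a b)) n
      ((cores.run I s).arr 4) ((cores.run I s).arr 5) ((cores.run I s).arr 6)
      ((cores.run I s).arr 3) := by
  set c := fill 13 3 (.var 13) (.const 0) with hc
  have F := frame_run I c s
  have h0 : ∀ i < n, (c.run I s).arr 3 i = 0 :=
    run_update I (fun _ => 0) (fun _ _ _ _ _ _ => rfl)
  obtain ⟨s', hF', hI, hrun⟩ := run_loop I (x := 9) (c := coreRound) (s := c.run I s)
    (fun m s' => CoreInv n (I.Big (I.dist a b) L) (I.Touch (I.dist a b)) m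
      (s'.arr 4) (s'.arr 5) (s'.arr 6) (s'.arr 3)) (CoreInv.init h0) (by
      intro i hi s' hF hI
      have := coreRound_spec hL (((h.of_frame F).of_frame hF).setVar 9 i)
        (by rw [State.setVar_var_self]; exact hI)
      rwa [State.setVar_var_self] at this)
  have : cores.run I s = s'.setVar 9 n := by rw [cores, run, hrun]
  rw [this]
  exact hI

end CapCenter

/-! ### Homes of the vertices, and the computation of the allotment. -/

namespace CapCenter

open LExpr LProg

variable {n : ℕ} {I : Instance n} {L : ℕ} {a b : Fin n} {s s' : State}

/-! #### The initial assignment to the cores -/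

/-- The second search overrides the first: a vertex in the ball of a core must belong to that core,
so that the core keeps at least `L` vertices in its ball. -/
def homeRound : LProg :=
  .seq (.assign 16 (.const 0)) (.seq
    (find 14 16 (conj (.read 3 (.var 14)) (near (.var 14) (.var 15))) (.read 3 (.var 14))) (.seq
    (find 14 16 (conj (conj (.read 3 (.var 14)) (near (.var 14) (.var 15)))
      (LExpr.eq (.read 4 (.read 3 (.var 14))) (succ (.var 14)))) (.read 3 (.var 14)))
    (.store 7 (.var 15) (.var 16))))

def homes : LProg := .loop 15 homeRound

/-- `x` is a core that covers a vertex `w` near to `v`; if some `w` is a core, then `w` is. -/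
def HomeVal {n : ℕ} (I : Instance n) (r : ℝ≥0) (core cov : ℕ → ℕ) (v x : ℕ) : Prop :=
  ((∃ w < n, cov w ≠ 0 ∧ I.Near r w v ∧ x = cov w) ∨
    (∀ w < n, ¬ (cov w ≠ 0 ∧ I.Near r w v)) ∧ x = 0) ∧
  ((∃ w < n, (cov w ≠ 0 ∧ I.Near r w v) ∧ core (cov w) = w + 1) →
    ∃ w < n, (cov w ≠ 0 ∧ I.Near r w v) ∧ core (cov w) = w + 1 ∧ x = cov w)

theorem homeRound_spec (h : Setup I L a b s) :
    ∃ k, (homeRound.run I s).arr 7 = Function.update (s.arr 7) (s.var 15) k ∧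
      HomeVal I (I.dist a b) (s.arr 4) (s.arr 3) (s.var 15) k := by
  obtain ⟨s₀, hs₀⟩ : ∃ s₀, s₀ = s.setVar 16 0 := ⟨_, rfl⟩
  have h₀ : Setup I L a b s₀ := by rw [hs₀]; exact h.setVar 16 0
  have a₀ : s₀.arr = s.arr := by rw [hs₀]; rfl
  have v₀ : s₀.var 15 = s.var 15 := by rw [hs₀]; simp [State.setVar_var]
  have x₀ : s₀.var 16 = 0 := by rw [hs₀]; simp
  have hne : ∀ s' : State, s'.arr 3 = s.arr 3 → Setup I L a b s' → s'.var 15 = s.var 15 →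
      ((conj (.read 3 (.var 14)) (near (.var 14) (.var 15))).Holds I s' ↔
        s.arr 3 (s'.var 14) ≠ 0 ∧ I.Near (I.dist a b) (s'.var 14) (s.var 15)) := by
    intro s' h1 h2 h3
    rw [holds_conj, holds_read, holds_near h2, h1, eval_var, eval_var, h3]
  set c₁ := find 14 16 (conj (.read 3 (.var 14)) (near (.var 14) (.var 15)))
    (.read 3 (.var 14)) with hc₁
  set c₂ := find 14 16 (conj (conj (.read 3 (.var 14)) (near (.var 14) (.var 15)))
      (LExpr.eq (.read 4 (.read 3 (.var 14))) (succ (.var 14)))) (.read 3 (.var 14)) with hc₂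
  have hrun : homeRound.run I s = (LProg.store 7 (.var 15) (.var 16)).run I
    (c₂.run I (c₁.run I s₀)) := by rw [hs₀]; rfl
  have F₁ := frame_run I c₁ s₀
  have S₁ := run_find I (x := 14) (y := 16) (by decide) (b := conj (.read 3 (.var 14))
      (near (.var 14) (.var 15))) (e := .read 3 (.var 14)) (s := s₀)
    (fun i => s.arr 3 i ≠ 0 ∧ I.Near (I.dist a b) i (s.var 15)) (s.arr 3)
    (fun i _ s' hF hi => by
      rw [hne s' (by rw [hF.arr 3 rfl, a₀]) (h₀.of_frame hF) (by rw [hF.var 15 rfl, v₀]), hi])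
    (fun i _ s' hF hi _ => by rw [eval_read, eval_var, hi, hF.arr 3 rfl, a₀])
  rw [← hc₁, x₀] at S₁
  obtain ⟨s₁, hs₁⟩ : ∃ s₁, s₁ = c₁.run I s₀ := ⟨_, rfl⟩
  rw [← hs₁] at F₁ S₁ hrun
  have h₁ := h₀.of_frame F₁
  have F₂ := frame_run I c₂ s₁
  have S₂ := run_find I (x := 14) (y := 16) (by decide) (b := conj (conj (.read 3 (.var 14))
      (near (.var 14) (.var 15))) (LExpr.eq (.read 4 (.read 3 (.var 14))) (succ (.var 14))))
    (e := .read 3 (.var 14)) (s := s₁)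
    (fun i => (s.arr 3 i ≠ 0 ∧ I.Near (I.dist a b) i (s.var 15)) ∧ s.arr 4 (s.arr 3 i) = i + 1)
    (s.arr 3)
    (fun i _ s' hF hi => by
      rw [holds_conj, hne s' (by rw [hF.arr 3 rfl, F₁.arr 3 rfl, a₀]) (h₁.of_frame hF)
        (by rw [hF.var 15 rfl, F₁.var 15 rfl, v₀]), holds_eq, eval_read, eval_read, eval_succ,
        eval_var, hi, hF.arr 3 rfl, F₁.arr 3 rfl, hF.arr 4 rfl, F₁.arr 4 rfl, a₀])
    (fun i _ s' hF hi _ => by rw [eval_read, eval_var, hi, hF.arr 3 rfl, F₁.arr 3 rfl, a₀])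
  rw [← hc₂] at S₂
  refine ⟨(c₂.run I s₁).var 16, ?_, ?_, ?_⟩
  · rw [hrun, run, State.setArr_arr, if_pos rfl, eval_var, eval_var, F₂.arr 7 rfl, F₁.arr 7 rfl,
      a₀, F₂.var 15 rfl, F₁.var 15 rfl, v₀]
  · rcases S₂ with ⟨w, hw, h1, h2⟩ | ⟨_, h2⟩
    · exact .inl ⟨w, hw, h1.1.1, h1.1.2, h2⟩
    · rw [h2]
      rcases S₁ with ⟨w, hw, h1, h3⟩ | ⟨h1, h3⟩
      exacts [.inl ⟨w, hw, h1.1, h1.2, h3⟩, .inr ⟨h1, h3⟩]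
  · rintro ⟨w, hw, h1⟩
    rcases S₂ with ⟨w, hw, h1, h2⟩ | ⟨h3, _⟩
    · exact ⟨w, hw, h1.1, h1.2, h2⟩
    · exact absurd h1 (h3 w hw)

theorem homes_spec (h : Setup I L a b s) :
    ∀ v < n, HomeVal I (I.dist a b) (s.arr 4) (s.arr 3) v ((homes.run I s).arr 7 v) := by
  refine run_table I (x := 15) (a := 7) (c := homeRound) _ fun i hi s' hF hi' => ?_
  have := homeRound_spec (h.of_frame hF)
  rw [hF.arr 4 rfl, hF.arr 3 rfl, hi'] at this
  exact this

/-! #### The numbers of vertices that are exchanged -/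

def ownCount (t : LExpr) : LExpr := cnt 24 (LExpr.eq (.read 7 (.var 24)) t)

def kidSum (x : ℕ) (t : LExpr) : LExpr :=
  .sum 24 (.ite (LExpr.eq (.read 5 (succ (.var 24))) t) (.read x (succ (.var 24))) (.const 0))

def total (t : LExpr) : LExpr := .add (ownCount t) (kidSum 9 t)

theorem eval_ownCount {t : LExpr} (ht : t.usesVar 24 = false) :
    (ownCount t).eval I s = (labelled n (s.arr 7) (t.eval I s)).card := by
  refine eval_cnt I 24 fun i _ => ?_
  rw [holds_eq, eval_setVar I t s i ht, eval_read, eval_var, State.setVar_var_self,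
    State.setVar_arr]

theorem eval_kidSum {t : LExpr} (ht : t.usesVar 24 = false) (x : ℕ) :
    (kidSum x t).eval I s = ∑ j ∈ kids n (s.arr 5) (t.eval I s), s.arr x j := by
  rw [kidSum, eval_sumIf I 24 (P := fun i => s.arr 5 (i + 1) = t.eval I s)
    (f := fun i => s.arr x (i + 1)), kids, Finset.sum_filter]
  · exact sum_range_succ_eq_Icc n fun i => if s.arr 5 i = t.eval I s then s.arr x i else 0
  · intro i _
    rw [holds_eq, eval_setVar I t s i ht, eval_read, eval_succ, eval_var, State.setVar_var_self,
      State.setVar_arr]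
  · intro i _ _
    rw [eval_read, eval_succ, eval_var, State.setVar_var_self, State.setVar_arr]

theorem eval_total {t : LExpr} (ht : t.usesVar 24 = false) :
    (total t).eval I s = (labelled n (s.arr 7) (t.eval I s)).card +
      ∑ j ∈ kids n (s.arr 5) (t.eval I s), s.arr 9 j := by
  rw [total, eval_add, eval_ownCount ht, eval_kidSum ht]

/-- The nodes in reverse order. -/
def revNode : LExpr := .sub (.var 0) (.var 13)

/-- Parents have smaller numbers than their children, so the reverse order goes through each tree
from the leaves to the root. -/
def fillC : LProg := fill 13 9 revNode (mod 22 23 (total revNode) (.var 1))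

def fillK : LProg := fill 13 8 (succ (.var 13)) (div 22 23 (total (succ (.var 13))) (.var 1))

def fillExtra : LProg :=
  fill 13 10 (succ (.var 13)) (LExpr.min
    (.sub (.read 9 (.read 6 (succ (.var 13))))
      (.sum 24 (.ite (conj (LExpr.lt (.var 24) (.var 13))
        (LExpr.eq (.read 6 (succ (.var 24))) (.read 6 (succ (.var 13)))))
        (.read 10 (succ (.var 24))) (.const 0))))
    (mul 22 (.read 8 (succ (.var 13))) (.sub (.var 2) (.var 1))))

def fillE : LProg := fill 13 11 revNode (.add (.read 10 revNode) (kidSum 11 revNode))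

/-- Values at later nodes determine the sum over the children. -/
theorem sum_kids_congr {par : ℕ → ℕ} (hpar : ∀ t, 1 ≤ t → t ≤ n → par t < t) {i : ℕ} (hi : i < n)
    {f g : ℕ → ℕ} (h : ∀ j < i, f (n - j) = g (n - j)) :
    ∑ j ∈ kids n par (n - i), f j = ∑ j ∈ kids n par (n - i), g j := by
  refine Finset.sum_congr rfl fun j hj => ?_
  simp only [kids, Finset.mem_filter, Finset.mem_Icc] at hj
  have h1 := hpar j hj.1.1 hj.1.2
  have h2 := h (n - j) (by omega)
  rwa [Nat.sub_sub_self hj.1.2] at h2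

/-- Division is only available for quotients up to `n`. A core has at most `n` own vertices and at
most `n` children, each handing over at most `L - 1`, so its total is at most `n * L`. -/
theorem fillC_spec (hL : 1 ≤ L) (h : Setup I L a b s)
    (hpar : ∀ t, 1 ≤ t → t ≤ n → s.arr 5 t < t) :
    ∀ t, 1 ≤ t → t ≤ n → (fillC.run I s).arr 9 t < L ∧
      (labelled n (s.arr 7) t).card + ∑ j ∈ kids n (s.arr 5) t, (fillC.run I s).arr 9 j =
        divUpTo n ((labelled n (s.arr 7) t).card +
          ∑ j ∈ kids n (s.arr 5) t, (fillC.run I s).arr 9 j) L * L + (fillC.run I s).arr 9 t := by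
  have hev : ∀ i < n, ∀ s', fillC.Frame s s' → s'.var 13 = i →
      (mod 22 23 (total revNode) (.var 1)).eval I s' =
      ((labelled n (s.arr 7) (n - i)).card + ∑ j ∈ kids n (s.arr 5) (n - i), s'.arr 9 j) -
      divUpTo n ((labelled n (s.arr 7) (n - i)).card +
        ∑ j ∈ kids n (s.arr 5) (n - i), s'.arr 9 j) L * L := by
    intro i hi s' hF hi'
    have h' := h.of_frame hF
    rw [eval_mod I (by decide) rfl rfl rfl, eval_total rfl, eval_var, h'.v1, revNode, eval_sub,
      eval_var, eval_var, h'.v0, hi', hF.arr 7 rfl, hF.arr 5 rfl]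
  have hf := run_fill I (x := 13) (a := 9) (d := revNode)
    (e := mod 22 23 (total revNode) (.var 1)) (s := s) (fun i => n - i)
    (fun i hi j hj hij => by omega)
    (fun i hi s' hF hi' => by
      rw [revNode, eval_sub, eval_var, eval_var, (h.of_frame (c := fillC) hF).v0, hi'])
    (fun i hi s₁ s₂ hF₁ hF₂ h1 h2 h3 => by
      rw [hev i hi s₁ hF₁ h1, hev i hi s₂ hF₂ h2, sum_kids_congr hpar hi h3])
  set c := (fillC.run I s).arr 9 with hc
  have hF := frame_run I fillC s
  have heq : ∀ t, 1 ≤ t → t ≤ n → c t = ((labelled n (s.arr 7) t).card +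
      ∑ j ∈ kids n (s.arr 5) t, c j) - divUpTo n ((labelled n (s.arr 7) t).card +
        ∑ j ∈ kids n (s.arr 5) t, c j) L * L := by
    intro t h1 h2
    have h3 := (hf (n - t) (by omega)).trans (hev (n - t) (by omega)
      ((fillC.run I s).setVar 13 (n - t)) (frame_trans hF (frame_setVar _ _)) (by simp))
    simp only [Nat.sub_sub_self h2, State.setVar_arr] at h3
    exact h3
  -- Induction from the last node down: the bound on the total at `t` needs `c j < L` for the
  -- children, which have larger numbers.
  have key : ∀ m t, t + m = n → 1 ≤ t → c t < L ∧
      (labelled n (s.arr 7) t).card + ∑ j ∈ kids n (s.arr 5) t, c j =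
        divUpTo n ((labelled n (s.arr 7) t).card + ∑ j ∈ kids n (s.arr 5) t, c j) L * L + c t := by
    intro m
    induction m using Nat.strong_induction_on with
    | _ m ih =>
      intro t ht h1
      have h2 : ∑ j ∈ kids n (s.arr 5) t, c j ≤ n * (L - 1) := by
        calc _ ≤ ∑ j ∈ kids n (s.arr 5) t, (L - 1) := by
              refine Finset.sum_le_sum fun j hj => ?_
              simp only [kids, Finset.mem_filter, Finset.mem_Icc] at hj
              have h3 := hpar j hj.1.1 hj.1.2
              have := (ih (n - j) (by omega) j (by omega) hj.1.1).1
              omega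
          _ ≤ n * (L - 1) := by
              rw [Finset.sum_const, smul_eq_mul]
              refine Nat.mul_le_mul_right _ ?_
              calc _ ≤ (Finset.Icc 1 n).card := Finset.card_filter_le _ _
                _ = n := by simp
      have h3 : (labelled n (s.arr 7) t).card ≤ n :=
        (Finset.card_filter_le _ _).trans (Finset.card_range n).le
      have h4 : n * (L - 1) + n = n * L := by
        obtain ⟨l, rfl⟩ : ∃ l, L = l + 1 := ⟨L - 1, by omega⟩
        rw [Nat.add_sub_cancel, Nat.mul_succ]
      have h5 := heq t h1 (by omega)
      rw [divUpTo_eq (by omega) (by omega)] at h5 ⊢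
      have h6 := Nat.mod_add_div' ((labelled n (s.arr 7) t).card +
        ∑ j ∈ kids n (s.arr 5) t, c j) L
      have h7 := Nat.mod_lt ((labelled n (s.arr 7) t).card +
        ∑ j ∈ kids n (s.arr 5) t, c j) (show L > 0 by omega)
      constructor <;> omega
  exact fun t h1 h2 => key (n - t) t (by omega) h1

theorem fillK_spec (h : Setup I L a b s) :
    ∀ t, 1 ≤ t → t ≤ n → (fillK.run I s).arr 8 t = divUpTo n ((labelled n (s.arr 7) t).card +
      ∑ j ∈ kids n (s.arr 5) t, s.arr 9 j) L := by
  have hev : ∀ i < n, ∀ s', fillK.Frame s s' → s'.var 13 = i →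
      (div 22 23 (total (succ (.var 13))) (.var 1)).eval I s' =
      divUpTo n ((labelled n (s.arr 7) (i + 1)).card +
        ∑ j ∈ kids n (s.arr 5) (i + 1), s.arr 9 j) L := by
    intro i hi s' hF hi'
    rw [eval_div I (by decide) rfl rfl rfl, eval_total rfl, eval_var, (h.of_frame hF).v1,
      eval_succ, eval_var, hi', hF.arr 7 rfl, hF.arr 5 rfl, hF.arr 9 rfl]
  have hf := run_fill I (x := 13) (a := 8) (d := succ (.var 13))
    (e := div 22 23 (total (succ (.var 13))) (.var 1)) (s := s) (fun i => i + 1)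
    (fun i hi j hj hij => by omega)
    (fun i hi s' hF hi' => by rw [eval_succ, eval_var, hi'])
    (fun i hi s₁ s₂ hF₁ hF₂ h1 h2 h3 => by rw [hev i hi s₁ hF₁ h1, hev i hi s₂ hF₂ h2])
  intro t h1 h2
  have h3 := (hf (t - 1) (by omega)).trans (hev (t - 1) (by omega)
    ((fillK.run I s).setVar 13 (t - 1)) (frame_trans (frame_run I fillK s) (frame_setVar _ _))
    (by simp))
  simp only [Nat.sub_add_cancel h1] at h3
  exact h3

theorem fillExtra_spec (h : Setup I L a b s) (hk : ∀ t, 1 ≤ t → t ≤ n → s.arr 8 t ≤ n) :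
    ∀ t, 1 ≤ t → t ≤ n → (fillExtra.run I s).arr 10 t =
      min (s.arr 9 (s.arr 6 t) - ∑ j ∈ (tree n (s.arr 6) (s.arr 6 t)).filter (· < t),
        (fillExtra.run I s).arr 10 j) (s.arr 8 t * (I.U - L)) := by
  have hev : ∀ i < n, ∀ s', fillExtra.Frame s s' → s'.var 13 = i →
      (LExpr.min (.sub (.read 9 (.read 6 (succ (.var 13))))
      (.sum 24 (.ite (conj (LExpr.lt (.var 24) (.var 13))
        (LExpr.eq (.read 6 (succ (.var 24))) (.read 6 (succ (.var 13)))))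
        (.read 10 (succ (.var 24))) (.const 0))))
        (mul 22 (.read 8 (succ (.var 13))) (.sub (.var 2) (.var 1)))).eval I s' =
      min (s.arr 9 (s.arr 6 (i + 1)) -
        ∑ j ∈ (tree n (s.arr 6) (s.arr 6 (i + 1))).filter (· < i + 1), s'.arr 10 j)
        (s.arr 8 (i + 1) * (I.U - L)) := by
    intro i hi s' hF hi'
    have h' := h.of_frame hF
    have h1 : (mul 22 (.read 8 (succ (.var 13))) (.sub (.var 2) (.var 1))).eval I s' =
        s.arr 8 (i + 1) * (I.U - L) := by
      have h2 : (LExpr.read 8 (succ (.var 13))).eval I s' = s.arr 8 (i + 1) := by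
        rw [eval_read, eval_succ, eval_var, hi', hF.arr 8 rfl]
      rw [eval_mul I rfl rfl (by rw [h2]; exact hk _ (by omega) (by omega)), h2, eval_sub,
        eval_var, eval_var, h'.v1, h'.v2]
    have h2 := eval_sumIf I (s := s') (a := conj (LExpr.lt (.var 24) (.var 13))
        (LExpr.eq (.read 6 (succ (.var 24))) (.read 6 (succ (.var 13)))))
        (b := .read 10 (succ (.var 24))) 24
        (P := fun j => j + 1 < i + 1 ∧ s.arr 6 (j + 1) = s.arr 6 (i + 1))
        (f := fun j => s'.arr 10 (j + 1))
        (fun j _ => by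
          rw [holds_conj, holds_lt, holds_eq]
          simp [State.setVar_var, hi', hF.arr 6 rfl])
        (fun j _ _ => by simp)
    rw [sum_range_succ_eq_Icc n fun j => if j < i + 1 ∧ s.arr 6 j = s.arr 6 (i + 1)
      then s'.arr 10 j else 0, ← Finset.sum_filter] at h2
    rw [eval_min, h1, eval_sub, h2, eval_read, eval_read, eval_succ, eval_var, hi', hF.arr 9 rfl,
      hF.arr 6 rfl, tree, Finset.filter_filter]
    simp only [and_comm]
  have hf := run_fill I (x := 13) (a := 10) (d := succ (.var 13)) (e := LExpr.min
    (.sub (.read 9 (.read 6 (succ (.var 13))))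
      (.sum 24 (.ite (conj (LExpr.lt (.var 24) (.var 13))
        (LExpr.eq (.read 6 (succ (.var 24))) (.read 6 (succ (.var 13)))))
        (.read 10 (succ (.var 24))) (.const 0))))
        (mul 22 (.read 8 (succ (.var 13))) (.sub (.var 2) (.var 1)))) (s := s) (fun i => i + 1)
    (fun i hi j hj hij => by omega)
    (fun i hi s' hF hi' => by rw [eval_succ, eval_var, hi'])
    (fun i hi s₁ s₂ hF₁ hF₂ h1 h2 h3 => by
      rw [hev i hi s₁ hF₁ h1, hev i hi s₂ hF₂ h2]
      congr 2
      refine Finset.sum_congr rfl fun j hj => ?_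
      simp only [tree, Finset.mem_filter, Finset.mem_Icc] at hj
      have := h3 (j - 1) (by omega)
      rwa [Nat.sub_add_cancel hj.1.1.1] at this)
  intro t h1 h2
  have h3 := (hf (t - 1) (by omega)).trans (hev (t - 1) (by omega)
    ((fillExtra.run I s).setVar 13 (t - 1)) (frame_trans (frame_run I fillExtra s) (frame_setVar _ _))
    (by simp))
  simp only [Nat.sub_add_cancel h1] at h3
  exact h3

theorem fillE_spec (h : Setup I L a b s) (hpar : ∀ t, 1 ≤ t → t ≤ n → s.arr 5 t < t) :
    ∀ t, 1 ≤ t → t ≤ n → (fillE.run I s).arr 11 t =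
      s.arr 10 t + ∑ j ∈ kids n (s.arr 5) t, (fillE.run I s).arr 11 j := by
  have hrev : ∀ i < n, ∀ s', fillE.Frame s s' → s'.var 13 = i → revNode.eval I s' = n - i := by
    intro i hi s' hF hi'
    rw [revNode, eval_sub, eval_var, eval_var, (h.of_frame hF).v0, hi']
  have hev : ∀ i < n, ∀ s', fillE.Frame s s' → s'.var 13 = i →
      (LExpr.add (.read 10 revNode) (kidSum 11 revNode)).eval I s' =
      s.arr 10 (n - i) + ∑ j ∈ kids n (s.arr 5) (n - i), s'.arr 11 j := by
    intro i hi s' hF hi'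
    rw [eval_add, eval_kidSum rfl, eval_read, hrev i hi s' hF hi', hF.arr 10 rfl, hF.arr 5 rfl]
  have hf := run_fill I (x := 13) (a := 11) (d := revNode)
    (e := .add (.read 10 revNode) (kidSum 11 revNode)) (s := s) (fun i => n - i)
    (fun i hi j hj hij => by omega) hrev
    (fun i hi s₁ s₂ hF₁ hF₂ h1 h2 h3 => by
      rw [hev i hi s₁ hF₁ h1, hev i hi s₂ hF₂ h2, sum_kids_congr hpar hi h3])
  intro t h1 h2
  have h3 := (hf (n - t) (by omega)).trans (hev (n - t) (by omega)
    ((fillE.run I s).setVar 13 (n - t)) (frame_trans (frame_run I fillE s) (frame_setVar _ _))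
    (by simp))
  simp only [Nat.sub_sub_self h2] at h3
  exact h3

def numbers : LProg := .seq fillC (.seq fillK (.seq fillExtra fillE))

theorem numbers_spec (hL : 1 ≤ L) (h : Setup I L a b s)
    (hpar : ∀ t, 1 ≤ t → t ≤ n → s.arr 5 t < t) :
    Allotment n L I.U (s.arr 5) (s.arr 6) (fun t => (labelled n (s.arr 7) t).card)
      ((numbers.run I s).arr 8) ((numbers.run I s).arr 9) ((numbers.run I s).arr 10)
      ((numbers.run I s).arr 11) := by
  have S₁ := fillC_spec hL h hpar
  have F₁ := frame_run I fillC s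
  obtain ⟨s₁, hs₁⟩ : ∃ s₁, s₁ = fillC.run I s := ⟨_, rfl⟩
  rw [← hs₁] at S₁ F₁
  have h₁ := h.of_frame F₁
  have S₂ := fillK_spec h₁
  have F₂ := frame_run I fillK s₁
  obtain ⟨s₂, hs₂⟩ : ∃ s₂, s₂ = fillK.run I s₁ := ⟨_, rfl⟩
  rw [← hs₂] at S₂ F₂
  have h₂ := h₁.of_frame F₂
  have S₃ := fillExtra_spec h₂ (fun t h1 h2 => by rw [S₂ t h1 h2]; exact divUpTo_le _ _ _)
  have F₃ := frame_run I fillExtra s₂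
  obtain ⟨s₃, hs₃⟩ : ∃ s₃, s₃ = fillExtra.run I s₂ := ⟨_, rfl⟩
  rw [← hs₃] at S₃ F₃
  have h₃ := h₂.of_frame F₃
  have a5 : s₃.arr 5 = s.arr 5 := by rw [F₃.arr 5 rfl, F₂.arr 5 rfl, F₁.arr 5 rfl]
  have a6 : s₂.arr 6 = s.arr 6 := by rw [F₂.arr 6 rfl, F₁.arr 6 rfl]
  have S₄ := fillE_spec h₃ (by rw [a5]; exact hpar)
  have F₄ := frame_run I fillE s₃
  have hrun : numbers.run I s = fillE.run I s₃ := by rw [hs₃, hs₂, hs₁]; rfl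
  rw [← hrun] at S₄ F₄
  rw [F₁.arr 7 rfl, F₁.arr 5 rfl] at S₂
  rw [a6, F₂.arr 9 rfl] at S₃
  rw [a5] at S₄
  rw [F₄.arr 8 rfl, F₃.arr 8 rfl, F₄.arr 9 rfl, F₃.arr 9 rfl, F₂.arr 9 rfl, F₄.arr 10 rfl]
  refine ⟨fun t h1 h2 => ?_, fun t h1 h2 => (S₁ t h1 h2).1, S₃, S₄⟩
  rw [S₂ t h1 h2]
  exact (S₁ t h1 h2).2

end CapCenter

/-! ### Carrying out the exchanges, and correctness of the clustering. -/

namespace CapCenter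

open LExpr LProg

variable {n : ℕ} {I : Instance n} {L : ℕ} {a b : Fin n} {s s' : State}

/-! #### The exchanges -/

def moveInit : LProg :=
  .seq (.assign 10 (succ (.var 9))) (.ite (.le (.read 11 (.var 10)) (.read 9 (.var 10)))
    (.seq (.assign 17 (.var 10)) (.seq (.assign 18 (.read 5 (.var 10)))
      (.assign 16 (.sub (.read 9 (.var 10)) (.read 11 (.var 10))))))
    (.seq (.assign 17 (.read 5 (.var 10))) (.seq (.assign 18 (.var 10))
      (.assign 16 (.sub (.read 11 (.var 10)) (.read 9 (.var 10)))))))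

/-- The test that the source has a core is needed: the truncated predecessor of `0` is `0`, which
would be read as the first vertex. -/
def moveTest : LExpr :=
  conj (.var 16) (conj (LExpr.eq (.read 7 (.var 15)) (.var 17))
    (conj (.read 4 (.var 17)) (near (pred (.read 4 (.var 17))) (.var 15))))

def moveBody : LProg :=
  .ite moveTest (.seq (.store 7 (.var 15) (.var 18)) (.assign 16 (pred (.var 16)))) .skip

def moveLoop : LProg := .loop 15 moveBody

def moves : LProg := .loop 9 (.seq moveInit moveLoop)

/-- `v` is in the neighbourhood of the core `i`. -/
def Nbh {n : ℕ} (I : Instance n) (r : ℝ≥0) (core : ℕ → ℕ) (i v : ℕ) : Prop :=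
  core i ≠ 0 ∧ I.Near r (core i - 1) v

theorem moveInit_spec (s : State) :
    (moveInit.run I s).var 16 = exAmt (s.arr 9) (s.arr 11) (s.var 9) ∧
      (moveInit.run I s).var 17 = exSrc (s.arr 5) (s.arr 9) (s.arr 11) (s.var 9) ∧
      (moveInit.run I s).var 18 = exDst (s.arr 5) (s.arr 9) (s.arr 11) (s.var 9) := by
  have h1 : ((LExpr.le (.read 11 (.var 10)) (.read 9 (.var 10))).Holds I
      (s.setVar 10 (s.var 9 + 1))) ↔ s.arr 11 (s.var 9 + 1) ≤ s.arr 9 (s.var 9 + 1) := by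
    simp
  have hrun : moveInit.run I s = (LProg.ite (.le (.read 11 (.var 10)) (.read 9 (.var 10)))
    (.seq (.assign 17 (.var 10)) (.seq (.assign 18 (.read 5 (.var 10)))
      (.assign 16 (.sub (.read 9 (.var 10)) (.read 11 (.var 10))))))
    (.seq (.assign 17 (.read 5 (.var 10))) (.seq (.assign 18 (.var 10))
      (.assign 16 (.sub (.read 11 (.var 10)) (.read 9 (.var 10))))))).run I
      (s.setVar 10 (s.var 9 + 1)) := rfl
  rw [hrun]
  by_cases hE : s.arr 11 (s.var 9 + 1) ≤ s.arr 9 (s.var 9 + 1)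
  · rw [run_ite_pos I (h1.2 hE), exAmt, exSrc, exDst, if_pos hE, if_pos hE, if_pos hE]
    simp [run, State.setVar_var]
  · rw [run_ite_neg I (fun h => hE (h1.1 h)), exAmt, exSrc, exDst, if_neg hE, if_neg hE, if_neg hE]
    simp [run, State.setVar_var]

/-- One greedy pass relabels every suitable vertex until the counter in variable `16` is exhausted.
-/
theorem moveLoop_spec (h : Setup I L a b s)
    (hx : s.var 16 ≤
      (available n (Nbh I (I.dist a b) (s.arr 4)) (s.arr 7) (s.var 17)).card) :
    Move n (Nbh I (I.dist a b) (s.arr 4)) (s.var 17) (s.var 18) (s.var 16) (s.arr 7)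
      ((moveLoop.run I s).arr 7) := by
  classical
  set nb := Nbh I (I.dist a b) (s.arr 4) with hnb
  obtain ⟨s', hF, ⟨M, hM, hcard, hin, hout, hall⟩, hrun⟩ := run_loop I (x := 15) (c := moveBody)
    (s := s) (fun i s' => ∃ M : Finset ℕ,
      (∀ v ∈ M, v < i ∧ nb (s.var 17) v ∧ s.arr 7 v = s.var 17) ∧
      M.card + s'.var 16 = s.var 16 ∧ (∀ v ∈ M, s'.arr 7 v = s.var 18) ∧
      (∀ v, v ∉ M → s'.arr 7 v = s.arr 7 v) ∧
      (s'.var 16 ≠ 0 → ∀ v < i, nb (s.var 17) v → s.arr 7 v = s.var 17 → v ∈ M))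
    ⟨∅, by simp, by simp, by simp, fun _ _ => rfl, fun _ v hv => absurd hv (Nat.not_lt_zero v)⟩
    (by
      rintro i hi s' hF ⟨M, hM, hcard, hin, hout, hall⟩
      have hF' := frame_trans hF (frame_setVar (c := moveBody) s' i)
      have h' := h.of_frame (c := moveLoop) hF'
      have hi' : i ∉ M := fun h => by have := (hM i h).1; omega
      have htest : moveTest.Holds I (s'.setVar 15 i) ↔
          s'.var 16 ≠ 0 ∧ s.arr 7 i = s.var 17 ∧ nb (s.var 17) i := by
        rw [moveTest, holds_conj, holds_conj, holds_conj, holds_near h', holds_eq, eval_read,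
          eval_var, eval_var, eval_pred, holds_read, eval_read, eval_var, hF'.arr 4 rfl,
          hF'.var 17 rfl, State.setVar_var_self, State.setVar_arr, hout i hi', holds_var,
          State.setVar_var_ne _ _ (by decide), hnb, Nbh]
      rw [moveBody]
      by_cases ht : moveTest.Holds I (s'.setVar 15 i)
      · rw [run_ite_pos I ht]
        obtain ⟨t1, t2, t3⟩ := htest.1 ht
        have h18 : s'.var 18 = s.var 18 := hF.var 18 rfl
        have harr : ((LProg.seq (.store 7 (.var 15) (.var 18)) (.assign 16 (pred (.var 16)))).run I
            (s'.setVar 15 i)).arr 7 = Function.update (s'.arr 7) i (s.var 18) := by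
          simp [run, State.setArr_arr, State.setVar_var, h18]
        have hvar : ((LProg.seq (.store 7 (.var 15) (.var 18)) (.assign 16 (pred (.var 16)))).run I
            (s'.setVar 15 i)).var 16 = s'.var 16 - 1 := by
          simp [run, State.setVar_var]
        rw [harr, hvar]
        refine ⟨insert i M, ?_, ?_, ?_, ?_, ?_⟩
        · intro v hv
          rcases Finset.mem_insert.1 hv with rfl | hv
          · exact ⟨by omega, t3, t2⟩
          · have := hM v hv
            exact ⟨by omega, this.2⟩
        · rw [Finset.card_insert_of_notMem hi']; omega
        · intro v hv
          by_cases hvi : v = i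
          · rw [hvi, Function.update_self]
          · rw [Function.update_of_ne hvi]
            exact hin v ((Finset.mem_insert.1 hv).resolve_left hvi)
        · intro v hv
          rw [Finset.mem_insert, not_or] at hv
          rw [Function.update_of_ne hv.1, hout v hv.2]
        · intro _ v hv h1 h2
          rw [Finset.mem_insert]
          rcases Nat.lt_succ_iff_lt_or_eq.1 hv with h3 | h3
          · exact .inr (hall t1 v h3 h1 h2)
          · exact .inl h3
      · rw [run_ite_neg I ht, run]
        have hvar : (s'.setVar 15 i).var 16 = s'.var 16 := State.setVar_var_ne _ _ (by decide)
        rw [hvar]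
        refine ⟨M, fun v hv => ?_, hcard, hin, hout, fun h0 v hv h1 h2 => ?_⟩
        · have := hM v hv
          exact ⟨by omega, this.2⟩
        · rcases Nat.lt_succ_iff_lt_or_eq.1 hv with h3 | rfl
          · exact hall h0 v h3 h1 h2
          · exact absurd (htest.2 ⟨h0, h2, h1⟩) ht)
  have : (moveLoop.run I s).arr 7 = s'.arr 7 := by rw [moveLoop, hrun]; rfl
  rw [this]
  -- A nonzero counter at the end would mean that every available vertex has moved, although at
  -- least as many were available as required.
  have h0 : s'.var 16 = 0 := by
    by_contra h0
    have hsub : available n nb (s.arr 7) (s.var 17) ⊆ M := fun v hv => by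
      simp only [available, Finset.mem_filter, Finset.mem_range] at hv
      exact hall h0 v hv.1 hv.2.1 hv.2.2
    have := Finset.card_le_card hsub
    omega
  exact ⟨M, hM, by omega, hin, fun v _ => hout v⟩

theorem moves_spec (h : Setup I L a b s)
    (hnb : ∀ i, 1 ≤ i → i ≤ n → ∀ v < n, Nbh I (I.dist a b) (s.arr 4) i v → s.arr 7 v = i)
    (hsrc : ∀ m < n, exAmt (s.arr 9) (s.arr 11) m ≠ 0 →
      1 ≤ exSrc (s.arr 5) (s.arr 9) (s.arr 11) m ∧ exSrc (s.arr 5) (s.arr 9) (s.arr 11) m ≤ n)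
    (hne : ∀ m < n, exSrc (s.arr 5) (s.arr 9) (s.arr 11) m ≠
      exDst (s.arr 5) (s.arr 9) (s.arr 11) m)
    (htot : ∀ i, 1 ≤ i → i ≤ n → ∑ t ∈ (Finset.range n).filter
      (fun t => exSrc (s.arr 5) (s.arr 9) (s.arr 11) t = i), exAmt (s.arr 9) (s.arr 11) t ≤
      (available n (Nbh I (I.dist a b) (s.arr 4)) (s.arr 7) i).card) :
    MovesInv n (Nbh I (I.dist a b) (s.arr 4)) (exSrc (s.arr 5) (s.arr 9) (s.arr 11))
      (exDst (s.arr 5) (s.arr 9) (s.arr 11)) (exAmt (s.arr 9) (s.arr 11)) (s.arr 7) n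
      ((moves.run I s).arr 7) := by
  obtain ⟨s', hF, hI, hrun⟩ := run_loop I (x := 9) (c := .seq moveInit moveLoop) (s := s)
    (fun i s' => MovesInv n (Nbh I (I.dist a b) (s.arr 4))
      (exSrc (s.arr 5) (s.arr 9) (s.arr 11)) (exDst (s.arr 5) (s.arr 9) (s.arr 11))
      (exAmt (s.arr 9) (s.arr 11)) (s.arr 7) i (s'.arr 7)) (MovesInv.init fun _ _ => rfl) (by
      intro i hi s' hF hI
      have hF' := frame_trans hF (frame_setVar (c := .seq moveInit moveLoop) s' i)
      obtain ⟨s₁, hs₁⟩ : ∃ s₁, s₁ = moveInit.run I (s'.setVar 9 i) := ⟨_, rfl⟩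
      have S := moveInit_spec (I := I) (s'.setVar 9 i)
      have F₁ := frame_run I moveInit (s'.setVar 9 i)
      rw [← hs₁] at S F₁
      rw [State.setVar_var_self, hF'.arr 5 rfl, hF'.arr 9 rfl, hF'.arr 11 rfl] at S
      have h₁ := (h.of_frame (c := moves) hF').of_frame F₁
      have h7 : s₁.arr 7 = s'.arr 7 := F₁.arr 7 rfl
      have h4 : s₁.arr 4 = s.arr 4 := (F₁.arr 4 rfl).trans (hF'.arr 4 rfl)
      rw [run, ← hs₁]
      refine hI.step hnb (hsrc i hi) (hne i hi) ?_
      have := moveLoop_spec h₁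
      rw [S.1, S.2.1, S.2.2, h7, h4] at this
      refine this ?_
      by_cases h0 : exAmt (s.arr 9) (s.arr 11) i = 0
      · omega
      · obtain ⟨h1, h2⟩ := hsrc i hi h0
        exact hI.amt_le hi h1 h2 (htot _ h1 h2))
  have : (moves.run I s).arr 7 = s'.arr 7 := by rw [moves, hrun]; rfl
  rw [this]
  exact hI

/-! #### The clustering -/

/-- Every class can be divided into clusters, has small diameter, and the clusters serve at least
as many vertices as every solution of radius at most `r`. -/
structure Clustering {n : ℕ} (I : Instance n) (L : ℕ) (r : ℝ≥0) (lab k : ℕ → ℕ) : Prop where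
  lower : ∀ t, 1 ≤ t → t ≤ n → k t * L ≤ (labelled n lab t).card
  upper : ∀ t, 1 ≤ t → t ≤ n → (labelled n lab t).card ≤ k t * I.U
  lab_le : ∀ v < n, lab v ≤ n
  near : ∀ v < n, ∀ w < n, lab v ≠ 0 → lab v = lab w → I.Near (10 * r) v w
  served : ∀ T : Solution n, I.Feasible T → I.radius T ≤ r →
    T.C.card ≤ ((Finset.range n).filter fun v => lab v ≠ 0).card

section

variable {r : ℝ≥0} {core par root cov home lab k c e E : ℕ → ℕ}

theorem CoreInv.forest (hC : CoreInv n (I.Big r L) (I.Touch r) n core par root cov) :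
    Forest n par root := ⟨hC.par_lt, hC.root_eq⟩

/-- If `v` lies in the ball of core `i`, its home was found through a vertex that is itself a core
near `v`. The two cores touch in `v`, so they coincide. -/
theorem CoreInv.home_eq
    (hC : CoreInv n (I.Big r L) (I.Touch r) n core par root cov)
    (hH : ∀ v < n, HomeVal I r core cov v (home v)) :
    ∀ i, 1 ≤ i → i ≤ n → ∀ v < n, Nbh I r core i v → home v = i := by
  intro i h1 h2 v hv ⟨h0, hn⟩
  obtain ⟨h3, h4⟩ := hC.core_spec i h1 h2 h0
  obtain ⟨w, hw, ⟨h5, h6⟩, h7, h8⟩ := (hH v hv).2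
    ⟨core i - 1, h3, ⟨by omega, hn⟩, by rw [h4]; omega⟩
  rw [h8]
  refine hC.disj _ (by omega) (hC.cov_le w hw) i h1 h2 (by omega) h0 ⟨v, hv, ?_, hn⟩
  rw [h7]
  exact h6

theorem CoreInv.exists_of_home (hH : ∀ v < n, HomeVal I r core cov v (home v)) {v : ℕ}
    (hv : v < n) (h : home v ≠ 0) : ∃ w < n, cov w ≠ 0 ∧ I.Near r w v ∧ home v = cov w := by
  rcases (hH v hv).1 with h1 | ⟨_, h1⟩
  exacts [h1, absurd h1 h]

/-- Rounds that select no core leave nodes without a vertex; these are kept so that nodes are always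
`1, …, n`, and they own nothing and have no children. -/
theorem CoreInv.inactive (hC : CoreInv n (I.Big r L) (I.Touch r) n core par root cov)
    (hH : ∀ v < n, HomeVal I r core cov v (home v)) {i : ℕ} (h1 : 1 ≤ i) (h0 : core i = 0) :
    labelled n home i = ∅ ∧ kids n par i = ∅ := by
  refine ⟨Finset.filter_eq_empty_iff.2 fun v hv hvi => ?_,
    Finset.filter_eq_empty_iff.2 fun j hj hji => ?_⟩
  · obtain ⟨w, hw, h2, _, h3⟩ := exists_of_home hH (Finset.mem_range.1 hv) (by omega)
    exact (hC.cov_spec w hw h2).2.1 (by rw [← h3, hvi, h0])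
  · have hj := Finset.mem_Icc.1 hj
    exact (hC.par_core j hj.1 hj.2 (by omega)).2.1 (by rw [hji, h0])

theorem exSrc_ne_exDst (F : Forest n par root) {m : ℕ} (hm : m < n) :
    exSrc par c E m ≠ exDst par c E m := by
  have := F.par_lt (m + 1) (by omega) (by omega)
  rw [exSrc, exDst]
  split_ifs <;> omega

/-- A root satisfies `E ≤ c`, so nothing is ever requested from the nonexistent parent of a root. -/
theorem exSrc_mem (F : Forest n par root)
    (A : Allotment n L I.U par root (fun t => (labelled n home t).card) k c e E) {m : ℕ}
    (hm : m < n) : 1 ≤ exSrc par c E m ∧ exSrc par c E m ≤ n := by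
  have h1 := F.par_lt (m + 1) (by omega) (by omega)
  have h2 := A.E_le_c F (t := m + 1) (by omega) (by omega)
  rw [exSrc]
  split_ifs with h
  · omega
  · have : par (m + 1) ≠ 0 := fun h0 => h (h2 h0)
    omega

/-- Fewer than `L` vertices leave a core, and its ball contains at least `L` vertices, all of which
have it as home. A node without a core has total zero, hence nothing to give. -/
theorem sum_exSrc_le
    (hC : CoreInv n (I.Big r L) (I.Touch r) n core par root cov)
    (hH : ∀ v < n, HomeVal I r core cov v (home v))
    (A : Allotment n L I.U par root (fun t => (labelled n home t).card) k c e E) :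
    ∀ i, 1 ≤ i → i ≤ n → ∑ t ∈ (Finset.range n).filter (fun t => exSrc par c E t = i),
      exAmt c E t ≤ (available n (Nbh I r core) home i).card := by
  intro i h1 h2
  rw [sum_exSrc n par c E h1 h2]
  by_cases h0 : core i = 0
  · obtain ⟨h3, h4⟩ := hC.inactive hH h1 h0
    have h5 := A.balance i h1 h2
    simp only [h3, h4, Finset.card_empty, Finset.sum_empty] at h5 ⊢
    omega
  · refine (A.out_lt hC.forest h1 h2).le.trans ?_
    obtain ⟨h3, h4⟩ := hC.core_spec i h1 h2 h0
    have hbig := (hC.cov_spec _ h3 (by omega)).1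
    refine le_trans hbig (Finset.card_le_card fun v hv => ?_)
    simp only [Finset.mem_filter, Finset.mem_range, available] at hv ⊢
    exact ⟨hv.1, ⟨h0, hv.2⟩, hC.home_eq hH i h1 h2 v hv.1 ⟨h0, hv.2⟩⟩

/-- After the exchanges, every vertex is within distance `5 r` of its core. -/
theorem near_core (hC : CoreInv n (I.Big r L) (I.Touch r) n core par root cov)
    (hH : ∀ v < n, HomeVal I r core cov v (home v))
    (A : Allotment n L I.U par root (fun t => (labelled n home t).card) k c e E)
    (hM : MovesInv n (Nbh I r core) (exSrc par c E) (exDst par c E) (exAmt c E) home n lab) {v : ℕ}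
    (hv : v < n) (h0 : lab v ≠ 0) : lab v ≤ n ∧ I.Near (5 * r) v (core (lab v) - 1) := by
  have F := hC.forest
  -- Core `t` touches a vertex that touches the parent core, and touching vertices are within `2 *
  -- r`.
  have link : ∀ t, 1 ≤ t → t ≤ n → par t ≠ 0 →
      I.Near (4 * r) (core t - 1) (core (par t) - 1) := by
    intro t h1 h2 h3
    obtain ⟨_, _, w, _, h4, h5⟩ := hC.par_core t h1 h2 h3
    exact (h4.near.trans h5.near).mono (le_of_eq (by ring))
  -- An unmoved vertex is within `r` of a vertex covered by its core, so within `3 * r` of the core.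
  -- A moved one starts within `r` of its old core and crosses one tree edge.
  rcases hM.lab_or v hv with h1 | ⟨⟨_, h1⟩, t, ht, h2, h3, h4⟩
  · rw [h1] at h0 ⊢
    obtain ⟨w, hw, h2, h3, h4⟩ := CoreInv.exists_of_home hH hv h0
    rw [h4]
    refine ⟨hC.cov_le w hw, (h3.symm.trans (hC.cov_spec w hw h2).2.2.near).mono ?_⟩
    calc r + (r + r) = 3 * r := by ring
      _ ≤ 5 * r := by gcongr; norm_num
  · have hp := F.par_lt (t + 1) (by omega) (by omega)
    have hsrc := exSrc_mem F A ht
    by_cases hE : E (t + 1) ≤ c (t + 1)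
    · rw [exSrc, if_pos hE] at h2
      rw [exDst, if_pos hE] at h3
      rw [← h3] at h0 ⊢
      rw [← h2] at h1
      exact ⟨by omega, (h1.symm.trans (link _ (by omega) (by omega) h0)).mono
        (le_of_eq (by ring))⟩
    · rw [exSrc, if_neg hE] at h2 hsrc
      rw [exDst, if_neg hE] at h3
      rw [← h3]
      rw [← h2] at h1
      exact ⟨by omega, (h1.symm.trans (link _ (by omega) (by omega) (by omega)).symm).mono
        (le_of_eq (by ring))⟩

theorem card_labelled (A : Allotment n L I.U par root (fun t => (labelled n home t).card) k c e E)
    (hM : MovesInv n (Nbh I r core) (exSrc par c E) (exDst par c E) (exAmt c E) home n lab) {t : ℕ}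
    (h1 : 1 ≤ t) (h2 : t ≤ n) : (labelled n lab t).card = k t * L + e t := by
  have h3 := hM.size t h1 h2
  rw [sum_exSrc n par c E h1 h2, sum_exDst n par c E h1 h2] at h3
  exact A.size_eq h1 h2 h3

theorem sum_card_labelled (n : ℕ) (f : ℕ → ℕ) (T : Finset ℕ) :
    ∑ t ∈ T, (labelled n f t).card = ((Finset.range n).filter fun v => f v ∈ T).card := by
  rw [Finset.card_eq_sum_card_fiberwise (f := f) (s := (Finset.range n).filter fun v => f v ∈ T)
    (t := T) fun v hv => (Finset.mem_filter.1 hv).2]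
  refine Finset.sum_congr rfl fun t ht => ?_
  congr 1
  ext v
  simp only [labelled, Finset.mem_filter, Finset.mem_range]
  constructor
  · rintro ⟨h1, rfl⟩; exact ⟨⟨h1, ht⟩, rfl⟩
  · rintro ⟨⟨h1, _⟩, h2⟩; exact ⟨h1, h2⟩

/-- `card_served_le` is applied with the trees as parts and the number of vertices at home in each
tree as `M`; `Allotment.served_ge` shows that each tree attains the resulting bound. -/
theorem served_le (hL : L = I.L + (1 - I.L)) (hLU : L ≤ I.U)
    (hC : CoreInv n (I.Big r L) (I.Touch r) n core par root cov)
    (hH : ∀ v < n, HomeVal I r core cov v (home v))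
    (A : Allotment n L I.U par root (fun t => (labelled n home t).card) k c e E)
    (hM : MovesInv n (Nbh I r core) (exSrc par c E) (exDst par c E) (exAmt c E) home n lab)
    (T : Solution n) (hT : I.Feasible T) (hr : I.radius T ≤ r) :
    T.C.card ≤ ((Finset.range n).filter fun v => lab v ≠ 0).card := by
  classical
  have F := hC.forest
  set R := (Finset.Icc 1 n).filter fun t => par t = 0 with hR
  have hcov : ∀ u : Fin n, I.Big r L u → cov u ≠ 0 ∧ cov u ≤ n := fun u hu =>
    ⟨hC.all_covered u u.2 hu, hC.cov_le u u.2⟩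
  refine (card_served_le I hT hr hL (fun u => root (cov u)) R
    (fun ρ => ∑ t ∈ tree n root ρ, (labelled n home t).card) ?_ ?_).trans ?_
  · intro u hu
    obtain ⟨h1, h2⟩ := hcov u hu
    obtain ⟨h3, h4, h5⟩ := F.root_spec (cov u) (by omega) h2
    simp only [hR, Finset.mem_filter, Finset.mem_Icc]
    exact ⟨⟨h3, by omega⟩, h5⟩
  · intro ρ hρ
    rw [sum_card_labelled, ← Finset.card_map Fin.valEmbedding]
    refine Finset.card_le_card fun x hx => ?_
    simp only [Finset.mem_map, Finset.mem_filter, Finset.mem_univ, true_and,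
      Fin.valEmbedding_apply, Finset.mem_range] at hx ⊢
    obtain ⟨v, ⟨u, hu, hn, hg⟩, rfl⟩ := hx
    obtain ⟨h1, h2⟩ := hcov u hu
    have h0 : home v ≠ 0 := by
      rcases (hH v v.2).1 with ⟨w, _, h3, _, h4⟩ | ⟨h3, _⟩
      · rwa [h4]
      · exact absurd ⟨h1, hn⟩ (h3 u u.2)
    -- The big vertex `w` that determined the home of `v` and the center `u` touch in `v`, so they
    -- belong to the same tree.
    obtain ⟨w, hw, h3, h4, h5⟩ := CoreInv.exists_of_home hH v.2 h0
    refine ⟨v.2, ?_⟩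
    simp only [tree, Finset.mem_filter, Finset.mem_Icc]
    refine ⟨⟨by omega, h5 ▸ hC.cov_le w hw⟩, ?_⟩
    rw [h5, ← hg]
    exact hC.same w hw u u.2 h3 h1 ⟨v, v.2, h4, hn⟩
  · calc _ ≤ ∑ ρ ∈ R, ∑ t ∈ tree n root ρ, (labelled n lab t).card := by
          refine Finset.sum_le_sum fun ρ hρ => ?_
          simp only [hR, Finset.mem_filter, Finset.mem_Icc] at hρ
          refine (A.served_ge F hLU hρ.1.1 hρ.1.2 hρ.2).trans (le_of_eq ?_)
          refine Finset.sum_congr rfl fun t ht => ?_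
          simp only [tree, Finset.mem_filter, Finset.mem_Icc] at ht
          rw [card_labelled A hM ht.1.1 ht.1.2]
      _ = ∑ t ∈ Finset.Icc 1 n, (labelled n lab t).card := by
          refine Finset.sum_fiberwise_of_maps_to (g := root) (fun t ht => ?_) _
          have ht := Finset.mem_Icc.1 ht
          obtain ⟨h3, h4, h5⟩ := F.root_spec t ht.1 ht.2
          simp only [hR, Finset.mem_filter, Finset.mem_Icc]
          exact ⟨⟨h3, by omega⟩, h5⟩
      _ = ((Finset.range n).filter fun v => lab v ∈ Finset.Icc 1 n).card :=
          sum_card_labelled n lab _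
      _ ≤ _ := by
          refine Finset.card_le_card fun v hv => ?_
          simp only [Finset.mem_filter, Finset.mem_Icc] at hv ⊢
          exact ⟨hv.1, by omega⟩

theorem clustering (hL : L = I.L + (1 - I.L)) (hLU : L ≤ I.U)
    (hC : CoreInv n (I.Big r L) (I.Touch r) n core par root cov)
    (hH : ∀ v < n, HomeVal I r core cov v (home v))
    (A : Allotment n L I.U par root (fun t => (labelled n home t).card) k c e E)
    (hM : MovesInv n (Nbh I r core) (exSrc par c E) (exDst par c E) (exAmt c E) home n lab) :
    Clustering I L r lab k where
  lower t h1 h2 := by rw [card_labelled A hM h1 h2]; omega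
  upper t h1 h2 := by
    have h3 := A.e_le h1 h2
    rw [card_labelled A hM h1 h2]
    calc _ ≤ k t * L + k t * (I.U - L) := by omega
      _ = k t * I.U := by rw [← Nat.mul_add, Nat.add_sub_cancel' hLU]
  lab_le v hv := by
    by_cases h0 : lab v = 0
    · omega
    · exact (near_core hC hH A hM hv h0).1
  near v hv w hw h0 h := by
    have h1 := (near_core hC hH A hM hv h0).2
    have h2 := (near_core hC hH A hM hw (h ▸ h0)).2
    rw [← h] at h2
    exact (h1.trans h2.symm).mono (le_of_eq (by ring))
  served := served_le hL hLU hC hH A hM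

end

/-- The computation of the clustering. -/
def cluster : LProg := .seq cores (.seq homes (.seq numbers moves))

theorem cluster_spec (hL : L = I.L + (1 - I.L)) (hLU : L ≤ I.U) (h : Setup I L a b s) :
    Clustering I L (I.dist a b) ((cluster.run I s).arr 7) ((cluster.run I s).arr 8) := by
  have hL1 : 1 ≤ L := by omega
  have hC := cores_spec hL1 h
  have F₁ := frame_run I cores s
  obtain ⟨s₁, hs₁⟩ : ∃ s₁, s₁ = cores.run I s := ⟨_, rfl⟩
  rw [← hs₁] at hC F₁
  have h₁ := h.of_frame F₁
  have hH := homes_spec h₁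
  have F₂ := frame_run I homes s₁
  obtain ⟨s₂, hs₂⟩ : ∃ s₂, s₂ = homes.run I s₁ := ⟨_, rfl⟩
  rw [← hs₂] at hH F₂
  have h₂ := h₁.of_frame F₂
  have A := numbers_spec hL1 h₂ (by rw [F₂.arr 5 rfl]; exact hC.par_lt)
  have F₃ := frame_run I numbers s₂
  obtain ⟨s₃, hs₃⟩ : ∃ s₃, s₃ = numbers.run I s₂ := ⟨_, rfl⟩
  rw [← hs₃] at A F₃
  have h₃ := h₂.of_frame F₃
  rw [F₂.arr 5 rfl, F₂.arr 6 rfl] at A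
  have F₄ := frame_run I moves s₃
  have hM := moves_spec h₃
  rw [F₃.arr 4 rfl, F₂.arr 4 rfl, F₃.arr 5 rfl, F₂.arr 5 rfl, F₃.arr 7 rfl] at hM
  have hrun : cluster.run I s = moves.run I s₃ := by rw [hs₃, hs₂, hs₁]; rfl
  rw [hrun, F₄.arr 8 rfl]
  exact clustering hL hLU hC hH A (hM (hC.home_eq hH)
    (fun m hm _ => exSrc_mem hC.forest A hm) (fun m hm => exSrc_ne_exDst hC.forest hm)
    (sum_exSrc_le hC hH A))

end CapCenter

/-! ### Output of a solution, and the search over all radii. -/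

namespace CapCenter

open LExpr LProg

variable {n : ℕ} {I : Instance n} {L : ℕ} {a b : Fin n} {s s' : State}

/-! #### The output -/

/-- If every class is divided by the rank modulo `k`, then the result is a solution. -/
theorem Clustering.feasible {r : ℝ≥0} {lab k : ℕ → ℕ} (h : Clustering I L r lab k) (hL : I.L ≤ L)
    {S : Solution n} (hC : ∀ v : Fin n, v ∈ S.C ↔ lab v ≠ 0)
    (hF : ∀ u : Fin n, u ∈ S.F ↔ lab u ≠ 0 ∧ rank lab u < k (lab u))
    (hφ : ∀ v ∈ S.C, lab (S.φ v) = lab v ∧ rank lab (S.φ v) = rank lab v % k (lab v))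
    (hk : ∀ v : Fin n, lab v ≠ 0 → 0 < k (lab v)) (hp : I.p ≤ S.C.card) :
    I.Feasible S ∧ I.radius S ≤ 10 * r := by
  have key : ∀ u ∈ S.F, L ≤ (S.C.filter fun v => S.φ v = u).card ∧
      (S.C.filter fun v => S.φ v = u).card ≤ I.U := by
    intro u hu
    obtain ⟨h0, h1⟩ := (hF u).1 hu
    have hn := h.lab_le u u.2
    have h2 := card_cluster h1 (h.lower _ (by omega) hn) (h.upper _ (by omega) hn)
    have h3 : ((labelled n lab (lab u)).filter fun v => rank lab v % k (lab u) = rank lab u) =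
        (S.C.filter fun v => S.φ v = u).map Fin.valEmbedding := by
      ext x
      simp only [labelled, Finset.mem_filter, Finset.mem_range, Finset.mem_map,
        Fin.valEmbedding_apply]
      constructor
      · rintro ⟨⟨hx, h4⟩, h5⟩
        have hxC : (⟨x, hx⟩ : Fin n) ∈ S.C := (hC _).2 (by rw [h4]; exact h0)
        obtain ⟨h6, h7⟩ := hφ _ hxC
        refine ⟨⟨x, hx⟩, ⟨hxC, Fin.ext (rank_injOn (h6.trans h4) ?_)⟩, rfl⟩
        rw [h7, h4, h5]
      · rintro ⟨v, ⟨hv, rfl⟩, rfl⟩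
        obtain ⟨h6, h7⟩ := hφ v hv
        exact ⟨⟨v.2, h6.symm⟩, by rw [h7, h6]⟩
    rw [h3, Finset.card_map] at h2
    exact h2
  refine ⟨⟨fun v hv => ?_, hp, fun u hu => hL.trans (key u hu).1, fun u hu => (key u hu).2⟩, ?_⟩
  · obtain ⟨h1, h2⟩ := hφ v hv
    have h0 := (hC v).1 hv
    rw [hF, h1, h2]
    exact ⟨h0, Nat.mod_lt _ (hk v h0)⟩
  · refine Finset.sup_le fun v hv => ?_
    obtain ⟨u, w, hu, hw, h1⟩ := h.near v v.2 (S.φ v) (S.φ v).2 ((hC v).1 hv) (hφ v hv).1.symm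
    rwa [Fin.ext hu, Fin.ext hw] at h1

/-- A nonempty class of at most `k * I.U` vertices needs at least one cluster. -/
theorem Clustering.pos {r : ℝ≥0} {lab k : ℕ → ℕ} (h : Clustering I L r lab k) {v : ℕ} (hv : v < n)
    (h0 : lab v ≠ 0) : 0 < k (lab v) := by
  have h1 := rank_lt_card (lab := lab) hv
  have h2 := h.upper (lab v) (by omega) (h.lab_le v hv)
  by_contra h3
  rw [Nat.eq_zero_of_not_pos h3, zero_mul] at h2
  omega

theorem rank_le (lab : ℕ → ℕ) (v : ℕ) : rank lab v ≤ v :=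
  (Finset.card_filter_le _ _).trans (Finset.card_range v).le

def rankExpr (x : LExpr) : LExpr :=
  cnt 25 (conj (lt (.var 25) x) (LExpr.eq (.read 7 (.var 25)) (.read 7 x)))

theorem eval_rankExpr {x : LExpr} (hx : x.usesVar 25 = false) (h : x.eval I s < n) :
    (rankExpr x).eval I s = rank (s.arr 7) (x.eval I s) := by
  rw [rankExpr, eval_cnt I 25 (P := fun i => i < x.eval I s ∧
    s.arr 7 i = s.arr 7 (x.eval I s)) fun i _ => by
      rw [holds_conj, holds_lt, holds_eq, eval_read, eval_read, eval_var, eval_setVar I x s i hx,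
        State.setVar_var_self, State.setVar_arr], rank]
  congr 1
  ext i
  simp only [Finset.mem_filter, Finset.mem_range]
  constructor
  · rintro ⟨_, h1⟩; exact h1
  · rintro h1; exact ⟨by omega, h1⟩

def residue : LExpr := mod 22 23 (rankExpr (.var 15)) (.read 8 (.read 7 (.var 15)))

theorem eval_residue {v : ℕ} (h15 : s.var 15 = v) (hv : v < n)
    (hk : 0 < s.arr 8 (s.arr 7 v)) :
    residue.eval I s = rank (s.arr 7) v % s.arr 8 (s.arr 7 v) := by
  have h1 : (rankExpr (.var 15)).eval I s = rank (s.arr 7) v := by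
    rw [eval_rankExpr rfl (by rw [eval_var, h15]; exact hv), eval_var, h15]
  have h2 := rank_le (s.arr 7) v
  -- The rank is at most `v < n`, so the quotient stays within the range of the bounded division.
  rw [residue, eval_mod I (by decide) rfl rfl rfl, h1, eval_read, eval_read, eval_var, h15,
    divUpTo_eq hk ((h2.trans hv.le).trans (Nat.le_mul_of_pos_right n hk))]
  have := Nat.div_add_mod' (rank (s.arr 7) v) (s.arr 8 (s.arr 7 v))
  omega

def openTest : LExpr :=
  conj (.read 7 (.var 15)) (lt (rankExpr (.var 15)) (.read 8 (.read 7 (.var 15))))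

def markServed : LProg := fill 15 0 (.var 15) (.ite (.read 7 (.var 15)) (.const 1) (.const 0))

def markOpen : LProg := fill 15 1 (.var 15) (.ite openTest (.const 1) (.const 0))

def centerTest : LExpr :=
  conj (LExpr.eq (.read 7 (.var 14)) (.read 7 (.var 15)))
    (LExpr.eq (rankExpr (.var 14)) residue)

def findCenter : LProg := find 14 16 centerTest (.var 14)

def assignCenters : LProg := .loop 15 (.seq findCenter (.store 2 (.var 15) (.var 16)))

theorem markServed_spec (s : State) :
    ∀ v < n, (markServed.run I s).arr 0 v = 1 ↔ s.arr 7 v ≠ 0 := by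
  intro v hv
  rw [markServed, run_update I (fun v => if s.arr 7 v ≠ 0 then 1 else 0) (fun i _ s' hF hi _ => ?_)
    v hv]
  · split_ifs with h <;> simp [h]
  · have h1 : (LExpr.read 7 (.var 15)).Holds I s' ↔ s.arr 7 i ≠ 0 := by
      rw [holds_read, eval_var, hi, hF.arr 7 rfl]
    split_ifs with h
    exacts [eval_ite_pos I (h1.2 h), eval_ite_neg I fun h' => h (h1.1 h')]

theorem markOpen_spec (s : State) :
    ∀ v < n, (markOpen.run I s).arr 1 v = 1 ↔
      s.arr 7 v ≠ 0 ∧ rank (s.arr 7) v < s.arr 8 (s.arr 7 v) := by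
  intro v hv
  rw [markOpen, run_update I
    (fun v => if s.arr 7 v ≠ 0 ∧ rank (s.arr 7) v < s.arr 8 (s.arr 7 v) then 1 else 0)
    (fun i hi' s' hF hi _ => ?_) v hv]
  · split_ifs with h <;> simp [h]
  · have h1 : openTest.Holds I s' ↔
        s.arr 7 i ≠ 0 ∧ rank (s.arr 7) i < s.arr 8 (s.arr 7 i) := by
      rw [openTest, holds_conj, holds_lt, eval_rankExpr rfl (by rw [eval_var, hi]; exact hi'),
        holds_read, eval_read, eval_read, eval_var, hi, hF.arr 7 rfl, hF.arr 8 rfl]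
    split_ifs with h
    exacts [eval_ite_pos I (h1.2 h), eval_ite_neg I fun h' => h (h1.1 h')]

/-- The residue is at most the rank of `v`, and the ranks in a class form an initial segment, so the
class has a vertex of that rank. -/
theorem findCenter_spec {v : ℕ} (h15 : s.var 15 = v) (hv : v < n)
    (hk : 0 < s.arr 8 (s.arr 7 v)) :
    (findCenter.run I s).var 16 < n ∧
      s.arr 7 ((findCenter.run I s).var 16) = s.arr 7 v ∧
      rank (s.arr 7) ((findCenter.run I s).var 16) =
        rank (s.arr 7) v % s.arr 8 (s.arr 7 v) := by
  rcases run_find I (x := 14) (y := 16) (by decide) (b := centerTest) (e := .var 14) (s := s)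
    (fun u => s.arr 7 u = s.arr 7 v ∧
      rank (s.arr 7) u = rank (s.arr 7) v % s.arr 8 (s.arr 7 v)) id
    (fun i hi s' hF hi' => by
      have e7 : s'.arr 7 = s.arr 7 := hF.arr 7 rfl
      have e8 : s'.arr 8 = s.arr 8 := hF.arr 8 rfl
      have e15 : s'.var 15 = v := (hF.var 15 rfl).trans h15
      rw [centerTest, holds_conj, holds_eq, holds_eq,
        eval_rankExpr rfl (by rw [eval_var, hi']; exact hi),
        eval_residue e15 hv (by rw [e7, e8]; exact hk), eval_read, eval_read, eval_var, eval_var,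
        hi', e15, e7, e8])
    (fun i _ s' _ hi' _ => hi') with ⟨i, hi, h1, h2⟩ | ⟨h1, _⟩
  · rw [findCenter, h2]
    exact ⟨hi, h1⟩
  · obtain ⟨u, hu, h2⟩ := exists_rank (n := n) (lab := s.arr 7) (t := s.arr 7 v)
      (i := rank (s.arr 7) v % s.arr 8 (s.arr 7 v))
      ((Nat.mod_le _ _).trans_lt (rank_lt_card hv))
    exact absurd h2 (h1 u hu)

theorem assignCenters_spec (s : State)
    (hk : ∀ v < n, s.arr 7 v ≠ 0 → 0 < s.arr 8 (s.arr 7 v)) :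
    ∀ v < n, s.arr 7 v ≠ 0 → (assignCenters.run I s).arr 2 v < n ∧
      s.arr 7 ((assignCenters.run I s).arr 2 v) = s.arr 7 v ∧
      rank (s.arr 7) ((assignCenters.run I s).arr 2 v) =
        rank (s.arr 7) v % s.arr 8 (s.arr 7 v) := by
  refine run_table I (fun v u => s.arr 7 v ≠ 0 → u < n ∧ s.arr 7 u = s.arr 7 v ∧
    rank (s.arr 7) u = rank (s.arr 7) v % s.arr 8 (s.arr 7 v)) fun i hi s' hF hi' => ?_
  have F := frame_run I findCenter s'
  have e7 : s'.arr 7 = s.arr 7 := hF.arr 7 rfl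
  have e8 : s'.arr 8 = s.arr 8 := hF.arr 8 rfl
  have h2 : (findCenter.run I s').arr 2 = s'.arr 2 := F.arr 2 rfl
  have h15 : (findCenter.run I s').var 15 = i := (F.var 15 rfl).trans hi'
  refine ⟨(findCenter.run I s').var 16, ?_, fun h0 => ?_⟩
  · rw [run, run, State.setArr_arr, if_pos rfl, eval_var, eval_var, h15, h2]
  · have := findCenter_spec (I := I) hi' hi (by rw [e7, e8]; exact hk i hi h0)
    rwa [e7, e8] at this

def record : LProg := .seq (.assign 8 (.const 1)) (.seq (.assign 6 (.var 4)) (.assign 7 (.var 5)))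

def write : LProg := .seq record (.seq markServed (.seq markOpen assignCenters))

def acceptTest : LExpr :=
  conj (.le (.var 3) (cnt 24 (.read 7 (.var 24))))
    (neg (conj (.var 8) (neg (.distLE (.var 4) (.var 5) (.var 6) (.var 7)))))

/-- Output the solution, if it serves enough vertices and is better than the previous one. -/
def accept : LProg := .ite acceptTest write .skip

/-- If variable `8` is set, then a solution has been found, for the radius given by
variables `6` and `7`. -/
def Found {n : ℕ} (I : Instance n) (s : State) : Prop :=
  s.var 8 ≠ 0 → ∃ a b : Fin n, s.var 6 = a ∧ s.var 7 = b ∧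
    ∃ S, s.Outputs S ∧ I.Feasible S ∧ I.radius S ≤ 10 * I.dist a b

/-- A solution has been found, for a radius of at most `r`. -/
def Below {n : ℕ} (I : Instance n) (s : State) (r : ℝ≥0) : Prop :=
  s.var 8 ≠ 0 ∧ ∃ a b : Fin n, s.var 6 = a ∧ s.var 7 = b ∧ I.dist a b ≤ r

theorem write_spec (hL : I.L ≤ L) (h : Setup I L a b s)
    (hC : Clustering I L (I.dist a b) (s.arr 7) (s.arr 8))
    (hp : I.p ≤ ((Finset.range n).filter fun v => s.arr 7 v ≠ 0).card) :
    Found I (write.run I s) ∧ Below I (write.run I s) (I.dist a b) := by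
  classical
  have F₁ := frame_run I record s
  have S₁ : (record.run I s).var 8 = 1 ∧ (record.run I s).var 6 = a ∧
      (record.run I s).var 7 = b := by
    simp [record, run, State.setVar_var, h.v4, h.v5]
  obtain ⟨s₁, hs₁⟩ : ∃ s₁, s₁ = record.run I s := ⟨_, rfl⟩
  rw [← hs₁] at F₁ S₁
  have F₂ := frame_run I markServed s₁
  have S₂ := markServed_spec (I := I) s₁
  obtain ⟨s₂, hs₂⟩ : ∃ s₂, s₂ = markServed.run I s₁ := ⟨_, rfl⟩
  rw [← hs₂] at F₂ S₂
  have F₃ := frame_run I markOpen s₂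
  have S₃ := markOpen_spec (I := I) s₂
  obtain ⟨s₃, hs₃⟩ : ∃ s₃, s₃ = markOpen.run I s₂ := ⟨_, rfl⟩
  rw [← hs₃] at F₃ S₃
  have F₄ := frame_run I assignCenters s₃
  have S₄ := assignCenters_spec (I := I) s₃
  have hrun : write.run I s = assignCenters.run I s₃ := by rw [hs₃, hs₂, hs₁]; rfl
  rw [← hrun] at F₄ S₄
  have a1 : s₁.arr 7 = s.arr 7 := F₁.arr 7 rfl
  have a2 : s₂.arr 7 = s.arr 7 := (F₂.arr 7 rfl).trans a1
  have a3 : s₃.arr 7 = s.arr 7 := (F₃.arr 7 rfl).trans a2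
  have b2 : s₂.arr 8 = s.arr 8 := (F₂.arr 8 rfl).trans (F₁.arr 8 rfl)
  have b3 : s₃.arr 8 = s.arr 8 := (F₃.arr 8 rfl).trans b2
  rw [a1] at S₂
  rw [a2, b2] at S₃
  rw [a3, b3] at S₄
  have S₄ := S₄ fun v hv => hC.pos hv
  have v8 : (write.run I s).var 8 ≠ 0 := by
    rw [F₄.var 8 rfl, F₃.var 8 rfl, F₂.var 8 rfl, S₁.1]; decide
  have v6 : (write.run I s).var 6 = a := by
    rw [F₄.var 6 rfl, F₃.var 6 rfl, F₂.var 6 rfl, S₁.2.1]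
  have v7 : (write.run I s).var 7 = b := by
    rw [F₄.var 7 rfl, F₃.var 7 rfl, F₂.var 7 rfl, S₁.2.2]
  have o0 : (write.run I s).arr 0 = s₂.arr 0 := (F₄.arr 0 rfl).trans (F₃.arr 0 rfl)
  have o1 : (write.run I s).arr 1 = s₃.arr 1 := F₄.arr 1 rfl
  refine ⟨fun _ => ⟨a, b, v6, v7, ?_⟩, v8, a, b, v6, v7, le_rfl⟩
  let S : Solution n :=
    { C := Finset.univ.filter fun v : Fin n => s.arr 7 v ≠ 0
      F := Finset.univ.filter fun u : Fin n =>
        s.arr 7 u ≠ 0 ∧ rank (s.arr 7) u < s.arr 8 (s.arr 7 u)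
      -- Outside the served vertices the value is arbitrary; `v` is a default.
      φ := fun v => if hv : s.arr 7 v ≠ 0 then ⟨(write.run I s).arr 2 v, (S₄ v v.2 hv).1⟩ else v }
  have hφ : ∀ v ∈ S.C, (S.φ v : ℕ) = (write.run I s).arr 2 v := by
    intro v hv
    have hv : s.arr 7 v ≠ 0 := by simpa [S] using hv
    simp only [S, dif_pos hv]
  refine ⟨S, ⟨fun v => ?_, fun u => ?_, hφ⟩, hC.feasible hL (S := S) (fun v => by simp [S])
    (fun u => by simp [S]) (fun v hv => ?_) (fun v => hC.pos v.2) ?_⟩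
  · rw [o0, S₂ v v.2]; simp [S]
  · rw [o1, S₃ u u.2]; simp [S]
  · rw [hφ v hv]
    exact (S₄ v v.2 (by simpa [S] using hv)).2
  · refine hp.trans (le_of_eq ?_)
    rw [← Finset.card_map Fin.valEmbedding]
    congr 1
    ext x
    simp only [S, Finset.mem_filter, Finset.mem_range, Finset.mem_map, Finset.mem_univ, true_and,
      Fin.valEmbedding_apply]
    constructor
    · rintro ⟨hx, h1⟩; exact ⟨⟨x, hx⟩, h1, rfl⟩
    · rintro ⟨v, h1, rfl⟩; exact ⟨v.2, h1⟩

/-- The recorded distance never grows. A clustering that serves enough vertices is rejected only if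
the recorded distance is already smaller. -/
theorem accept_spec (hL : I.L ≤ L) (h : Setup I L a b s) (h3 : s.var 3 = I.p)
    (hC : Clustering I L (I.dist a b) (s.arr 7) (s.arr 8)) (hs : Found I s) :
    Found I (accept.run I s) ∧ (∀ r, Below I s r → Below I (accept.run I s) r) ∧
      (I.p ≤ ((Finset.range n).filter fun v => s.arr 7 v ≠ 0).card →
        Below I (accept.run I s) (I.dist a b)) := by
  have htest : acceptTest.Holds I s ↔
      I.p ≤ ((Finset.range n).filter fun v => s.arr 7 v ≠ 0).card ∧
      ¬ (s.var 8 ≠ 0 ∧ ¬ I.DistLE a b (s.var 6) (s.var 7)) := by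
    rw [acceptTest, holds_conj, holds_le, holds_neg, holds_conj, holds_neg, holds_distLE,
      eval_cnt I 24 (P := fun v => s.arr 7 v ≠ 0) fun i _ => by
        rw [holds_read, eval_var, State.setVar_var_self, State.setVar_arr]]
    simp only [eval_var, holds_var, h3, h.v4, h.v5]
  rw [accept]
  by_cases ht : acceptTest.Holds I s
  · rw [run_ite_pos I ht]
    obtain ⟨h1, h2⟩ := htest.1 ht
    obtain ⟨h4, h5⟩ := write_spec hL h hC h1
    refine ⟨h4, ?_, fun _ => h5⟩
    rintro r ⟨h6, u, v, h7, h8, h9⟩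
    obtain ⟨h10, a', b', h11, h12, h13⟩ := h5
    refine ⟨h10, a', b', h11, h12, h13.trans (le_trans ?_ h9)⟩
    obtain ⟨u₁, u₂, u₃, u₄, e1, e2, e3, e4, h14⟩ := not_not.1 fun h' => h2 ⟨h6, h'⟩
    obtain rfl := Fin.ext e1
    obtain rfl := Fin.ext e2
    obtain rfl := Fin.ext (e3.trans h7)
    obtain rfl := Fin.ext (e4.trans h8)
    exact h14
  · rw [run_ite_neg I ht, run]
    refine ⟨hs, fun r h => h, fun h1 => ?_⟩
    obtain ⟨h2, h4⟩ := not_not.1 fun h' => ht (htest.2 ⟨h1, h'⟩)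
    obtain ⟨u, v, h5, h6, _⟩ := hs h2
    refine ⟨h2, u, v, h5, h6, le_of_lt (not_le.1 fun h7 => h4 ?_)⟩
    exact ⟨a, b, u, v, rfl, rfl, h5.symm, h6.symm, h7⟩

/-! #### The main program -/

theorem Found.congr (h : Found I s) (h6 : s'.var 6 = s.var 6) (h7 : s'.var 7 = s.var 7)
    (h8 : s'.var 8 = s.var 8) (a0 : s'.arr 0 = s.arr 0) (a1 : s'.arr 1 = s.arr 1)
    (a2 : s'.arr 2 = s.arr 2) : Found I s' := by
  intro h0
  obtain ⟨a, b, h1, h2, S, hS, h3⟩ := h (h8 ▸ h0)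
  exact ⟨a, b, h6.trans h1, h7.trans h2, S, ⟨a0 ▸ hS.served, a1 ▸ hS.opened, a2 ▸ hS.assigned⟩, h3⟩

theorem Below.congr {r : ℝ≥0} (h : Below I s r) (h6 : s'.var 6 = s.var 6)
    (h7 : s'.var 7 = s.var 7) (h8 : s'.var 8 = s.var 8) : Below I s' r := by
  obtain ⟨h0, a, b, h1, h2, h3⟩ := h
  exact ⟨h8 ▸ h0, a, b, h6.trans h1, h7.trans h2, h3⟩

def step : LProg := .seq cluster accept

def inner : LProg := .loop 5 step

def outer : LProg := .loop 4 inner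

/-- The `10`-approximation algorithm. -/
def algorithm : LProg :=
  -- Truncated subtraction turns `L` into max(L, 1). If `p = 0`, the untouched memory already
  -- encodes the empty solution.
  .seq (.assign 1 (.add (.var 1) (.sub (.const 1) (.var 1)))) (.ite (.var 3) outer .skip)

/-- A solution of radius at most d(a, b) serves at least `p` vertices and the clustering serves no
fewer, so the test on the number served succeeds. -/
theorem step_spec (hL : L = I.L + (1 - I.L)) (hLU : L ≤ I.U) (h : Setup I L a b s)
    (h3 : s.var 3 = I.p) (hs : Found I s) :
    Found I (step.run I s) ∧ (∀ r, Below I s r → Below I (step.run I s) r) ∧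
      ((∃ T, I.Feasible T ∧ I.radius T ≤ I.dist a b) →
        Below I (step.run I s) (I.dist a b)) := by
  have F := frame_run I cluster s
  have hC := cluster_spec hL hLU h
  obtain ⟨s₁, hs₁⟩ : ∃ s₁, s₁ = cluster.run I s := ⟨_, rfl⟩
  have hrun : step.run I s = accept.run I s₁ := by rw [hs₁]; rfl
  rw [← hs₁] at F hC
  have v6 : s₁.var 6 = s.var 6 := F.var 6 rfl
  have v7 : s₁.var 7 = s.var 7 := F.var 7 rfl
  have v8 : s₁.var 8 = s.var 8 := F.var 8 rfl
  obtain ⟨h4, h5, h6⟩ := accept_spec (by omega) (h.of_frame F) ((F.var 3 rfl).trans h3) hC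
    (hs.congr v6 v7 v8 (F.arr 0 rfl) (F.arr 1 rfl) (F.arr 2 rfl))
  rw [hrun]
  refine ⟨h4, fun r hr => h5 r (hr.congr v6 v7 v8), ?_⟩
  rintro ⟨T, hT, hr⟩
  exact h6 (hT.card_served.trans (hC.served T hT hr))

theorem inner_spec (hL : L = I.L + (1 - I.L)) (hLU : L ≤ I.U) (h0 : s.var 0 = n)
    (h1 : s.var 1 = L) (h2 : s.var 2 = I.U) (h3 : s.var 3 = I.p) (h4 : s.var 4 = a)
    (hs : Found I s) :
    Found I (inner.run I s) ∧ (∀ r, Below I s r → Below I (inner.run I s) r) ∧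
      ∀ b : Fin n, (∃ T, I.Feasible T ∧ I.radius T ≤ I.dist a b) →
        Below I (inner.run I s) (I.dist a b) := by
  obtain ⟨s', hF, ⟨i1, i2, i3⟩, hrun⟩ := run_loop I (x := 5) (c := step) (s := s)
    (fun j s' => Found I s' ∧ (∀ r, Below I s r → Below I s' r) ∧
      ∀ b : Fin n, (b : ℕ) < j → (∃ T, I.Feasible T ∧ I.radius T ≤ I.dist a b) →
        Below I s' (I.dist a b))
    ⟨hs, fun _ h => h, fun _ h => absurd h (Nat.not_lt_zero _)⟩ (by
      rintro j hj s' hF ⟨i1, i2, i3⟩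
      have hF' := frame_trans hF (frame_setVar (c := step) s' j)
      have hset : Setup I L a ⟨j, hj⟩ (s'.setVar 5 j) :=
        ⟨(hF'.var 0 rfl).trans h0, (hF'.var 1 rfl).trans h1, (hF'.var 2 rfl).trans h2,
          (hF'.var 4 rfl).trans h4, State.setVar_var_self _ _ _⟩
      obtain ⟨j1, j2, j3⟩ := step_spec hL hLU hset ((hF'.var 3 rfl).trans h3)
        (i1.congr rfl rfl rfl rfl rfl rfl)
      refine ⟨j1, fun r hr => j2 r ((i2 r hr).congr rfl rfl rfl), fun b hb hT => ?_⟩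
      rcases Nat.lt_succ_iff_lt_or_eq.1 hb with hb | hb
      · exact j2 _ ((i3 b hb hT).congr rfl rfl rfl)
      · obtain rfl : b = ⟨j, hj⟩ := Fin.ext hb
        exact j3 hT)
  rw [inner, hrun]
  exact ⟨i1.congr rfl rfl rfl rfl rfl rfl, fun r hr => (i2 r hr).congr rfl rfl rfl,
    fun b hT => (i3 b b.2 hT).congr rfl rfl rfl⟩

theorem outer_spec (hL : L = I.L + (1 - I.L)) (hLU : L ≤ I.U) (h0 : s.var 0 = n)
    (h1 : s.var 1 = L) (h2 : s.var 2 = I.U) (h3 : s.var 3 = I.p) (hs : s.var 8 = 0) :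
    Found I (outer.run I s) ∧
      ∀ a b : Fin n, (∃ T, I.Feasible T ∧ I.radius T ≤ I.dist a b) →
        Below I (outer.run I s) (I.dist a b) := by
  obtain ⟨s', hF, ⟨i1, i2⟩, hrun⟩ := run_loop I (x := 4) (c := inner) (s := s)
    (fun j s' => Found I s' ∧
      ∀ a : Fin n, (a : ℕ) < j → ∀ b, (∃ T, I.Feasible T ∧ I.radius T ≤ I.dist a b) →
        Below I s' (I.dist a b))
    ⟨fun h => absurd hs h, fun _ h => absurd h (Nat.not_lt_zero _)⟩ (by
      rintro j hj s' hF ⟨i1, i2⟩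
      have hF' := frame_trans hF (frame_setVar (c := inner) s' j)
      obtain ⟨j1, j2, j3⟩ := inner_spec (a := ⟨j, hj⟩) hL hLU ((hF'.var 0 rfl).trans h0)
        ((hF'.var 1 rfl).trans h1) ((hF'.var 2 rfl).trans h2) ((hF'.var 3 rfl).trans h3)
        (State.setVar_var_self s' 4 j) (i1.congr rfl rfl rfl rfl rfl rfl)
      refine ⟨j1, fun a ha b hT => ?_⟩
      rcases Nat.lt_succ_iff_lt_or_eq.1 ha with ha | ha
      · exact j2 _ ((i2 a ha b hT).congr rfl rfl rfl)
      · obtain rfl : a = ⟨j, hj⟩ := Fin.ext ha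
        exact j3 b hT)
  rw [outer, hrun]
  exact ⟨i1.congr rfl rfl rfl rfl rfl rfl, fun a b hT => (i2 a a.2 b hT).congr rfl rfl rfl⟩

theorem algorithm_spec (I : Instance n) (hT : ∃ T, I.Feasible T) :
    ∃ S, (algorithm.run I I.initState).Outputs S ∧ I.IsApprox 10 S := by
  obtain ⟨s, hs⟩ : ∃ s, s = I.initState.setVar 1 (I.L + (1 - I.L)) := ⟨_, rfl⟩
  have hrun : algorithm.run I I.initState = (LProg.ite (.var 3) outer .skip).run I s := by
    rw [hs]; rfl
  have hv : s.var 0 = n ∧ s.var 1 = I.L + (1 - I.L) ∧ s.var 2 = I.U ∧ s.var 3 = I.p ∧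
      s.var 8 = 0 := by
    rw [hs]; simp [State.setVar_var, Instance.initState]
  obtain ⟨h0, h1, h2, h3, h8⟩ := hv
  have htest : (LExpr.var 3).Holds I s ↔ I.p ≠ 0 := by rw [holds_var, h3]
  rw [hrun]
  by_cases hp : I.p = 0
  · rw [run_ite_neg I fun h => htest.1 h hp, run]
    refine ⟨⟨∅, ∅, id⟩, ?_, ?_, fun T _ => ?_⟩
    · rw [hs]
      constructor <;> simp [Instance.initState]
    · constructor <;> simp [hp]
    · simp [Instance.radius]
  · rw [run_ite_pos I (htest.2 hp)]
    have hne : ∀ T, I.Feasible T → T.C.Nonempty := fun T hT =>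
      Finset.card_pos.1 (by have := hT.card_served; omega)
    -- Since `p` is positive, a feasible solution has a nonempty cluster, so `U` is positive.
    have hLU : I.L + (1 - I.L) ≤ I.U := by
      obtain ⟨T, hT⟩ := hT
      obtain ⟨v, hv⟩ := hne T hT
      have h4 := hT.upper _ (hT.mapsTo v hv)
      have h5 : 0 < (T.C.filter fun w => T.φ w = T.φ v).card :=
        Finset.card_pos.2 ⟨v, by simp [hv]⟩
      have := I.L_le_U
      omega
    obtain ⟨h4, h5⟩ := outer_spec rfl hLU h0 h1 h2 h3 h8
    -- The radius of `T` is attained at some pair `v`, `T.φ v`, and this pair is among those tried.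
    have h6 : ∀ T, I.Feasible T → Below I (outer.run I s) (I.radius T) := by
      intro T hT
      obtain ⟨v, hv, h⟩ := Finset.exists_mem_eq_sup T.C (hne T hT) fun v => I.dist v (T.φ v)
      have := h5 v (T.φ v) ⟨T, hT, h.le⟩
      rwa [← h] at this
    obtain ⟨T, hT⟩ := hT
    obtain ⟨a, b, h9, h10, S, hS, h11, h12⟩ := h4 (h6 T hT).1
    refine ⟨S, hS, h11, fun T' hT' => h12.trans ?_⟩
    -- The recorded pair is read off from the final memory, so it is the same for every solution
    -- used in the comparison.
    obtain ⟨_, a', b', h13, h14, h15⟩ := h6 T' hT'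
    obtain rfl := Fin.ext (h9.symm.trans h13)
    obtain rfl := Fin.ext (h10.symm.trans h14)
    gcongr

/-- Every variable of the algorithm is below `30`, so the compiled code can keep its temporaries
from `30` on. -/
theorem algorithm_ok : algorithm.ok 30 = true := by decide

/-- The compiled algorithm is a `10`-approximation and takes polynomial time. -/
theorem algorithm_exec (I : Instance n) :
    ∃ (s : State) (t : ℕ), Prog.Exec I (algorithm.comp 30) I.initState s t ∧
      t ≤ algorithm.time.eval n ∧
      ((∃ T : Solution n, I.Feasible T) → ∃ S : Solution n, s.Outputs S ∧ I.IsApprox 10 S) := by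
  obtain ⟨s, t, h1, h2, h3⟩ := LProg.comp_reaches I (by decide : 0 < 30) algorithm algorithm_ok
    I.initState I.initState (State.Agree.refl _ _) rfl
  refine ⟨s, t, h1, h2, fun hT => ?_⟩
  obtain ⟨S, hS, h⟩ := algorithm_spec I hT
  refine ⟨S, ⟨?_, ?_, ?_⟩, h⟩
  · rw [h3.arr]; exact hS.served
  · rw [h3.arr]; exact hS.opened
  · rw [h3.arr]; exact hS.assigned

end CapCenter

/-- One program and one polynomial work for all instances. The program halts within polynomially
many steps on every instance, and if the instance has a feasible solution, then it outputs a
feasible solution of radius at most `10` times the optimum. -/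
theorem mainTheorem2 :
    ∃ (prog : CapCenter.Prog) (time : Polynomial ℕ),
      ∀ (n : ℕ) (I : CapCenter.Instance n),
        ∃ (s : CapCenter.State) (t : ℕ),
          CapCenter.Prog.Exec I prog I.initState s t ∧
          t ≤ time.eval n ∧
          ((∃ T : CapCenter.Solution n, I.Feasible T) →
            ∃ S : CapCenter.Solution n, s.Outputs S ∧ I.IsApprox 10 S) := by
  exact ⟨_, _, fun n I => CapCenter.algorithm_exec I⟩
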